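/- There are an absolute constant $C$ and a single algorithm such that the following holds for all integers $k\ge 2$, $n\ge 2$, $w\ge 1$, every real $0<\varepsilon\le 1$, and every sequence $S$ over the variables $x_1,\dots,x_n$ in which each variable occurs at most $k$ times. An oblivious branching program of width $w$ with reading order $S$ is a layered program with at most $w$ vertices per layer in which all vertices of the $j$-th layer read the $j$-th variable of $S$; it computes a function $\{0,1\}^n\to\{0,1\}$. A map $G:\{0,1\}^s\to\{0,1\}^m$ $\delta$-fools $f:\{0,1\}^m\to\{0,1\}$ if $|\Pr_{y}[f(G(y))=1]-\Pr_{x}[f(x)=1]|\le\delta$ for uniformly random $y\in\{0,1\}^s$, $x\in\{0,1\}^m$. Let $S'$ be $S$ followed by further reads so that every variable occurs exactly $k$ times ($S'=S$ if this is already so). For a sequence $T$, let $T^{(c)}$ be the subsequence of the $c$-th occurrences of its elements and $T^{(i,j)}$ that of the $i$-th and $j$-th occurrences. Call $T$, in which each of its elements occurs $k$ times, *per-read-monotone* if each $T^{(c)}$, $1\le c\le k$, is increasing or decreasing in the order of first occurrences, and *$k$-regularly-interleaving* if for all $i\ne j$ in $\{1,\dots,k\}$ the sequence $T^{(i,j)}$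 is a concatenation of blocks $A_\ell B_\ell$, where $A_\ell$ and $B_\ell$ each list the elements of a set $X_\ell$ exactly once and the sets $X_\ell$ are disjoint. Then the variables can be partitioned into $t\le \exp(k^2)\cdot n^{1-1/2^{k-1}}$ nonempty parts $Y_1,\dots,Y_t$ such that each restriction $S'|_{Y_i}$ is per-read-monotone and $k$-regularly-interleaving, and there are generators $G_i:\{0,1\}^{s_i}\to\{0,1\}^{|Y_i|}$ with $$s_i\le C\,\log n\cdot(\log(n/\varepsilon)+k\log w)$$ such that: 1. each $G_i$ $(\varepsilon/n)$-fools every width-$w$ oblivious branching program on $|Y_i|$ variables whose reading order can be simulated by a head that moves on a tape of $|Y_i|$ cells (one variable per cell) by at most one cell per step and visits every cell at most $2k$ times; 2. the product $G=G_1^{Y_1}\times\cdots\times G_t^{Y_t}:\{0,1\}^s\to\{0,1\}^n$, $s=\sum_i s_i$, which applies $G_i$ to the $i$-th block of the seed and writes the result into the coordinates $Y_i$ in the order of their first occurrence in $S'$, $\varepsilon$-fools every width-$w$ oblivious branching program with reading order $S$; $$\text{3.}\qquad s\le C\,\exp(k^2)\cdot n^{1-1/2^{k-1}}\cdot\log n\cdot(\log(n/\varepsilon)+k\log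 w);$$ 4. $G$ is efficiently computable: given $n$, $k$, $w$, $\lceil\log_2(1/\varepsilon)\rceil$, $S$ and a seed $y\in\{0,1\}^s$, the algorithm outputs $G(y)$ in time polynomial in $n$, $k$, $\log w$ and $\log(1/\varepsilon)$. -/

import Mathlib

/-! ### Reading sequences -/

namespace ReadK

/-- The subsequence of `S` made of the `c`-th occurrences of elements, for `c ∈ I`; occurrences
are numbered from `1`.  Thus `occurrences S {i}` is `S^{(i)}` and `occurrences S {i, j}` is
`S^{(i,j)}`. -/
def occurrences {α : Type} [DecidableEq α] (S : List α) (I : Finset ℕ) : List α :=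
  ((List.finRange S.length).filter
    (fun p => decide ((S.take (p.1 + 1)).count (S.get p) ∈ I))).map S.get

/-- `x` comes before `y` in the order in which `S` reads its elements for the first time. -/
def FirstReadLT {α : Type} [DecidableEq α] (S : List α) (x y : α) : Prop :=
  S.idxOf x < S.idxOf y

/-- Every `S^{(c)}`, `1 ≤ c ≤ k`, is increasing or decreasing, with respect to the linear order
given by `S^{(1)}`. -/
def PerReadMonotone {α : Type} [DecidableEq α] (k : ℕ) (S : List α) : Prop :=
  ∀ c ∈ Finset.Icc 1 k,
    (occurrences S {c}).Pairwise (fun x y => FirstReadLT S x y) ∨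
    (occurrences S {c}).Pairwise (fun x y => FirstReadLT S y x)

/-- A read-2 sequence is a concatenation of blocks `A ++ B`, where `A` lists the elements of a set
`X_i` once (their first occurrences) and `B` lists the same elements once (their second
occurrences), the sets `X_i` of different blocks being disjoint. -/
def TwoRegularlyInterleaving {α : Type} (T : List α) : Prop :=
  ∃ blocks : List (List α × List α),
    T = (blocks.map (fun b => b.1 ++ b.2)).flatten ∧
    (∀ b ∈ blocks, b.1.Nodup ∧ b.2.Perm b.1) ∧
    blocks.Pairwise (fun b b' => b.1.Disjoint b'.1)

def RegularlyInterleaving {α : Type} [DecidableEq α] (k : ℕ) (S : List α) : Prop :=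
  ∀ i ∈ Finset.Icc 1 k, ∀ j ∈ Finset.Icc 1 k, i ≠ j →
    TwoRegularlyInterleaving (occurrences S {i, j})

/-- The sequence `S` followed by as many further reads as are needed for every variable to be
read at least `k` times.  If `S` reads every variable at most `k` times, the result reads every
variable exactly `k` times, and it is `S` itself if `S` does so already. -/
def padReads {n : ℕ} (k : ℕ) (S : List (Fin n)) : List (Fin n) :=
  S ++ (List.finRange n).flatMap (fun x => List.replicate (k - S.count x) x)

/-- The sequence `T` of reads of tape cells `0, …, m-1` can be simulated by a head that moves by at
most one cell in each step and visits every cell at most `d` times: `walk` lists the successive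
head positions. -/
def HeadVisitsAtMost {m : ℕ} (d : ℕ) (T : List (Fin m)) : Prop :=
  ∃ walk : List (Fin m),
    walk.IsChain (fun a b => a.1 ≤ b.1 + 1 ∧ b.1 ≤ a.1 + 1) ∧
    T.Sublist walk ∧ ∀ c, walk.count c ≤ d

/-! ### Oblivious branching programs and fooling -/

/-- An oblivious layered branching program of width (at most) `w` over the variables `V`: every
layer carries the variable that all its vertices read, and the two maps to the next layer.  The
vertices of the last layer are merged into the two sinks by `accept`. -/
structure ObliviousBP (V : Type) (w : ℕ) where
  layers : List (V × (Bool → Fin w → Fin w))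
  start : Fin w
  accept : Fin w → Bool

/-- The reading order of a program. -/
def ObliviousBP.order {V : Type} {w : ℕ} (B : ObliviousBP V w) : List V :=
  B.layers.map Prod.fst

/-- The boolean function computed by a program. -/
def ObliviousBP.eval {V : Type} {w : ℕ} (B : ObliviousBP V w) (x : V → Bool) : Bool :=
  B.accept (B.layers.foldl (fun v l => l.2 (x l.1) v) B.start)

/-- The probability that `f` accepts a uniformly random bit string of length `m`. -/
noncomputable def prAccept {m : ℕ} (f : (Fin m → Bool) → Bool) : ℝ :=
  ((Finset.univ.filter (fun x => f x = true)).card : ℝ) / 2 ^ m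

/-- The generator `G` `ε`-fools the function `f`. -/
def Fools {s m : ℕ} (ε : ℝ) (G : (Fin s → Bool) → (Fin m → Bool))
    (f : (Fin m → Bool) → Bool) : Prop :=
  |prAccept (fun y => f (G y)) - prAccept f| ≤ ε

/-! ### Partitions of the variables and products of generators -/

/-- A partition of `n` variables into `t` nonempty parts `Y_i`, of sizes `size i`, each with an
enumeration `cell ⟨i, 0⟩, cell ⟨i, 1⟩, …` of its variables. -/
structure OrderedPartition (n t : ℕ) where
  size : Fin t → ℕ
  size_pos : ∀ i, 0 < size i
  cell : (Σ i : Fin t, Fin (size i)) ≃ Fin n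

/-- The restriction `S|_{Y_i}` of a sequence to a part. -/
def OrderedPartition.restrict {n t : ℕ} (Y : OrderedPartition n t) (S : List (Fin n))
    (i : Fin t) : List (Fin n) :=
  S.filter (fun x => decide ((Y.cell.symm x).1 = i))

/-- The product `G_1^{Y_1} × ⋯ × G_t^{Y_t}`: the seed is cut into `t` consecutive blocks of lengths
`len i`, and the output of `G_i` on the `i`-th block is written into the coordinates `Y_i`. -/
def OrderedPartition.product {n t : ℕ} (Y : OrderedPartition n t) (len : Fin t → ℕ)
    (g : ∀ i : Fin t, (Fin (len i) → Bool) → (Fin (Y.size i) → Bool)) :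
    (Fin (∑ i, len i) → Bool) → (Fin n → Bool) :=
  fun y x =>
    g (Y.cell.symm x).1 (fun j => y (finSigmaFinEquiv ⟨(Y.cell.symm x).1, j⟩)) (Y.cell.symm x).2

end ReadK

/-! ### A random access machine with logarithmic cost

Structured programs over natural-number variables and arrays.  Every evaluated subexpression costs
the bit length of its value plus one, so that polynomial time is the usual notion. -/

namespace Ram

structure State where
  var : ℕ → ℕ
  arr : ℕ → ℕ → ℕ

inductive BinOp where
  | add | sub | mul | div | mod

/-- Truncated subtraction and rounded division; division by `0` gives `0`. -/
def BinOp.eval : BinOp → ℕ → ℕ → ℕ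
  | .add, a, b => a + b
  | .sub, a, b => a - b
  | .mul, a, b => a * b
  | .div, a, b => a / b
  | .mod, a, b => a % b

inductive Expr where
  | lit (c : ℕ)
  | var (x : ℕ)
  | get (a : ℕ) (i : Expr)
  | op (o : BinOp) (e₁ e₂ : Expr)

def Expr.eval (σ : State) : Expr → ℕ
  | .lit c => c
  | .var x => σ.var x
  | .get a i => σ.arr a (i.eval σ)
  | .op o e₁ e₂ => o.eval (e₁.eval σ) (e₂.eval σ)

def Expr.cost (σ : State) : Expr → ℕ
  | .lit c => Nat.size c + 1
  | .var x => Nat.size (σ.var x) + 1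
  | .get a i => i.cost σ + Nat.size (σ.arr a (i.eval σ)) + 1
  | .op o e₁ e₂ => e₁.cost σ + e₂.cost σ + Nat.size (o.eval (e₁.eval σ) (e₂.eval σ)) + 1

inductive Cmd where
  | skip
  | assign (x : ℕ) (e : Expr)
  | store (a : ℕ) (i e : Expr)
  | seq (c₁ c₂ : Cmd)
  | ite (e : Expr) (c₁ c₂ : Cmd)
  | loop (e : Expr) (c : Cmd)

/-- `Exec c σ σ' T`: started in state `σ`, the program `c` halts in state `σ'` at cost `T`.
Conditions are true when they are nonzero; `loop e c` repeats `c` while `e` is true. -/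
inductive Exec : Cmd → State → State → ℕ → Prop where
  | skip (σ : State) : Exec .skip σ σ 1
  | assign (x : ℕ) (e : Expr) (σ : State) :
      Exec (.assign x e) σ ⟨Function.update σ.var x (e.eval σ), σ.arr⟩ (e.cost σ + 1)
  | store (a : ℕ) (i e : Expr) (σ : State) :
      Exec (.store a i e) σ
        ⟨σ.var, Function.update σ.arr a (Function.update (σ.arr a) (i.eval σ) (e.eval σ))⟩
        (i.cost σ + e.cost σ + 1)
  | seq {c₁ c₂ : Cmd} {σ σ₁ σ₂ : State} {T₁ T₂ : ℕ} :
      Exec c₁ σ σ₁ T₁ → Exec c₂ σ₁ σ₂ T₂ → Exec (.seq c₁ c₂) σ σ₂ (T₁ + T₂)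
  | iteTrue {e : Expr} {c₁ c₂ : Cmd} {σ σ' : State} {T : ℕ} :
      e.eval σ ≠ 0 → Exec c₁ σ σ' T → Exec (.ite e c₁ c₂) σ σ' (e.cost σ + 1 + T)
  | iteFalse {e : Expr} {c₁ c₂ : Cmd} {σ σ' : State} {T : ℕ} :
      e.eval σ = 0 → Exec c₂ σ σ' T → Exec (.ite e c₁ c₂) σ σ' (e.cost σ + 1 + T)
  | loopTrue {e : Expr} {c : Cmd} {σ σ₁ σ₂ : State} {T₁ T₂ : ℕ} :
      e.eval σ ≠ 0 → Exec c σ σ₁ T₁ → Exec (.loop e c) σ₁ σ₂ T₂ →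
      Exec (.loop e c) σ σ₂ (e.cost σ + 1 + T₁ + T₂)
  | loopFalse {e : Expr} {c : Cmd} {σ : State} :
      e.eval σ = 0 → Exec (.loop e c) σ σ (e.cost σ + 1)

/-- The initial state: the variables `0, …, 5` hold `n`, `k`, `w`, the precision `e`, the length of
`S` and the seed length; array `0` holds the sequence `S` and array `1` holds the seed `y`.
Everything else is `0`. -/
def input (n k w e : ℕ) (S : List (Fin n)) {s : ℕ} (y : Fin s → Bool) : State where
  var x := [n, k, w, e, S.length, s].getD x 0
  arr a i := match a with
    | 0 => (S.map Fin.val).getD i 0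
    | 1 => ((List.ofFn y).map Bool.toNat).getD i 0
    | _ => 0

/-- The program halts at cost at most `T` with the bit string `z` in array `2`. -/
def OutputsWithin {m : ℕ} (c : Cmd) (σ : State) (z : Fin m → Bool) (T : ℕ) : Prop :=
  ∃ σ' T', Exec c σ σ' T' ∧ T' ≤ T ∧ ∀ i : Fin m, σ'.arr 2 i = (z i).toNat

end Ram

open scoped BigOperators

namespace ReadK

/-! ### Averages over finite products -/

/-! Partition. Time-stamp the reads of the padded sequence. Making the `c`-th reads monotone is an
Erdős–Szekeres argument: inside each class compare the orders of first and of `c`-th reads. As long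
as some class contains a chain of `K` elements increasing in both orders, the chain is split off as
a class of its own, at most `n / K` times in all. What remains of a class has no such chain, so it
splits by rank into at most `K - 1` antichains, on each of which the `c`-th read reverses the order.
Hence `T` classes become at most `n / K + T * (K - 1)`, and with `K` about `n ^ (1 / 2 ^ (r + 1))`
in the step for read `r + 2` there are at most `k * n ^ (1 - 1 / 2 ^ (k - 1))` classes in the end
(`numClasses_mono_le`, `numClasses_monoLab_le`). For two reads `i < j`, view each variable as the
interval between them, and let its level be the length of a longest sequence of intervals that
precede it, each ending before the next begins. Only neighbouring levels can overlap, so splitting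
by the parity of the level gives regular interleaving (`pairLevel_regular`). The `k * k` parity
steps cost a factor `2 ^ (k * k)`, and `k * 2 ^ (k * k) ≤ exp (k ^ 2)`.

Simulation. On a part whose cells are ordered by first reads, regularity allows three kinds of
steps: at most one cell forward in the current direction, backwards against it, or a turn at an end
of the tape (`headVisits_of_regular`). A backward jump is walked over cells that still have a spare
visit from their own reads, so two visits for each read suffice (`exists_walk_of_regularStep`).

Generator. On each part Nisan's generator is used: a block of `M` bits is expanded `d` times, each
time by one Toeplitz hash function that turns every block `z` into the pair of `z` and its hash. Fix
a pair of neighbouring segments. A program of width `w` whose head changes fewer than `Q` times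
between the left segment, the right one and the rest is a sum over at most `w ^ Q` transcripts of
products of functions of the three (`exists_transcripts`). A random hash function errs by at most `2
^ (-M / 2)` on each product (`toeplitzHash_mixing`), which gives the total error `(2 ^ d - 1) * w ^
Q * 2 ^ (-M / 2)` (`genBlock_fools`). If every cell is visited at most `2 * k` times, then `Q = 12 *
k + 1` works at every scale (`crossBound_of_adjacent`). For the product of the generators, fixing
all parts but one leaves a program of width `w` on that part, and the hybrid argument adds up at
most `n` errors `ε / n`.

Running time. All objects are defined by bounded recursions (`least`, `rank`, `mark`, …) that a
program can follow. The polynomial-time functions `PT` are closed under composition, counted loops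
and loops on tables stored as the digits of one number (`PT.iter`, `PT.iterTable`), which covers the
output bits (`PT.out`). -/

theorem expect_update {ι : Type} [Fintype ι] [DecidableEq ι] {B : ι → Type}
    [∀ i, Fintype (B i)] [∀ i, Nonempty (B i)] (j : ι) (G : (∀ i, B i) → ℝ) :
    𝔼 b : (∀ i, B i), 𝔼 c : B j, G (Function.update b j c) = 𝔼 b, G b := by
  have h1 : 𝔼 p : (∀ i, B i) × B j, G (Function.update p.1 j p.2)
      = 𝔼 p : (∀ i, B i) × B j, G p.1 := by
    apply Fintype.expect_bijective (fun p : (∀ i, B i) × B j => (Function.update p.1 j p.2, p.1 j))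
    · apply Function.Involutive.bijective
      rintro ⟨b, c⟩
      simp
    · rintro ⟨b, c⟩
      rfl
  rw [← Finset.univ_product_univ, Finset.expect_product, Finset.expect_product] at h1
  simpa using h1

theorem abs_expect_sub_expect_le {α : Type} [Fintype α] [Nonempty α] (f g : α → ℝ) (η : ℝ)
    (h : ∀ a, |f a - g a| ≤ η) : |𝔼 a, f a - 𝔼 a, g a| ≤ η := by
  rw [← Finset.expect_sub_distrib]
  refine (Finset.abs_expect_le _ _).trans ?_
  exact Finset.expect_le Finset.univ_nonempty (fun a _ => h a)

/-- The hybrid argument: the coordinates of a random point are replaced one at a time. -/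
theorem abs_expect_pi_sub_le {ι : Type} [Fintype ι] [DecidableEq ι] {A B : ι → Type}
    [∀ i, Fintype (A i)] [∀ i, Nonempty (A i)] [∀ i, Fintype (B i)] [∀ i, Nonempty (B i)]
    (φ : ∀ i, A i → B i) (F : (∀ i, B i) → ℝ) (η : ι → ℝ)
    (h : ∀ j (z : ∀ i, B i), |𝔼 a, F (Function.update z j (φ j a)) -
      𝔼 b, F (Function.update z j b)| ≤ η j) :
    |𝔼 a : (∀ i, A i), F (fun i => φ i (a i)) - 𝔼 b, F b| ≤ ∑ i, η i := by
  classical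
  -- Coordinates in `s` already come from the generator; the others are uniform.
  let mix (s : Finset ι) (a : ∀ i, A i) (b : ∀ i, B i) : ∀ i, B i :=
    fun i => if i ∈ s then φ i (a i) else b i
  have key : ∀ s : Finset ι, |𝔼 a, 𝔼 b, F (mix s a b) - 𝔼 b, F b| ≤ ∑ i ∈ s, η i := by
    intro s
    induction s using Finset.induction_on with
    | empty => simp [mix]
    | insert j s hj ih =>
      -- Resampling coordinate `j` does not change an average; it isolates the one coordinate in
      -- which two neighbouring hybrids differ.
      have e1 : 𝔼 a, 𝔼 b, F (mix (insert j s) a b)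
          = 𝔼 a, 𝔼 b, 𝔼 a', F (Function.update (mix s a b) j (φ j a')) := by
        rw [← expect_update j]
        refine Finset.expect_congr rfl fun a _ => ?_
        rw [Finset.expect_comm]
        refine Finset.expect_congr rfl fun b _ => Finset.expect_congr rfl fun a' _ => ?_
        congr 1
        funext i
        by_cases hij : i = j
        · subst hij
          simp [mix]
        · simp [mix, hij]
      have e2 : 𝔼 a, 𝔼 b, F (mix s a b)
          = 𝔼 a, 𝔼 b, 𝔼 b', F (Function.update (mix s a b) j b') := by
        refine Finset.expect_congr rfl fun a _ => ?_
        rw [← expect_update j]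
        refine Finset.expect_congr rfl fun b _ => Finset.expect_congr rfl fun b' _ => ?_
        congr 1
        funext i
        by_cases hij : i = j
        · subst hij
          simp [mix, hj]
        · simp [mix, hij]
      have e3 : |𝔼 a, 𝔼 b, F (mix (insert j s) a b) - 𝔼 a, 𝔼 b, F (mix s a b)| ≤ η j := by
        rw [e1, e2]
        exact abs_expect_sub_expect_le _ _ _ fun a =>
          abs_expect_sub_expect_le _ _ _ fun b => h j _
      rw [Finset.sum_insert hj]
      calc _ = |(𝔼 a, 𝔼 b, F (mix (insert j s) a b) - 𝔼 a, 𝔼 b, F (mix s a b))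
            + (𝔼 a, 𝔼 b, F (mix s a b) - 𝔼 b, F b)| := by ring_nf
        _ ≤ _ := (abs_add_le _ _).trans (add_le_add e3 ih)
  simpa [mix] using key Finset.univ

/-- The average of `F (φ a + b)` over `a` does not depend on `b`, because `b` is some `φ a₀` and `a`
may be translated by `a₀`. Averaging over both variables, in either order, gives the two sides. -/
theorem expect_comp_surjective {A B : Type} [Fintype A] [Fintype B] [AddCommGroup A]
    [AddCommGroup B] (φ : A →+ B) (hφ : Function.Surjective φ) (F : B → ℝ) :
    𝔼 a, F (φ a) = 𝔼 b, F b := by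
  have h1 : ∀ b, 𝔼 a, F (φ a + b) = 𝔼 a, F (φ a) := by
    intro b
    obtain ⟨a₀, rfl⟩ := hφ b
    exact Fintype.expect_equiv (Equiv.addRight a₀) _ _ (fun a => by simp)
  have h2 : ∀ a, 𝔼 b, F (φ a + b) = 𝔼 b, F b := fun a =>
    Fintype.expect_equiv (Equiv.addLeft (φ a)) _ _ (fun b => by simp)
  calc 𝔼 a, F (φ a) = 𝔼 b : B, 𝔼 a, F (φ a + b) := by simp [h1]
    _ = 𝔼 a : A, 𝔼 b, F (φ a + b) := Finset.expect_comm _ _ _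
    _ = 𝔼 b, F b := by simp [h2]

/-! ### Pairwise independent hashing with Toeplitz matrices -/

/-- `a` holds the diagonals of a Toeplitz matrix and `b` a shift. -/
def toeplitzHash {M : ℕ} (h : (Fin (2 * M) → Bool) × (Fin M → Bool)) (x : Fin M → Bool) :
    Fin M → Bool :=
  fun j => h.2 j + ∑ l : Fin M, h.1 ⟨j + l, by omega⟩ * x l

/-- Let `m` be the last position where `x` is nonzero. Row `j` involves only the diagonals `j, …, j
+ m`, and the last of these occurs in no earlier row with nonzero coefficient, so the rows can be
solved one after the other. Arithmetic in `Bool` is that of the field with two elements. -/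
theorem toeplitz_surjective {M : ℕ} (x : Fin M → Bool) (hx : x ≠ 0) (y : Fin M → Bool) :
    ∃ a : Fin (2 * M) → Bool, ∀ j : Fin M, ∑ l : Fin M, a ⟨j + l, by omega⟩ * x l = y j := by
  classical
  obtain ⟨l₀, hl₀⟩ : ∃ l, x l ≠ 0 := by
    by_contra hcon
    push Not at hcon
    exact hx (funext hcon)
  obtain ⟨m, hm, hmax⟩ := (Finset.univ.filter fun l => x l ≠ 0).exists_max_image id ⟨l₀, by simp [hl₀]⟩
  have hxm : x m = 1 := by
    have : x m ≠ 0 := by simpa using hm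
    revert this
    generalize x m = b
    revert b
    decide
  have hzero : ∀ l, m < l → x l = 0 := by
    intro l hl
    by_contra hne
    have := hmax l (by simp [hne])
    simp only [id] at this
    exact absurd hl (not_lt.mpr this)
  have step : ∀ r ≤ M, ∃ a : ℕ → Bool, ∀ j : Fin M, j < r → ∑ l : Fin M, a (j + l) * x l = y j := by
    intro r
    induction r with
    | zero => exact fun _ => ⟨0, fun j hj => absurd hj (Nat.not_lt_zero _)⟩
    | succ r ih =>
      intro hr
      obtain ⟨a, ha⟩ := ih (by omega)
      let v : Bool := y ⟨r, by omega⟩ + ∑ l ∈ Finset.univ.erase m, a (r + l) * x l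
      refine ⟨Function.update a (r + m) v, fun j hj => ?_⟩
      rcases Nat.lt_succ_iff_lt_or_eq.mp hj with hj' | hj'
      · rw [← ha j hj']
        refine Finset.sum_congr rfl fun l _ => ?_
        by_cases hlm : m < l
        · simp [hzero l hlm]
        · rw [Function.update_of_ne]
          have : (l : ℕ) ≤ m := by simpa using hlm
          omega
      · have hjr : j = ⟨r, by omega⟩ := Fin.ext hj'
        rw [← Finset.add_sum_erase _ _ (Finset.mem_univ m)]
        have : ∑ l ∈ Finset.univ.erase m, Function.update a (r + m) v (j + l) * x l
            = ∑ l ∈ Finset.univ.erase m, a (r + l) * x l := by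
          refine Finset.sum_congr rfl fun l hl => ?_
          have hne : (l : ℕ) ≠ m := fun hcon => (Finset.ne_of_mem_erase hl) (Fin.ext hcon)
          rw [hj', Function.update_of_ne (by omega)]
        rw [this, hj', Function.update_self, hxm, mul_one, hjr]
        simp only [v]
        rw [add_assoc, BooleanRing.add_self, add_zero]
  obtain ⟨a, ha⟩ := step M le_rfl
  exact ⟨fun i => a i, fun j => ha j j.2⟩

/-- For fixed inputs the pair of hash values is additive in the key. It is onto: the Toeplitz matrix
applied to the nonzero vector `x + x'` realizes any difference of values, and the shift then adjusts
the first value. So a random key gives a uniform pair. -/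
theorem toeplitzHash_pairwise {M : ℕ} (x x' : Fin M → Bool) (hx : x ≠ x')
    (F : (Fin M → Bool) → (Fin M → Bool) → ℝ) :
    𝔼 h, F (toeplitzHash h x) (toeplitzHash h x') = 𝔼 y, 𝔼 y', F y y' := by
  let φ : ((Fin (2 * M) → Bool) × (Fin M → Bool)) →+ (Fin M → Bool) × (Fin M → Bool) :=
    { toFun := fun h => (toeplitzHash h x, toeplitzHash h x')
      map_zero' := by
        ext j <;> simp [toeplitzHash]
      map_add' := by
        rintro ⟨a, b⟩ ⟨a', b'⟩
        ext j <;> simp only [toeplitzHash, Prod.mk_add_mk, Pi.add_apply, add_mul,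
          Finset.sum_add_distrib] <;> abel_nf }
  have hφ : Function.Surjective φ := by
    rintro ⟨y, y'⟩
    have hne : x + x' ≠ 0 := by
      intro hcon
      apply hx
      funext j
      have := congrFun hcon j
      simp only [Pi.add_apply, Pi.zero_apply] at this
      revert this
      generalize x j = b
      generalize x' j = c
      revert b c
      decide
    obtain ⟨a, ha⟩ := toeplitz_surjective (x + x') hne (y + y')
    refine ⟨(a, fun j => y j + ∑ l : Fin M, a ⟨j + l, by omega⟩ * x l), ?_⟩
    refine Prod.ext ?_ ?_
    · funext j
      simp only [φ, toeplitzHash, AddMonoidHom.coe_mk, ZeroHom.coe_mk]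
      rw [add_assoc, BooleanRing.add_self, add_zero]
    · funext j
      have := ha j
      simp only [Pi.add_apply, mul_add, Finset.sum_add_distrib] at this
      simp only [φ, toeplitzHash, AddMonoidHom.coe_mk, ZeroHom.coe_mk]
      rw [add_assoc, this, ← add_assoc, BooleanRing.add_self, zero_add]
  have := expect_comp_surjective φ hφ (fun p => F p.1 p.2)
  rw [← Finset.univ_product_univ, Finset.expect_product, ← Finset.univ_product_univ,
    Finset.expect_product] at this
  rw [← Finset.univ_product_univ, Finset.expect_product]
  exact this

/-- A random hash function behaves like an independent sample with respect to any rectangle. -/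
theorem toeplitzHash_mixing {M : ℕ} (A B : (Fin M → Bool) → ℝ) (hA : ∀ x, |A x| ≤ 1)
    (hB : ∀ x, B x = 0 ∨ B x = 1) :
    𝔼 h, |𝔼 x, A x * B (toeplitzHash h x) - 𝔼 x, 𝔼 y, A x * B y| ≤ 1 / Real.sqrt (2 ^ M) := by
  set β := 𝔼 y, B y with hβ
  have hβ0 : 0 ≤ β := Finset.expect_nonneg fun y _ => by rcases hB y with h | h <;> simp [h]
  have hβ1 : β ≤ 1 := Finset.expect_le Finset.univ_nonempty fun y _ => by
    rcases hB y with h | h <;> simp [h]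
  -- Centring `B` removes the product of averages. Since `C` has mean zero, pairwise independence
  -- leaves only the diagonal `x = x'` in the second moment.
  let C : (Fin M → Bool) → ℝ := fun y => B y - β
  have hC : ∀ y, |C y| ≤ 1 := fun y => by
    rcases hB y with h | h <;> simp only [C, h, abs_le] <;> constructor <;> linarith
  have hC0 : 𝔼 y, C y = 0 := by
    simp only [C, Finset.expect_sub_distrib, Fintype.expect_const]
    rw [hβ, sub_self]
  have hD : ∀ h : (Fin (2 * M) → Bool) × (Fin M → Bool),
      𝔼 x, A x * B (toeplitzHash h x) - 𝔼 x, 𝔼 y, A x * B y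
        = 𝔼 x, A x * C (toeplitzHash h x) := by
    intro h
    rw [← Finset.expect_sub_distrib]
    refine Finset.expect_congr rfl fun x _ => ?_
    rw [← Finset.mul_expect]
    simp only [C]
    ring
  simp only [hD]
  have hsq : 𝔼 h : (Fin (2 * M) → Bool) × (Fin M → Bool), (𝔼 x, A x * C (toeplitzHash h x)) ^ 2
      ≤ 1 / 2 ^ M := by
    have e1 : 𝔼 h : (Fin (2 * M) → Bool) × (Fin M → Bool), (𝔼 x, A x * C (toeplitzHash h x)) ^ 2
        = 𝔼 x, 𝔼 x', 𝔼 h : (Fin (2 * M) → Bool) × (Fin M → Bool),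
          A x * A x' * (C (toeplitzHash h x) * C (toeplitzHash h x')) := by
      calc _ = 𝔼 h : (Fin (2 * M) → Bool) × (Fin M → Bool), 𝔼 x, 𝔼 x',
            A x * A x' * (C (toeplitzHash h x) * C (toeplitzHash h x')) := by
            refine Finset.expect_congr rfl fun h _ => ?_
            rw [sq, Fintype.expect_mul_expect]
            refine Finset.expect_congr rfl fun x _ => Finset.expect_congr rfl fun x' _ => ?_
            ring
        _ = 𝔼 x, 𝔼 h : (Fin (2 * M) → Bool) × (Fin M → Bool), 𝔼 x',
            A x * A x' * (C (toeplitzHash h x) * C (toeplitzHash h x')) := Finset.expect_comm _ _ _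
        _ = _ := Finset.expect_congr rfl fun x _ => Finset.expect_comm _ _ _
    rw [e1]
    have e2 : ∀ x x' : Fin M → Bool, 𝔼 h : (Fin (2 * M) → Bool) × (Fin M → Bool),
        A x * A x' * (C (toeplitzHash h x) * C (toeplitzHash h x')) ≤ if x = x' then 1 else 0 := by
      intro x x'
      split_ifs with hxx
      · subst hxx
        refine Finset.expect_le Finset.univ_nonempty fun h _ => ?_
        refine (le_abs_self _).trans ?_
        rw [abs_mul, abs_mul, abs_mul]
        have h1 := hA x
        have h2 := hC (toeplitzHash h x)
        have h3 := abs_nonneg (A x)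
        have h4 := abs_nonneg (C (toeplitzHash h x))
        exact mul_le_one₀ (mul_le_one₀ h1 h3 h1) (by positivity) (mul_le_one₀ h2 h4 h2)
      · rw [← Finset.mul_expect, toeplitzHash_pairwise x x' hxx (fun y y' => C y * C y'),
          ← Fintype.expect_mul_expect, hC0]
        simp
    calc _ ≤ 𝔼 x : Fin M → Bool, 𝔼 x' : Fin M → Bool, (if x = x' then (1 : ℝ) else 0) :=
          Finset.expect_le_expect fun x _ => Finset.expect_le_expect fun x' _ => e2 x x'
      _ = 1 / 2 ^ M := by
          have : ∀ x : Fin M → Bool, 𝔼 x' : Fin M → Bool, (if x = x' then (1 : ℝ) else 0)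
              = 1 / 2 ^ M := by
            intro x
            rw [Fintype.expect_eq_sum_div_card]
            simp
          simp only [this, Fintype.expect_const]
  -- The square of the mean absolute value is at most the second moment, because a variance is
  -- nonnegative.
  have hjensen : (𝔼 h : (Fin (2 * M) → Bool) × (Fin M → Bool),
      |𝔼 x, A x * C (toeplitzHash h x)|) ^ 2 ≤ 1 / 2 ^ M := by
    refine le_trans ?_ hsq
    set f : (Fin (2 * M) → Bool) × (Fin M → Bool) → ℝ :=
      fun h => |𝔼 x, A x * C (toeplitzHash h x)| with hf
    have h0 : 0 ≤ 𝔼 h, (f h - 𝔼 g, f g) ^ 2 := Finset.expect_nonneg fun h _ => sq_nonneg _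
    have h1 : 𝔼 h, (f h - 𝔼 g, f g) ^ 2 = 𝔼 h, (f h) ^ 2 - (𝔼 g, f g) ^ 2 := by
      have : ∀ h, (f h - 𝔼 g, f g) ^ 2 = (f h) ^ 2 - (2 * 𝔼 g, f g) * f h + (𝔼 g, f g) ^ 2 :=
        fun h => by ring
      simp only [this, Finset.expect_add_distrib, Finset.expect_sub_distrib, Fintype.expect_const,
        ← Finset.mul_expect]
      ring
    have h2 : ∀ h, (f h) ^ 2 = (𝔼 x, A x * C (toeplitzHash h x)) ^ 2 := fun h => sq_abs _
    simp only [h2] at h1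
    linarith
  rw [one_div, ← Real.sqrt_inv]
  refine Real.le_sqrt_of_sq_le ?_
  simpa using hjensen

end ReadK

namespace ReadK

/-! ### Layered programs over an arbitrary alphabet and their transcripts -/

/-- The state reached from `v` on the input `x`. -/
def runLayers {κ V : Type} {w : ℕ} (P : List (κ × (V → Fin w → Fin w))) (x : κ → V) (v : Fin w) :
    Fin w :=
  P.foldl (fun v l => l.2 (x l.1) v) v

/-- The number of changes of label between consecutive entries of a list. -/
def changes {κ Λ : Type} [DecidableEq Λ] (lab : κ → Λ) : List κ → ℕ
  | [] => 0
  | [_] => 0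
  | a :: b :: l => (if lab a = lab b then 0 else 1) + changes lab (b :: l)

theorem changes_map {κ κ' Λ : Type} [DecidableEq Λ] (lab : κ' → Λ) (f : κ → κ') (l : List κ) :
    changes lab (l.map f) = changes (fun c => lab (f c)) l := by
  induction l with
  | nil => rfl
  | cons a l ih =>
    cases l with
    | nil => rfl
    | cons b l =>
      simp only [List.map_cons, changes] at ih ⊢
      rw [ih]

/-- Consecutive layers with equal labels are merged into one piece. -/
theorem exists_pieces {κ V Λ : Type} [DecidableEq Λ] {w : ℕ} (lab : κ → Λ)
    (l : κ × (V → Fin w → Fin w)) (P : List (κ × (V → Fin w → Fin w))) :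
    ∃ (p : Λ × ((κ → V) → Fin w → Fin w)) (ps : List (Λ × ((κ → V) → Fin w → Fin w))),
      p.1 = lab l.1 ∧ ps.length = changes lab ((l :: P).map Prod.fst) ∧
      (∀ q ∈ p :: ps, ∀ x y : κ → V, (∀ c, lab c = q.1 → x c = y c) → q.2 x = q.2 y) ∧
      ∀ x v, runLayers (l :: P) x v = (p :: ps).foldl (fun v q => q.2 x v) v := by
  induction P generalizing l with
  | nil =>
    refine ⟨(lab l.1, fun x => l.2 (x l.1)), [], rfl, rfl, ?_, fun x v => rfl⟩
    intro q hq x y hxy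
    obtain rfl : q = _ := by simpa using hq
    simp [hxy l.1 rfl]
  | cons l' P ih =>
    obtain ⟨p, ps, hp, hlen, hdep, hrun⟩ := ih l'
    by_cases hll : lab l.1 = lab l'.1
    · refine ⟨(lab l.1, fun x v => p.2 x (l.2 (x l.1) v)), ps, rfl, ?_, ?_, ?_⟩
      · simp only [List.map_cons, changes, hll] at hlen ⊢
        simpa using hlen
      · intro q hq x y hxy
        rcases List.mem_cons.mp hq with rfl | hq
        · funext v
          have h1 : p.2 x = p.2 y := hdep p (by simp) x y fun c hc => hxy c (by
            simp only
            rw [hc, hp, hll])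
          simp only [h1, hxy l.1 rfl]
        · exact hdep q (by simp [hq]) x y hxy
      · intro x v
        have := hrun x (l.2 (x l.1) v)
        simpa [runLayers] using this
    · refine ⟨(lab l.1, fun x => l.2 (x l.1)), p :: ps, rfl, ?_, ?_, ?_⟩
      · simp only [List.map_cons, changes, hll, List.length_cons] at hlen ⊢
        simp [hlen, add_comm]
      · intro q hq x y hxy
        rcases List.mem_cons.mp hq with rfl | hq
        · simp [hxy l.1 rfl]
        · exact hdep q hq x y hxy
      · intro x v
        have := hrun x (l.2 (x l.1) v)
        simpa [runLayers] using this

/-- A program is a sum of products of functions of the separate label classes, one for each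
transcript of the states between the pieces. -/
theorem exists_transcripts {κ V : Type} {w : ℕ} (lab : κ → Fin 3)
    (ps : List (Fin 3 × ((κ → V) → Fin w → Fin w)))
    (hdep : ∀ q ∈ ps, ∀ x y : κ → V, (∀ c, lab c = q.1 → x c = y c) → q.2 x = q.2 y)
    (g : Fin w → ℝ) (hg : ∀ v, g v = 0 ∨ g v = 1) :
    ∃ (T : Type) (_ : Fintype T) (a : Fin 3 → Fin w → T → (κ → V) → ℝ),
      Fintype.card T = w ^ ps.length ∧
      (∀ i v τ x, a i v τ x = 0 ∨ a i v τ x = 1) ∧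
      (∀ i v τ x y, (∀ c, lab c = i → x c = y c) → a i v τ x = a i v τ y) ∧
      ∀ x v, g (ps.foldl (fun v q => q.2 x v) v) =
        ∑ τ, a 0 v τ x * a 1 v τ x * a 2 v τ x := by
  induction ps with
  | nil =>
    -- The final value depends on no variable, so any one of the three factors may carry it.
    refine ⟨Unit, inferInstance, fun i v _ _ => if i = 2 then g v else 1, by simp, ?_, ?_, ?_⟩
    · intro i v τ x
      beta_reduce
      split_ifs
      · exact hg v
      · simp
    · simp
    · simp
  | cons p ps ih =>
    obtain ⟨T, hT, a, hcard, ha, hdepa, hsum⟩ := ih fun q hq => hdep q (by simp [hq])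
    -- A transcript records the state after each piece. Whether the piece `p` leads from `v` to the
    -- recorded state depends on the class `p.1` alone, so this check goes into that factor.
    refine ⟨Fin w × T, inferInstance, fun i v τ x =>
      (if i = p.1 then (if p.2 x v = τ.1 then 1 else 0) else 1) * a i τ.1 τ.2 x, ?_, ?_, ?_, ?_⟩
    · simp [hcard, pow_succ, mul_comm]
    · intro i v τ x
      beta_reduce
      rcases ha i τ.1 τ.2 x with h | h <;> split_ifs <;> simp [h]
    · intro i v τ x y hxy
      have h1 := hdepa i τ.1 τ.2 x y hxy
      beta_reduce
      split_ifs with h2 h3 h4 h5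
      · rw [h1]
      · exact absurd (by rw [← hdep p (by simp) x y (h2 ▸ hxy)]; exact h3) h4
      · exact absurd (by rw [hdep p (by simp) x y (h2 ▸ hxy)]; exact h5) h3
      · rw [h1]
      · rw [h1]
    · intro x v
      rw [List.foldl_cons, hsum x (p.2 x v), Fintype.sum_prod_type,
        Finset.sum_eq_single (p.2 x v)]
      · refine Finset.sum_congr rfl fun τ _ => ?_
        simp
      · intro v' _ hv'
        refine Finset.sum_eq_zero fun τ _ => ?_
        obtain ⟨i, f⟩ := p
        simp only at hv' ⊢
        rw [if_neg (Ne.symm hv')]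
        fin_cases i <;> simp
      · simp

/-! ### The recursive generator -/

/-- The label of a cell with respect to the pair of cells `2s, 2s+1`. -/
def pairLabel (s c : ℕ) : Fin 3 := if c = 2 * s then 0 else if c = 2 * s + 1 then 1 else 2

/-- At every scale, the list of cells enters and leaves the members of each pair of neighbouring
segments few times. -/
def CrossBound (Q : ℕ) (l : List ℕ) : Prop :=
  ∀ i s, changes (pairLabel s) (l.map (· / 2 ^ i)) < Q

/-- The block written into cell `c` of a tape with `2 ^ d` cells. -/
def genBlock {M : ℕ} : (d : ℕ) → (Fin d → (Fin (2 * M) → Bool) × (Fin M → Bool)) →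
    (Fin M → Bool) → ℕ → Fin M → Bool
  | 0, _, x, _ => x
  | d + 1, hs, x, c =>
    let z := genBlock d (fun i => hs i.castSucc) x (c / 2)
    if c % 2 = 1 then toeplitzHash (hs (Fin.last d)) z else z

/-- The pair that contains a cell. -/
def halfCell (d : ℕ) (c : Fin (2 ^ (d + 1))) : Fin (2 ^ d) :=
  ⟨c.1 / 2, Nat.div_lt_of_lt_mul (by rw [mul_comm, ← pow_succ]; exact c.2)⟩

/-- The two halves of a pair. -/
def pairCell {V : Type} (d : ℕ) (b : Fin (2 ^ d) → V × V) (c : Fin (2 ^ (d + 1))) : V :=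
  if c.1 % 2 = 1 then (b (halfCell d c)).2
  else (b (halfCell d c)).1

theorem pairCell_bijective {V : Type} (d : ℕ) :
    Function.Bijective (pairCell d : (Fin (2 ^ d) → V × V) → _) := by
  refine ⟨fun b b' h => ?_, fun x => ?_⟩
  · funext s
    have hs := s.2
    have h0 := congrFun h ⟨2 * s, by rw [pow_succ]; omega⟩
    have h1 := congrFun h ⟨2 * s + 1, by rw [pow_succ]; omega⟩
    have e0 : (2 * (s : ℕ)) / 2 = s := by omega
    have e1 : (2 * (s : ℕ) + 1) / 2 = s := by omega
    have e2 : (2 * (s : ℕ)) % 2 = 0 := by omega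
    have e3 : (2 * (s : ℕ) + 1) % 2 = 1 := by omega
    simp only [pairCell, halfCell, e0, e1, e2, e3] at h0 h1
    exact Prod.ext (by simpa using h0) (by simpa using h1)
  · refine ⟨fun s => (x ⟨2 * s, by have := s.2; rw [pow_succ]; omega⟩,
      x ⟨2 * s + 1, by have := s.2; rw [pow_succ]; omega⟩), ?_⟩
    funext c
    simp only [pairCell, halfCell]
    split_ifs with hc
    · congr 1
      ext
      simp only
      omega
    · congr 1
      ext
      simp only
      omega

theorem pairLabel_zero_iff {s c : ℕ} : pairLabel s c = 0 ↔ c = 2 * s := by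
  unfold pairLabel
  split_ifs <;> simp_all

theorem pairLabel_one_iff {s c : ℕ} : pairLabel s c = 1 ↔ c = 2 * s + 1 := by
  unfold pairLabel
  split_ifs <;> simp_all

theorem pairLabel_two_iff {s c : ℕ} : pairLabel s c = 2 ↔ c / 2 ≠ s := by
  unfold pairLabel
  split_ifs with h1 h2
  · simp; omega
  · simp; omega
  · simp; omega

/-- Replacing one pair of independent blocks by a block and its hash. -/
theorem exists_pair_bound {M w d Q : ℕ} (hw : 0 < w)
    (P : List (Fin (2 ^ (d + 1)) × ((Fin M → Bool) → Fin w → Fin w)))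
    (s : Fin (2 ^ d))
    (hcross : changes (pairLabel s) (P.map fun l => l.1.1) < Q) (v : Fin w)
    (g : Fin w → ℝ) (hg : ∀ v, g v = 0 ∨ g v = 1) :
    ∃ η : (Fin (2 * M) → Bool) × (Fin M → Bool) → ℝ,
      𝔼 h, η h ≤ w ^ Q * (1 / Real.sqrt (2 ^ M)) ∧
      ∀ h (z : Fin (2 ^ d) → (Fin M → Bool) × (Fin M → Bool)),
        |𝔼 a, g (runLayers P (pairCell d (Function.update z s (a, toeplitzHash h a))) v) -
          𝔼 b : (Fin M → Bool) × (Fin M → Bool),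
            g (runLayers P (pairCell d (Function.update z s b)) v)| ≤ η h := by
  have hδ : 0 ≤ 1 / Real.sqrt (2 ^ M) := by positivity
  rcases P with _ | ⟨l, P⟩
  · refine ⟨fun _ => 0, by simp only [Finset.expect_const_zero]; positivity, fun h z => ?_⟩
    simp [runLayers]
  obtain ⟨p, ps, -, hlen, hdep, hrun⟩ := exists_pieces (fun c => pairLabel s c.1) l P
  obtain ⟨T, hT, a, hcard, ha, hdepa, hsum⟩ :=
    exists_transcripts (fun c : Fin (2 ^ (d + 1)) => pairLabel s c.1) (p :: ps) hdep g hg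
  let A : T → (Fin M → Bool) → ℝ := fun τ u => a 0 v τ fun _ => u
  let B : T → (Fin M → Bool) → ℝ := fun τ u => a 1 v τ fun _ => u
  -- The two members of the pair and the rest of the tape separate. The third factor does not see
  -- the pair, so it is common to both averages, and it is at most one.
  have hfact : ∀ z b, g (runLayers (l :: P) (pairCell d (Function.update z s b)) v) =
      ∑ τ, A τ b.1 * B τ b.2 * a 2 v τ (pairCell d z) := by
    intro z b
    rw [hrun, hsum]
    refine Finset.sum_congr rfl fun τ _ => ?_
    congr 1
    · congr 1
      · refine hdepa 0 v τ _ _ fun c hc => ?_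
        have hc' := pairLabel_zero_iff.mp hc
        have e : halfCell d c = s :=
          Fin.ext (by simp only [halfCell]; omega)
        have e2 : ¬ c.1 % 2 = 1 := by omega
        simp only [pairCell, e, if_neg e2, Function.update_self]
      · refine hdepa 1 v τ _ _ fun c hc => ?_
        have hc' := pairLabel_one_iff.mp hc
        have e : halfCell d c = s :=
          Fin.ext (by simp only [halfCell]; omega)
        have e2 : c.1 % 2 = 1 := by omega
        simp only [pairCell, e, if_pos e2, Function.update_self]
    · refine hdepa 2 v τ _ _ fun c hc => ?_
      have hc' := pairLabel_two_iff.mp hc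
      have e : halfCell d c ≠ s :=
        fun hcon => hc' (congrArg Fin.val hcon)
      simp only [pairCell, Function.update_of_ne e]
  let D : T → (Fin (2 * M) → Bool) × (Fin M → Bool) → ℝ := fun τ h =>
    |𝔼 x, A τ x * B τ (toeplitzHash h x) - 𝔼 x, 𝔼 y, A τ x * B τ y|
  have hmix : ∀ τ, 𝔼 h, D τ h ≤ 1 / Real.sqrt (2 ^ M) := fun τ =>
    toeplitzHash_mixing (A τ) (B τ)
      (fun x => by rcases ha 0 v τ fun _ => x with h | h <;> simp [A, h]) (fun x => ha 1 v τ _)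
  -- There is one more piece than there are changes of label; this is why `CrossBound` is a strict
  -- inequality.
  have hQ : (p :: ps).length ≤ Q := by
    rw [List.length_cons, hlen, ← changes_map (pairLabel s) Fin.val, List.map_map]
    exact hcross
  refine ⟨fun h => ∑ τ, D τ h, ?_, ?_⟩
  · generalize 1 / Real.sqrt (2 ^ M) = δ at hδ hmix ⊢
    rw [Finset.expect_sum_comm]
    refine (Finset.sum_le_sum fun τ _ => hmix τ).trans ?_
    rw [Finset.sum_const, Finset.card_univ, hcard, nsmul_eq_mul, Nat.cast_pow]
    refine mul_le_mul_of_nonneg_right ?_ hδ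
    exact pow_le_pow_right₀ (by exact_mod_cast hw) hQ
  · intro h z
    simp only [hfact]
    rw [Finset.expect_sum_comm, Finset.expect_sum_comm, ← Finset.sum_sub_distrib]
    refine (Finset.abs_sum_le_sum_abs _ _).trans (Finset.sum_le_sum fun τ _ => ?_)
    rw [← Finset.univ_product_univ, Finset.expect_product]
    simp only [← Finset.expect_mul]
    rw [← sub_mul, abs_mul]
    refine mul_le_of_le_one_right (abs_nonneg _) ?_
    rcases ha 2 v τ (pairCell d z) with h | h <;> simp [h]

theorem expect_snoc {H : Type} [Fintype H] [Nonempty H] {d : ℕ} (F : (Fin (d + 1) → H) → ℝ) :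
    𝔼 hs : Fin (d + 1) → H, F hs = 𝔼 h : H, 𝔼 hs : Fin d → H, F (Fin.snoc hs h) := by
  rw [← Finset.expect_product' (f := fun h hs => F (Fin.snoc (α := fun _ => H) hs h)),
    Finset.univ_product_univ]
  refine Fintype.expect_equiv (Fin.snocEquiv fun _ => H).symm _ _ fun hs => ?_
  simp [Fin.snocEquiv]

/-- The generator fools every program whose head crosses each boundary few times. -/
theorem genBlock_fools {M w Q : ℕ} (hw : 0 < w) (d : ℕ)
    (P : List (Fin (2 ^ d) × ((Fin M → Bool) → Fin w → Fin w)))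
    (hcross : CrossBound Q (P.map fun l => l.1.1)) (v : Fin w)
    (g : Fin w → ℝ) (hg : ∀ v, g v = 0 ∨ g v = 1) :
    |𝔼 hs, 𝔼 x, g (runLayers P (fun c => genBlock d hs x c) v) -
      𝔼 x : Fin (2 ^ d) → Fin M → Bool, g (runLayers P x v)| ≤
        ((2 : ℝ) ^ d - 1) * (w ^ Q * (1 / Real.sqrt (2 ^ M))) := by
  induction d with
  | zero =>
    have : 𝔼 hs, 𝔼 x, g (runLayers P (fun c => genBlock 0 hs x c) v) =
        𝔼 x : Fin (2 ^ 0) → Fin M → Bool, g (runLayers P x v) := by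
      rw [show (fun hs : Fin 0 → (Fin (2 * M) → Bool) × (Fin M → Bool) =>
        𝔼 x, g (runLayers P (fun c => genBlock 0 hs x c) v)) =
        fun _ => 𝔼 x, g (runLayers P (fun _ => x) v) from rfl, Fintype.expect_const]
      refine Fintype.expect_bijective (fun x _ => x) ?_ _ _ fun x => rfl
      refine ⟨fun x y hxy => congrFun hxy ⟨0, by simp⟩, fun x => ⟨x ⟨0, by simp⟩, ?_⟩⟩
      funext i
      rw [show i = ⟨0, by simp⟩ from Fin.ext (by have := i.2; simp)]
    rw [this]
    simp
  | succ d ih =>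
    -- The last hash function is moved into the transitions: `Ph h` reads the common block of a pair
    -- of cells and hashes it where `P` reads the odd one.
    let Ph (h : (Fin (2 * M) → Bool) × (Fin M → Bool)) :
        List (Fin (2 ^ d) × ((Fin M → Bool) → Fin w → Fin w)) :=
      P.map fun l => (halfCell d l.1,
        fun z => l.2 (if l.1.1 % 2 = 1 then toeplitzHash h z else z))
    have hPh : ∀ h (y : Fin (2 ^ d) → Fin M → Bool),
        runLayers (Ph h) y v = runLayers P (pairCell d fun s => (y s, toeplitzHash h (y s))) v := by
      intro h y
      simp only [runLayers, Ph, List.foldl_map, pairCell]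
    have hcrossh : ∀ h, CrossBound Q ((Ph h).map fun l => l.1.1) := by
      -- Crossings of `Ph h` at scale `i` are crossings of `P` at scale `i + 1`.
      intro h i s
      have := hcross (i + 1) s
      rw [List.map_map] at this
      simp only [Ph, List.map_map]
      refine lt_of_eq_of_lt ?_ this
      congr 2
      funext l
      simp [halfCell, Nat.div_div_eq_div_mul, pow_succ, mul_comm]
    have hgen : ∀ (hs : Fin d → (Fin (2 * M) → Bool) × (Fin M → Bool)) h x,
        runLayers P (fun c => genBlock (d + 1) (Fin.snoc hs h) x c) v =
          runLayers (Ph h) (fun c => genBlock d hs x c) v := by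
      intro hs h x
      rw [hPh]
      congr 1
      funext c
      simp only [genBlock, pairCell, halfCell, Fin.snoc_castSucc, Fin.snoc_last]
    rw [expect_snoc]
    simp only [hgen]
    have h1 : |𝔼 h, 𝔼 hs, 𝔼 x, g (runLayers (Ph h) (fun c => genBlock d hs x c) v) -
        𝔼 h, 𝔼 y : Fin (2 ^ d) → Fin M → Bool, g (runLayers (Ph h) y v)| ≤
          ((2 : ℝ) ^ d - 1) * (w ^ Q * (1 / Real.sqrt (2 ^ M))) :=
      abs_expect_sub_expect_le _ _ _ fun h => ih (Ph h) (hcrossh h)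
    have hcross0 : ∀ s : Fin (2 ^ d), changes (pairLabel s) (P.map fun l => l.1.1) < Q := by
      intro s
      simpa [Function.comp_def] using hcross 0 s
    choose η hη hηz using fun s => exists_pair_bound hw P s (hcross0 s) v g hg
    -- It remains to replace `2 ^ d` independent pairs by a block and its hash. All of them share
    -- the same `h`, so the hybrid argument is run for fixed `h`, with errors valid for all values
    -- of the other pairs, and only the sum of the errors is averaged over `h`. Together with `2 ^ d
    -- - 1` from the induction this gives `2 ^ (d + 1) - 1`.
    have h2 : |𝔼 h, 𝔼 y : Fin (2 ^ d) → Fin M → Bool, g (runLayers (Ph h) y v) -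
        𝔼 x : Fin (2 ^ (d + 1)) → Fin M → Bool, g (runLayers P x v)| ≤
          (2 : ℝ) ^ d * (w ^ Q * (1 / Real.sqrt (2 ^ M))) := by
      have e : 𝔼 x : Fin (2 ^ (d + 1)) → Fin M → Bool, g (runLayers P x v) =
          𝔼 b : Fin (2 ^ d) → (Fin M → Bool) × (Fin M → Bool),
            g (runLayers P (pairCell d b) v) :=
        (Fintype.expect_bijective (pairCell d) (pairCell_bijective d) _ _ fun b => rfl).symm
      rw [e, ← Fintype.expect_const (ι := (Fin (2 * M) → Bool) × (Fin M → Bool))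
        (𝔼 b : Fin (2 ^ d) → (Fin M → Bool) × (Fin M → Bool), g (runLayers P (pairCell d b) v)),
        ← Finset.expect_sub_distrib]
      refine (Finset.abs_expect_le _ _).trans ?_
      calc _ ≤ 𝔼 h, ∑ s, η s h := by
            refine Finset.expect_le_expect fun h _ => ?_
            simp only [hPh]
            exact abs_expect_pi_sub_le (A := fun _ : Fin (2 ^ d) => Fin M → Bool)
              (B := fun _ : Fin (2 ^ d) => (Fin M → Bool) × (Fin M → Bool))
              (fun _ a => (a, toeplitzHash h a)) (fun b => g (runLayers P (pairCell d b) v))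
              (fun s => η s h) (fun s z => hηz s h z)
        _ = ∑ s, 𝔼 h, η s h := Finset.expect_sum_comm _ _ _
        _ ≤ ∑ _s : Fin (2 ^ d), (w : ℝ) ^ Q * (1 / Real.sqrt (2 ^ M)) :=
            Finset.sum_le_sum fun s _ => hη s
        _ = _ := by simp
    calc _ ≤ _ := abs_sub_le _ (𝔼 h, 𝔼 y : Fin (2 ^ d) → Fin M → Bool,
            g (runLayers (Ph h) y v)) _
      _ ≤ _ := add_le_add h1 h2
      _ = _ := by ring

end ReadK

namespace ReadK

/-! ### Programs simulated by a head with few visits -/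

/-- Every change of label is charged to the entry that follows it. -/
theorem changes_cons_le_countP {κ Λ : Type} [DecidableEq Λ] (lab : κ → Λ) (p : κ → Bool)
    (R : κ → κ → Prop) (hR : ∀ a b, R a b → lab a ≠ lab b → p b = true) (a : κ) (l : List κ)
    (hl : (a :: l).IsChain R) : changes lab (a :: l) ≤ l.countP p := by
  induction l generalizing a with
  | nil => simp [changes]
  | cons b l ih =>
    rw [List.isChain_cons_cons] at hl
    have h1 := ih b hl.2
    have h2 := hR a b hl.1
    simp only [changes, List.countP_cons]
    by_cases hab : lab a = lab b
    · rw [if_pos hab]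
      omega
    · rw [if_neg hab, if_pos (h2 hab)]
      omega

theorem countP_mem_le (F : Finset ℕ) (l : List ℕ) :
    l.countP (fun c => decide (c ∈ F)) ≤ ∑ c ∈ F, l.count c := by
  induction l with
  | nil => simp
  | cons a l ih =>
    simp only [List.countP_cons, List.count_cons, Finset.sum_add_distrib, decide_eq_true_eq]
    have : (if a ∈ F then 1 else 0) ≤ ∑ x ∈ F, if (a == x) = true then 1 else 0 := by
      split_ifs with h
      · exact le_trans (by simp) (Finset.single_le_sum (f := fun x => if (a == x) = true then 1 else 0)
          (fun _ _ => Nat.zero_le _) h)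
      · exact Nat.zero_le _
    omega

/-- With `N = 2 ^ i`, the label changes only when the head crosses one of the three borders `2 * s *
N`, `(2 * s + 1) * N`, `(2 * s + 2) * N` of the two segments. Such a step enters one of the six
cells next to the borders, and each of these is visited at most `D` times. -/
theorem crossBound_of_adjacent (D : ℕ) (l : List ℕ)
    (hl : l.IsChain (fun a b => a ≤ b + 1 ∧ b ≤ a + 1)) (hD : ∀ c, l.count c ≤ D) :
    CrossBound (6 * D + 1) l := by
  intro i s
  rw [changes_map, Nat.lt_succ_iff]
  rcases l with _ | ⟨a, l⟩
  · simp [changes]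
  set N := 2 ^ i with hN
  have hNpos : 0 < N := by positivity
  let F : Finset ℕ := {2 * s * N, 2 * s * N - 1, (2 * s + 1) * N, (2 * s + 1) * N - 1,
    (2 * s + 2) * N, (2 * s + 2) * N - 1}
  have hF : F.card ≤ 6 := Finset.card_le_six
  calc _ ≤ l.countP (fun c => decide (c ∈ F)) := by
        refine changes_cons_le_countP _ _ _ ?_ a l hl
        rintro a b ⟨hab, hba⟩ hlab
        -- A crossing between neighbouring segments takes place at a multiple of `N`.
        have key : ∀ q c : ℕ, c / N = q → (c + 1) / N = q + 1 → c + 1 = (q + 1) * N := by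
          intro q c h1 h2
          have h3 := Nat.div_add_mod c N
          have h4 := Nat.div_add_mod (c + 1) N
          have h5 := Nat.mod_lt c hNpos
          have h6 := Nat.mod_lt (c + 1) hNpos
          rw [h1] at h3
          rw [h2, mul_add, mul_one] at h4
          rw [add_mul, one_mul, mul_comm q]
          omega
        have step : ∀ c, (c + 1) / N = c / N ∨ (c + 1) / N = c / N + 1 := by
          intro c
          have h1 : c / N ≤ (c + 1) / N := Nat.div_le_div_right (by omega)
          have h2 : (c + 1) / N ≤ (c + N) / N := Nat.div_le_div_right (by omega)
          rw [Nat.add_div_right _ hNpos] at h2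
          omega
        simp only [decide_eq_true_eq, F, Finset.mem_insert, Finset.mem_singleton]
        have hne : a / N ≠ b / N := fun h => hlab (by simp only [h])
        have hcases : b = a + 1 ∨ a = b + 1 := by
          have : a ≠ b := fun h => hne (by rw [h])
          omega
        rcases hcases with rfl | rfl
        · have h1 := (step a).resolve_left (Ne.symm hne)
          have h2 := key _ _ rfl h1
          rw [h1] at hlab
          have h3 : a / N + 1 = 2 * s ∨ a / N + 1 = 2 * s + 1 ∨ a / N + 1 = 2 * s + 2 := by
            simp only [pairLabel] at hlab
            by_contra hcon
            apply hlab
            split_ifs <;> omega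
          rcases h3 with h | h | h <;> rw [h] at h2 <;> simp [h2]
        · have h1 := (step b).resolve_left hne
          have h2 := key _ _ rfl h1
          rw [h1] at hlab
          have h3 : b / N + 1 = 2 * s ∨ b / N + 1 = 2 * s + 1 ∨ b / N + 1 = 2 * s + 2 := by
            simp only [pairLabel] at hlab
            by_contra hcon
            apply hlab
            split_ifs <;> omega
          have h4 : b = (b / N + 1) * N - 1 := by omega
          rcases h3 with h | h | h <;> rw [h] at h4 <;> simp [← h4]
    _ ≤ ∑ c ∈ F, l.count c := countP_mem_le F l
    _ ≤ ∑ _c ∈ F, D := Finset.sum_le_sum fun c _ =>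
        (List.Sublist.count_le c (List.sublist_cons_self a l)).trans (hD c)
    _ = F.card * D := by simp
    _ ≤ 6 * D := Nat.mul_le_mul_right _ hF

/-- Idle layers do not change the function computed by a program. -/
theorem exists_layers_of_sublist {κ V : Type} {w : ℕ} (walk : List κ)
    (L : List (κ × (V → Fin w → Fin w))) (h : (L.map Prod.fst).Sublist walk) :
    ∃ P : List (κ × (V → Fin w → Fin w)), P.map Prod.fst = walk ∧
      ∀ x v, runLayers P x v = runLayers L x v := by
  induction walk generalizing L with
  | nil =>
    have : L = [] := by simpa using h
    exact ⟨[], rfl, fun x v => by rw [this]⟩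
  | cons c walk ih =>
    rcases L with _ | ⟨l, L⟩
    · obtain ⟨P, hP, hrun⟩ := ih [] (by simp)
      exact ⟨(c, fun _ v => v) :: P, by simp [hP], fun x v => by simpa [runLayers] using hrun x v⟩
    · rw [List.map_cons] at h
      cases h with
      | cons _ h =>
        obtain ⟨P, hP, hrun⟩ := ih (l :: L) (by simpa using h)
        exact ⟨(c, fun _ v => v) :: P, by simp [hP], fun x v => by simpa [runLayers] using hrun x v⟩
      | cons_cons _ h =>
        obtain ⟨P, hP, hrun⟩ := ih L h
        refine ⟨l :: P, by simp [hP], fun x v => ?_⟩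
        simpa [runLayers] using hrun x (l.2 (x l.1) v)

theorem prAccept_eq_expect {m : ℕ} (f : (Fin m → Bool) → Bool) :
    prAccept f = 𝔼 x, if f x = true then (1 : ℝ) else 0 := by
  rw [Fintype.expect_eq_sum_div_card, Finset.sum_boole, prAccept]
  simp

/-- The first bits of the blocks of the generator fool every program that is simulated by a head
with few visits. -/
theorem genBlock_fools_head {M w m d D : ℕ} (hM : 0 < M) (hm : m ≤ 2 ^ d)
    (B : ObliviousBP (Fin m) w) (hB : HeadVisitsAtMost D B.order) :
    |𝔼 hs, 𝔼 x, (if B.eval (fun c : Fin m => genBlock d hs x c ⟨0, hM⟩) = true then (1 : ℝ) else 0) -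
      prAccept B.eval| ≤ (2 : ℝ) ^ d * (w ^ (6 * D + 1) * (1 / Real.sqrt (2 ^ M))) := by
  have hw : 0 < w := Fin.pos B.start
  obtain ⟨walk, hchain, hsub, hcount⟩ := hB
  obtain ⟨P, hP, hrun⟩ := exists_layers_of_sublist walk B.layers hsub
  let P' : List (Fin (2 ^ d) × ((Fin M → Bool) → Fin w → Fin w)) :=
    P.map fun l => (Fin.castLE hm l.1, fun z => l.2 (z ⟨0, hM⟩))
  let g : Fin w → ℝ := fun v => if B.accept v = true then 1 else 0
  have hg : ∀ v, g v = 0 ∨ g v = 1 := by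
    intro v
    simp only [g]
    split_ifs <;> simp
  have hP' : ∀ (x : Fin (2 ^ d) → Fin M → Bool),
      g (runLayers P' x B.start) =
        if B.eval (fun c : Fin m => x (Fin.castLE hm c) ⟨0, hM⟩) = true then (1 : ℝ) else 0 := by
    intro x
    have h1 := hrun (fun c : Fin m => x (Fin.castLE hm c) ⟨0, hM⟩) B.start
    have h2 : runLayers P' x B.start =
        runLayers P (fun c : Fin m => x (Fin.castLE hm c) ⟨0, hM⟩) B.start := by
      simp only [runLayers, P', List.foldl_map]
    rw [h2, h1]
    rfl
  have hcross : CrossBound (6 * D + 1) (P'.map fun l => l.1.1) := by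
    have : (P'.map fun l => l.1.1) = walk.map Fin.val := by
      rw [← hP]
      simp [P', Function.comp_def]
    rw [this]
    refine crossBound_of_adjacent D _ ((List.isChain_map _).mpr hchain) fun c => ?_
    by_cases hc : c < m
    · have := List.count_map_of_injective walk Fin.val Fin.val_injective ⟨c, hc⟩
      simp only at this
      rw [this]
      exact hcount _
    · rw [List.count_eq_zero_of_not_mem]
      · exact Nat.zero_le _
      · intro h
        obtain ⟨a, -, rfl⟩ := List.mem_map.mp h
        exact hc a.2
  have main := genBlock_fools hw d P' hcross B.start g hg
  simp only [hP'] at main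
  -- Taking the first bits of `m` of the blocks is a surjective homomorphism, so uniform blocks give
  -- uniform bits.
  have hunif : 𝔼 x : Fin (2 ^ d) → Fin M → Bool,
      (if B.eval (fun c : Fin m => x (Fin.castLE hm c) ⟨0, hM⟩) = true then (1 : ℝ) else 0) =
        prAccept B.eval := by
    rw [prAccept_eq_expect]
    let φ : (Fin (2 ^ d) → Fin M → Bool) →+ (Fin m → Bool) :=
      { toFun := fun x c => x (Fin.castLE hm c) ⟨0, hM⟩
        map_zero' := rfl
        map_add' := fun _ _ => rfl }
    refine expect_comp_surjective φ (fun u => ?_) (fun u => if B.eval u = true then (1 : ℝ) else 0)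
    refine ⟨fun c _ => if h : c.1 < m then u ⟨c, h⟩ else false, ?_⟩
    funext c
    simp [φ]
  rw [hunif] at main
  refine main.trans ?_
  refine mul_le_mul_of_nonneg_right (by linarith) (by positivity)

end ReadK

namespace ReadK

/-! ### Products of generators -/

/-- Fixing the variables outside a part gives a program that reads the part only. -/
theorem exists_restricted_layers {κ κ' V : Type} {w : ℕ} (sel : κ → Option κ') (z : κ → V)
    (L : List (κ × (V → Fin w → Fin w))) :
    ∃ (L' : List (κ' × (V → Fin w → Fin w))) (post : Fin w → Fin w),
      L'.map Prod.fst = (L.map Prod.fst).filterMap sel ∧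
      ∀ (u : κ' → V) v, runLayers L (fun c => ((sel c).map u).getD (z c)) v =
        post (runLayers L' u v) := by
  -- Layers that read outside the part are collected in `post`; the next layer that reads the part
  -- absorbs them.
  induction L using List.reverseRecOn with
  | nil => exact ⟨[], id, rfl, fun u v => rfl⟩
  | append_singleton L l ih =>
    obtain ⟨L', post, hL', hrun⟩ := ih
    cases hs : sel l.1 with
    | none =>
      refine ⟨L', fun v => l.2 (z l.1) (post v), by simp [hL', hs], fun u v => ?_⟩
      have := hrun u v
      simp only [runLayers, List.foldl_append, List.foldl_cons, List.foldl_nil, hs] at this ⊢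
      rw [this]
      simp
    | some c =>
      refine ⟨L' ++ [(c, fun b v => l.2 b (post v))], id, by simp [hL', hs], fun u v => ?_⟩
      have := hrun u v
      simp only [runLayers, List.foldl_append, List.foldl_cons, List.foldl_nil, hs] at this ⊢
      rw [this]
      simp

/-- The cell of a variable if it lies in part `i`. -/
def OrderedPartition.cellIn {n t : ℕ} (Y : OrderedPartition n t) (i : Fin t) (x : Fin n) :
    Option (Fin (Y.size i)) :=
  if h : (Y.cell.symm x).1 = i then some (h ▸ (Y.cell.symm x).2) else none

theorem OrderedPartition.cellIn_cell {n t : ℕ} (Y : OrderedPartition n t) (i : Fin t)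
    (c : Fin (Y.size i)) : Y.cellIn i (Y.cell ⟨i, c⟩) = some c := by
  unfold cellIn
  have h : Y.cell.symm (Y.cell ⟨i, c⟩) = ⟨i, c⟩ := Equiv.symm_apply_apply _ _
  rw [dif_pos (by rw [h])]
  congr 1
  generalize_proofs h'
  revert h'
  rw [h]
  intro h'
  rfl

theorem OrderedPartition.cellIn_eq_none {n t : ℕ} (Y : OrderedPartition n t) (i j : Fin t)
    (c : Fin (Y.size j)) (hij : j ≠ i) : Y.cellIn i (Y.cell ⟨j, c⟩) = none := by
  unfold cellIn
  rw [dif_neg]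
  rw [Equiv.symm_apply_apply]
  exact hij

/-- The hybrid argument replaces one part at a time. With all other parts fixed, the program becomes
one of the same width on this part, reading its variables in the induced order, so the hypothesis
applies to it. -/
theorem product_fools {n t w : ℕ} (Y : OrderedPartition n t) (len : Fin t → ℕ)
    (g : ∀ i : Fin t, (Fin (len i) → Bool) → (Fin (Y.size i) → Bool)) (η : ℝ)
    (B : ObliviousBP (Fin n) w)
    (hg : ∀ i, ∀ B' : ObliviousBP (Fin (Y.size i)) w, B'.order = B.order.filterMap (Y.cellIn i) →
      Fools η (g i) B'.eval) :
    Fools (t * η) (Y.product len g) B.eval := by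
  let join (b : ∀ i : Fin t, Fin (Y.size i) → Bool) : Fin n → Bool :=
    fun x => b (Y.cell.symm x).1 (Y.cell.symm x).2
  let F (b : ∀ i : Fin t, Fin (Y.size i) → Bool) : ℝ := if B.eval (join b) = true then 1 else 0
  have hjoin : ∀ b i c, join b (Y.cell ⟨i, c⟩) = b i c := fun b i c =>
    congrArg (fun p : Σ i : Fin t, Fin (Y.size i) => b p.1 p.2)
      (Equiv.symm_apply_apply Y.cell ⟨i, c⟩)
  have h1 : prAccept B.eval = 𝔼 b, F b := by
    rw [prAccept_eq_expect]
    symm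
    refine Fintype.expect_bijective join ?_ _ _ fun b => rfl
    refine ⟨fun b b' h => ?_, fun x => ⟨fun i c => x (Y.cell ⟨i, c⟩), ?_⟩⟩
    · funext i c
      have := congrFun h (Y.cell ⟨i, c⟩)
      rwa [hjoin, hjoin] at this
    · funext c
      simp [join]
  have h2 : prAccept (fun y => B.eval (Y.product len g y)) =
      𝔼 a : (∀ i : Fin t, Fin (len i) → Bool), F (fun i => g i (a i)) := by
    rw [prAccept_eq_expect]
    refine Fintype.expect_bijective (fun y i j => y (finSigmaFinEquiv ⟨i, j⟩)) ?_ _ _ fun y => rfl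
    refine ⟨fun y y' h => ?_, fun a => ⟨fun c => a (finSigmaFinEquiv.symm c).1
      (finSigmaFinEquiv.symm c).2, ?_⟩⟩
    · funext c
      have := congrFun (congrFun h (finSigmaFinEquiv.symm c).1) (finSigmaFinEquiv.symm c).2
      simpa using this
    · funext i j
      exact congrArg (fun p : Σ i : Fin t, Fin (len i) => a p.1 p.2)
        (Equiv.symm_apply_apply finSigmaFinEquiv ⟨i, j⟩)
  rw [Fools, h1, h2]
  refine (abs_expect_pi_sub_le g F (fun _ => η) fun j z => ?_).trans (by simp)
  obtain ⟨L', post, hL', hrun⟩ :=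
    exists_restricted_layers (Y.cellIn j) (join z) B.layers
  have hF : ∀ u, F (Function.update z j u) =
      if (⟨L', B.start, fun v => B.accept (post v)⟩ : ObliviousBP (Fin (Y.size j)) w).eval u = true
        then 1 else 0 := by
    intro u
    have hj : join (Function.update z j u) = fun c => ((Y.cellIn j c).map u).getD (join z c) := by
      funext x
      obtain ⟨⟨i, c⟩, rfl⟩ := Y.cell.surjective x
      by_cases hij : i = j
      · subst hij
        rw [hjoin, Y.cellIn_cell]
        simp
      · rw [hjoin, Y.cellIn_eq_none j i c hij, hjoin]
        simp [hij]
    simp only [F, hj]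
    have : B.eval (fun c => ((Y.cellIn j c).map u).getD (join z c)) =
        (⟨L', B.start, fun v => B.accept (post v)⟩ : ObliviousBP (Fin (Y.size j)) w).eval u :=
      congrArg B.accept (hrun u B.start)
    rw [this]
  have := hg j ⟨L', B.start, fun v => B.accept (post v)⟩ hL'
  rw [Fools, prAccept_eq_expect, prAccept_eq_expect] at this
  simpa only [hF] using this

/-! ### Seeds -/

/-- Position `j` of a seed `y`, or `false` beyond its end. -/
def seedBit {s : ℕ} (y : Fin s → Bool) (j : ℕ) : Bool := if h : j < s then y ⟨j, h⟩ else false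

/-- The generator on a part, read off a seed of `M + 3 * M * d` bits: a block of `M` bits, then the
descriptions of `d` hash functions. -/
def genSeed {s : ℕ} (M d : ℕ) (y : Fin s → Bool) (c : ℕ) : Fin M → Bool :=
  genBlock d (fun i => (fun j => seedBit y (M + 3 * M * i + j),
    fun j => seedBit y (M + 3 * M * i + 2 * M + j))) (fun j => seedBit y j) c

/-- The pieces of the seed are disjoint and cover it, so a uniform seed amounts to an independent
uniform block and uniform hash functions. Since the cardinalities agree, it is enough that the
pieces determine the seed. -/
theorem expect_seed {M d : ℕ} (F : (Fin d → (Fin (2 * M) → Bool) × (Fin M → Bool)) →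
    (Fin M → Bool) → ℝ) :
    𝔼 y : Fin (M + 3 * M * d) → Bool, F (fun i => (fun j => seedBit y (M + 3 * M * i + j),
      fun j => seedBit y (M + 3 * M * i + 2 * M + j))) (fun j => seedBit y j) =
    𝔼 hs, 𝔼 x, F hs x := by
  let ψ : (Fin (M + 3 * M * d) → Bool) →
      (Fin d → (Fin (2 * M) → Bool) × (Fin M → Bool)) × (Fin M → Bool) := fun y =>
    ((fun i => (fun j => seedBit y (M + 3 * M * i + j),
      fun j => seedBit y (M + 3 * M * i + 2 * M + j))), (fun j => seedBit y j))
  suffices hψ : Function.Bijective ψ by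
    have h1 : 𝔼 y, (fun p : (Fin d → (Fin (2 * M) → Bool) × (Fin M → Bool)) × (Fin M → Bool) =>
        F p.1 p.2) (ψ y) = 𝔼 p, (fun p : (Fin d → (Fin (2 * M) → Bool) × (Fin M → Bool)) ×
          (Fin M → Bool) => F p.1 p.2) p :=
      Fintype.expect_bijective ψ hψ _ _ fun y => rfl
    rw [← Finset.univ_product_univ, Finset.expect_product] at h1
    exact h1
  rw [Fintype.bijective_iff_injective_and_card]
  constructor
  · intro y y' h
    have h1 := congrArg Prod.fst h
    have h2 := congrArg Prod.snd h
    simp only [ψ] at h1 h2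
    have key : ∀ c < M + 3 * M * d, seedBit y c = seedBit y' c := by
      intro c hc
      by_cases hcM : c < M
      · exact congrFun h2 ⟨c, hcM⟩
      · obtain ⟨r, rfl⟩ := Nat.exists_eq_add_of_le (not_lt.mp hcM)
        have hr : r < 3 * M * d := by omega
        have hM : 0 < 3 * M := by
          by_contra hcon
          have : 3 * M = 0 := by omega
          simp [this] at hr
        have hi : r / (3 * M) < d := Nat.div_lt_of_lt_mul hr
        have hd := Nat.div_add_mod r (3 * M)
        have hm := Nat.mod_lt r hM
        have h3 := congrFun h1 ⟨r / (3 * M), hi⟩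
        simp only [Prod.mk.injEq] at h3
        by_cases hj : r % (3 * M) < 2 * M
        · have := congrFun h3.1 ⟨r % (3 * M), hj⟩
          simpa [add_assoc, hd] using this
        · have := congrFun h3.2 ⟨r % (3 * M) - 2 * M, by omega⟩
          simp only at this
          have e : M + 3 * M * (r / (3 * M)) + 2 * M + (r % (3 * M) - 2 * M) = M + r := by omega
          rwa [e] at this
    funext c
    have := key c c.2
    simpa [seedBit] using this
  · simp only [Fintype.card_pi, Fintype.card_bool, Fintype.card_prod, Finset.prod_const,
      Finset.card_univ, Fintype.card_fin]
    rw [← pow_add, ← pow_mul, ← pow_add]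
    congr 1
    ring

theorem genSeed_fools {M w m d D : ℕ} (hM : 0 < M) (hm : m ≤ 2 ^ d)
    (B : ObliviousBP (Fin m) w) (hB : HeadVisitsAtMost D B.order) :
    Fools ((2 : ℝ) ^ d * (w ^ (6 * D + 1) * (1 / Real.sqrt (2 ^ M))))
      (fun (y : Fin (M + 3 * M * d) → Bool) (c : Fin m) => genSeed M d y c ⟨0, hM⟩) B.eval := by
  rw [Fools, prAccept_eq_expect]
  have := genBlock_fools_head hM hm B hB
  rw [← expect_seed (fun hs x => if B.eval (fun c : Fin m => genBlock d hs x c ⟨0, hM⟩) = true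
    then (1 : ℝ) else 0)] at this
  exact this

end ReadK

namespace ReadK

/-! ### Simulating a regular reading sequence by a head -/

/-- A head can step down from `a` to `b`. -/
theorem exists_path_down {m : ℕ} (a b : Fin m) (h : b < a) :
    ∃ F : List (Fin m), (a :: (F ++ [b])).IsChain (fun a b => a.1 ≤ b.1 + 1 ∧ b.1 ≤ a.1 + 1) ∧
      ∀ p, F.count p = if b < p ∧ p < a then 1 else 0 := by
  obtain ⟨δ, hδ⟩ : ∃ δ, a.1 = b.1 + δ + 1 := ⟨a - b - 1, by have : b.1 < a.1 := h; omega⟩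
  induction δ generalizing a with
  | zero =>
    refine ⟨[], by simp; omega, fun p => ?_⟩
    rw [if_neg]
    · rfl
    · rintro ⟨h1, h2⟩
      have h1' : b.1 < p.1 := h1
      have h2' : p.1 < a.1 := h2
      omega
  | succ δ ih =>
    have ha := a.2
    obtain ⟨F, hF, hcount⟩ := ih ⟨a - 1, by omega⟩ (by rw [Fin.lt_def]; simp only; omega)
      (by simp only; omega)
    refine ⟨⟨a - 1, by omega⟩ :: F, ?_, fun p => ?_⟩
    · rw [List.cons_append, List.isChain_cons_cons]
      exact ⟨by simp only; omega, hF⟩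
    · rw [List.count_cons, hcount]
      simp only [Fin.lt_def, beq_iff_eq, Fin.ext_iff]
      split_ifs <;> omega

theorem exists_path_up {m : ℕ} (a b : Fin m) (h : a < b) :
    ∃ F : List (Fin m), (a :: (F ++ [b])).IsChain (fun a b => a.1 ≤ b.1 + 1 ∧ b.1 ≤ a.1 + 1) ∧
      ∀ p, F.count p = if a < p ∧ p < b then 1 else 0 := by
  obtain ⟨F, hF, hcount⟩ := exists_path_down b a h
  refine ⟨F.reverse, ?_, fun p => by rw [List.count_reverse, hcount]⟩
  have := List.isChain_reverse.mpr hF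
  simp only [List.reverse_cons, List.reverse_append, List.reverse_nil, List.nil_append,
    List.cons_append] at this
  exact this.imp fun a b h => ⟨h.2, h.1⟩

/-- A step of the reading sequence; the flag tells whether the cells are read in increasing
order. -/
def RegularStep {m : ℕ} (a b : Fin m × Bool) : Prop :=
  (a.2 = true ∧ b.2 = true ∧ b.1.1 ≤ a.1.1 + 1) ∨
  (a.2 = false ∧ b.2 = false ∧ a.1.1 ≤ b.1.1 + 1) ∨
  (a.2 = true ∧ b.2 = false ∧ a.1 = b.1 ∧ a.1.1 + 1 = m) ∨
  (a.2 = false ∧ b.2 = true ∧ a.1 = b.1 ∧ a.1.1 = 0)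

/-- Jumps against the reading direction are paid for by the preceding reads of the cells jumped
over. -/
theorem exists_walk_of_regularStep {m : ℕ} (L : List (Fin m × Bool)) (a : Fin m × Bool)
    (hstart : ∀ e ∈ (L ++ [a]).head?, e.1.1 = 0 ∧ e.2 = true)
    (hchain : (L ++ [a]).IsChain RegularStep) :
    ∃ W : List (Fin m), W.IsChain (fun a b => a.1 ≤ b.1 + 1 ∧ b.1 ≤ a.1 + 1) ∧
      W.getLast? = some a.1 ∧ ((L ++ [a]).map Prod.fst).Sublist W ∧
      ∀ p, W.count p + (if (a.2 = true ∧ p ≤ a.1) ∨ (a.2 = false ∧ a.1 ≤ p) then 1 else 0) ≤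
        2 * ((L ++ [a]).map Prod.fst).count p := by
  -- The indicator in the bound is a credit of one spare visit, held by every cell up to the present
  -- one while reading in increasing order, and by every cell from it on while decreasing. A read
  -- adds two units, one for the visit and one as credit. A jump back visits the cells strictly
  -- between once, and these are cells whose credit is given up by the move.
  induction L using List.reverseRecOn generalizing a with
  | nil =>
    obtain ⟨h0, h1⟩ := hstart a (by simp)
    refine ⟨[a.1], by simp, by simp, by simp, fun p => ?_⟩
    simp only [List.nil_append, List.map_cons, List.map_nil, List.count_cons, List.count_nil, h1,
      beq_iff_eq, Fin.le_def, Fin.ext_iff, h0]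
    split_ifs <;> simp_all
  | append_singleton L b ih =>
    have hst : ∀ e ∈ (L ++ [b]).head?, e.1.1 = 0 ∧ e.2 = true := by
      intro e he
      apply hstart e
      rw [List.head?_append]
      simp only [Option.mem_def] at he ⊢
      rw [he]
      rfl
    obtain ⟨W, hW, hlast, hsub, hcount⟩ := ih b hst hchain.left_of_append
    have hstep : RegularStep b a := by
      have := (List.isChain_append.mp hchain).2.2 b (by simp) a (by simp)
      exact this
    obtain ⟨F, hF, hFc⟩ : ∃ F : List (Fin m),
        (b.1 :: (F ++ [a.1])).IsChain (fun a b => a.1 ≤ b.1 + 1 ∧ b.1 ≤ a.1 + 1) ∧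
        ∀ p, F.count p = if (b.2 = true ∧ a.2 = true ∧ a.1 < p ∧ p < b.1) ∨
          (b.2 = false ∧ a.2 = false ∧ b.1 < p ∧ p < a.1) then 1 else 0 := by
      by_cases hnear : a.1.1 ≤ b.1.1 + 1 ∧ b.1.1 ≤ a.1.1 + 1
      · refine ⟨[], by simp; omega, fun p => ?_⟩
        rw [if_neg]
        · rfl
        · simp only [Fin.lt_def]
          omega
      · rcases hstep with ⟨h1, h2, h3⟩ | ⟨h1, h2, h3⟩ | ⟨h1, h2, h3, h4⟩ | ⟨h1, h2, h3, h4⟩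
        · obtain ⟨F, hF, hFc⟩ := exists_path_down b.1 a.1 (by rw [Fin.lt_def]; omega)
          exact ⟨F, hF, fun p => by rw [hFc]; simp [h1, h2]⟩
        · obtain ⟨F, hF, hFc⟩ := exists_path_up b.1 a.1 (by rw [Fin.lt_def]; omega)
          exact ⟨F, hF, fun p => by rw [hFc]; simp [h1, h2]⟩
        · rw [h3] at hnear
          omega
        · rw [h3] at hnear
          omega
    refine ⟨W ++ (F ++ [a.1]), ?_, ?_, ?_, fun p => ?_⟩
    · refine hW.append hF.tail ?_
      intro x hx y hy
      rw [hlast] at hx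
      obtain rfl : b.1 = x := by simpa using hx
      exact hF.rel_head? hy
    · rw [← List.append_assoc]
      simp
    · rw [List.map_append]
      exact List.Sublist.append hsub (by simp)
    · have h1 := hcount p
      rw [List.count_append, List.count_append, hFc, List.map_append, List.count_append]
      simp only [List.map_cons, List.map_nil, List.count_cons, List.count_nil, beq_iff_eq,
        Fin.ext_iff, Fin.le_def, Fin.lt_def] at h1 ⊢
      rcases hstep with ⟨h2, h3, h4⟩ | ⟨h2, h3, h4⟩ | ⟨h2, h3, h4, h5⟩ | ⟨h2, h3, h4, h5⟩ <;>
        simp only [h2, h3, true_and, false_and, or_false, false_or, reduceCtorEq] at h1 ⊢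
      · split_ifs at h1 ⊢ <;> omega
      · split_ifs at h1 ⊢ <;> omega
      · rw [h4] at h1 h5
        have := p.2
        split_ifs at h1 ⊢ <;> omega
      · rw [h4] at h1 h5
        split_ifs at h1 ⊢ <;> omega

/-- The reads `(x, c)` of cells, ordered by their times `ρ c x`, form a sequence that a head can
simulate if every read is monotone and any two reads interleave regularly. -/
theorem headVisits_of_regular {m k : ℕ} (ρ : ℕ → Fin m → ℕ) (L : List (Fin m × ℕ))
    (hL : L.Pairwise fun a b => ρ a.2 a.1 < ρ b.2 b.1)
    (hmem : ∀ x c, (x, c) ∈ L ↔ 1 ≤ c ∧ c ≤ k)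
    (hcount : ∀ x, (L.map Prod.fst).count x ≤ k)
    (hone : StrictMono (ρ 1))
    (hlt : ∀ c d x, 1 ≤ c → c < d → d ≤ k → ρ c x < ρ d x)
    (hmono : ∀ c, 1 ≤ c → c ≤ k → StrictMono (ρ c) ∨ StrictAnti (ρ c))
    (hlev : ∀ i j, 1 ≤ i → i < j → j ≤ k → ∃ lev : Fin m → ℕ, ∀ x y,
      (ρ i x < ρ j y → lev x ≤ lev y) ∧ (ρ j x < ρ i y → lev x < lev y)) :
    HeadVisitsAtMost (2 * k) (L.map Prod.fst) := by
  classical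
  rcases L.eq_nil_or_concat with rfl | ⟨L₀, e, he⟩
  · exact ⟨[], by simp, by simp, by simp⟩
  -- No read happens strictly between two consecutive ones. A step of a shape other than those in
  -- `RegularStep` would leave room for such a read or contradict the levels.
  have hsep : ∀ a b l₁ l₂, L = l₁ ++ a :: b :: l₂ → ∀ e ∈ L,
      ρ e.2 e.1 ≤ ρ a.2 a.1 ∨ ρ b.2 b.1 ≤ ρ e.2 e.1 := by
    rintro a b l₁ l₂ rfl e he
    rw [List.pairwise_append] at hL
    obtain ⟨h1, h2, h3⟩ := hL
    rw [List.pairwise_cons, List.pairwise_cons] at h2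
    rcases List.mem_append.mp he with he | he
    · exact Or.inl (h3 e he a (by simp)).le
    · rcases List.mem_cons.mp he with rfl | he
      · exact Or.inl le_rfl
      · rcases List.mem_cons.mp he with rfl | he
        · exact Or.inr le_rfl
        · exact Or.inr (h2.2.1 e he).le
  have hinj : ∀ x c y d, 1 ≤ c → c ≤ k → 1 ≤ d → d ≤ k → c ≠ d → ρ c x ≠ ρ d y := by
    intro x c y d hc hc' hd hd' hcd
    have : Std.Symm fun a b : Fin m × ℕ => ρ a.2 a.1 ≠ ρ b.2 b.1 := ⟨fun _ _ h => Ne.symm h⟩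
    have := List.Pairwise.forall (R := fun a b : Fin m × ℕ => ρ a.2 a.1 ≠ ρ b.2 b.1)
      (hL.imp fun h => h.ne)
    exact this ((hmem x c).mpr ⟨hc, hc'⟩) ((hmem y d).mpr ⟨hd, hd'⟩) (by simp [hcd])
  let dir : ℕ → Bool := fun c => decide (StrictMono (ρ c))
  have hinc : ∀ c, dir c = true → StrictMono (ρ c) := fun c h => by simpa [dir] using h
  have hdec : ∀ c, 1 ≤ c → c ≤ k → dir c = false → StrictAnti (ρ c) := fun c h1 h2 h =>
    (hmono c h1 h2).resolve_left (by simpa [dir] using h)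
  let L' : List (Fin m × Bool) := L.map fun a => (a.1, dir a.2)
  have hmap : L'.map Prod.fst = L.map Prod.fst := by simp [L', Function.comp_def]
  have hchain : L'.IsChain RegularStep := by
    rw [List.isChain_map, List.isChain_iff_forall_rel_of_append_cons_cons]
    rintro ⟨x, c⟩ ⟨y, d⟩ l₁ l₂ hl
    have hs := hsep _ _ _ _ hl
    have hxc : 1 ≤ c ∧ c ≤ k := (hmem x c).mp (by rw [hl]; simp)
    have hyd : 1 ≤ d ∧ d ≤ k := (hmem y d).mp (by rw [hl]; simp)
    have hxy : ρ c x < ρ d y := by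
      rw [hl, List.pairwise_append] at hL
      exact (List.pairwise_cons.mp hL.2.1).1 (y, d) (by simp)
    have hs' : ∀ z e, 1 ≤ e → e ≤ k → ρ e z ≤ ρ c x ∨ ρ d y ≤ ρ e z := fun z e h1 h2 =>
      hs (z, e) ((hmem z e).mpr ⟨h1, h2⟩)
    unfold RegularStep
    simp only
    cases hc : dir c <;> cases hd : dir d
    -- Both reads decrease, and a jump from `x` to some `y < x - 1` must be excluded. For `c < d`
    -- the `c`-th read of `y` would fall in between, and for `c = d` that of `z = x - 1`. For `d <
    -- c` the levels would satisfy `lev y ≤ lev z ≤ lev x < lev y`.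
    · refine Or.inr (Or.inl ⟨rfl, rfl, ?_⟩)
      have ic := hdec c hxc.1 hxc.2 hc
      have id := hdec d hyd.1 hyd.2 hd
      by_contra hcon
      push Not at hcon
      have hyx : y < x := by rw [Fin.lt_def]; omega
      have hxm := x.2
      rcases lt_trichotomy c d with hcd | rfl | hcd
      · rcases hs' y c hxc.1 hxc.2 with h | h
        · exact absurd (ic hyx) (not_lt.mpr h)
        · exact absurd (hlt c d y hxc.1 hcd hyd.2) (not_lt.mpr h)
      · let z : Fin m := ⟨x - 1, by omega⟩
        have hzx : z < x := by rw [Fin.lt_def]; simp only [z]; omega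
        have hyz : y < z := by rw [Fin.lt_def]; simp only [z]; omega
        rcases hs' z c hxc.1 hxc.2 with h | h
        · exact absurd (ic hzx) (not_lt.mpr h)
        · exact absurd (ic hyz) (not_lt.mpr h)
      · let z : Fin m := ⟨x - 1, by omega⟩
        have hzx : z < x := by rw [Fin.lt_def]; simp only [z]; omega
        have hyz : y < z := by rw [Fin.lt_def]; simp only [z]; omega
        obtain ⟨lev, hlev⟩ := hlev d c hyd.1 hcd hxc.2
        have h1 : ρ d z < ρ c x := by
          rcases hs' z d hyd.1 hyd.2 with h | h
          · refine lt_of_le_of_ne h fun heq => ?_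
            exact hinj z d x c hyd.1 hyd.2 hxc.1 hxc.2 hcd.ne heq
          · exact absurd (id hyz) (not_lt.mpr h)
        have h2 : ρ d y < ρ c z := by
          rcases hs' z c hxc.1 hxc.2 with h | h
          · exact absurd (ic hzx) (not_lt.mpr h)
          · refine lt_of_le_of_ne h fun heq => ?_
            exact hinj y d z c hyd.1 hyd.2 hxc.1 hxc.2 hcd.ne heq
        have := (hlev z x).1 h1
        have := (hlev y z).1 h2
        have := (hlev x y).2 hxy
        omega
    -- A turn from decreasing to increasing. Comparing both reads at the cell `max x y` gives `c <
    -- d`. Then the `c`-th read of cell `0` is not before that of `x` and its `d`-th read is not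
    -- after that of `y`, so `x` and `y` must both be cell `0`. The other turn is symmetric.
    · refine Or.inr (Or.inr (Or.inr ⟨rfl, rfl, ?_⟩))
      have ic := hdec c hxc.1 hxc.2 hc
      have id := hinc d hd
      have hm : 0 < m := by have := x.2; omega
      let o : Fin m := ⟨0, hm⟩
      have ho : ∀ z, o ≤ z := fun z => by rw [Fin.le_def]; simp [o]
      have hcd : c < d := by
        rcases lt_trichotomy c d with h | rfl | h
        · exact h
        · rw [hc] at hd
          exact absurd hd (by simp)
        · have h1 := hlt d c (max x y) hyd.1 h hxc.2
          have h2 : ρ c (max x y) ≤ ρ c x := ic.antitone (le_max_left _ _)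
          have h3 : ρ d y ≤ ρ d (max x y) := id.monotone (le_max_right _ _)
          omega
      have hco : ρ c o < ρ d o := hlt c d o hxc.1 hcd hyd.2
      have hxo : ρ c x ≤ ρ c o := ic.antitone (ho x)
      have hyo : ρ d o ≤ ρ d y := id.monotone (ho y)
      have e1 : x = o := by
        by_contra hne
        have h2 := ic (lt_of_le_of_ne (ho x) (Ne.symm hne))
        rcases hs' o c hxc.1 hxc.2 with h | h <;> omega
      have e2 : y = o := by
        by_contra hne
        have h2 := id (lt_of_le_of_ne (ho y) (Ne.symm hne))
        rcases hs' o d hyd.1 hyd.2 with h | h <;> omega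
      rw [e1, e2]
      exact ⟨rfl, rfl⟩
    · refine Or.inr (Or.inr (Or.inl ⟨rfl, rfl, ?_⟩))
      have ic := hinc c hc
      have id := hdec d hyd.1 hyd.2 hd
      have hm : 0 < m := by have := x.2; omega
      let o : Fin m := ⟨m - 1, by omega⟩
      have ho : ∀ z, z ≤ o := fun z => by have := z.2; rw [Fin.le_def]; simp only [o]; omega
      have hcd : c < d := by
        rcases lt_trichotomy c d with h | rfl | h
        · exact h
        · rw [hc] at hd
          exact absurd hd (by simp)
        · have h1 := hlt d c (min x y) hyd.1 h hxc.2
          have h2 : ρ c (min x y) ≤ ρ c x := ic.monotone (min_le_left _ _)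
          have h3 : ρ d y ≤ ρ d (min x y) := id.antitone (min_le_right _ _)
          omega
      have hco : ρ c o < ρ d o := hlt c d o hxc.1 hcd hyd.2
      have hxo : ρ c x ≤ ρ c o := ic.monotone (ho x)
      have hyo : ρ d o ≤ ρ d y := id.antitone (ho y)
      have e1 : x = o := by
        by_contra hne
        have h2 := ic (lt_of_le_of_ne (ho x) hne)
        rcases hs' o c hxc.1 hxc.2 with h | h <;> omega
      have e2 : y = o := by
        by_contra hne
        have h2 := id (lt_of_le_of_ne (ho y) hne)
        rcases hs' o d hyd.1 hyd.2 with h | h <;> omega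
      rw [e1, e2]
      exact ⟨rfl, by simp only [o]; omega⟩
    · refine Or.inl ⟨rfl, rfl, ?_⟩
      have ic := hinc c hc
      have id := hinc d hd
      by_contra hcon
      push Not at hcon
      have hyx : x < y := by rw [Fin.lt_def]; omega
      have hym := y.2
      let z : Fin m := ⟨x + 1, by omega⟩
      have hzx : x < z := by rw [Fin.lt_def]; simp only [z]; omega
      have hyz : z < y := by rw [Fin.lt_def]; simp only [z]; omega
      rcases lt_trichotomy c d with hcd | rfl | hcd
      · rcases hs' y c hxc.1 hxc.2 with h | h
        · exact absurd (ic hyx) (not_lt.mpr h)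
        · exact absurd (hlt c d y hxc.1 hcd hyd.2) (not_lt.mpr h)
      · rcases hs' z c hxc.1 hxc.2 with h | h
        · exact absurd (ic hzx) (not_lt.mpr h)
        · exact absurd (ic hyz) (not_lt.mpr h)
      · obtain ⟨lev, hlev⟩ := hlev d c hyd.1 hcd hxc.2
        have h1 : ρ d z < ρ c x := by
          rcases hs' z d hyd.1 hyd.2 with h | h
          · refine lt_of_le_of_ne h fun heq => ?_
            exact hinj z d x c hyd.1 hyd.2 hxc.1 hxc.2 hcd.ne heq
          · exact absurd (id hyz) (not_lt.mpr h)
        have h2 : ρ d y < ρ c z := by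
          rcases hs' z c hxc.1 hxc.2 with h | h
          · exact absurd (ic hzx) (not_lt.mpr h)
          · refine lt_of_le_of_ne h fun heq => ?_
            exact hinj y d z c hyd.1 hyd.2 hxc.1 hxc.2 hcd.ne heq
        have := (hlev z x).1 h1
        have := (hlev y z).1 h2
        have := (hlev x y).2 hxy
        omega
  -- The earliest read is a first read of its cell, and first reads increase along the tape.
  have hstart : ∀ e ∈ L'.head?, e.1.1 = 0 ∧ e.2 = true := by
    rcases L with _ | ⟨⟨x, c⟩, L⟩
    · simp at he
    · intro e he
      obtain rfl : (x, dir c) = e := by simpa [L'] using he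
      obtain ⟨hc1, hck⟩ := (hmem x c).mp (by simp)
      have hmin : ∀ y d, 1 ≤ d → d ≤ k → ρ c x ≤ ρ d y := by
        intro y d h1 h2
        rcases List.mem_cons.mp ((hmem y d).mpr ⟨h1, h2⟩) with h | h
        · rw [Prod.mk.injEq] at h
          rw [h.1, h.2]
        · exact ((List.pairwise_cons.mp hL).1 _ h).le
      have hc : c = 1 := by
        by_contra hne
        have := hlt 1 c x le_rfl (by omega) hck
        have := hmin x 1 le_rfl (by omega)
        omega
      subst hc
      refine ⟨?_, by simpa [dir] using hone⟩
      by_contra hne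
      have h1 : (⟨0, by have := x.2; omega⟩ : Fin m) < x := by
        rw [Fin.lt_def]
        simp only at hne ⊢
        omega
      exact absurd (hone h1) (not_lt.mpr (hmin _ 1 le_rfl hck))
  have hsnoc : L' = (L₀.map fun a => (a.1, dir a.2)) ++ [(e.1, dir e.2)] := by
    simp only [L', he]
    simp
  rw [hsnoc] at hchain hstart
  obtain ⟨W, hW, -, hsub, hWc⟩ := exists_walk_of_regularStep _ _ hstart hchain
  rw [← hsnoc, hmap] at hsub
  refine ⟨W, hW, hsub, fun p => ?_⟩
  have h1 := hWc p
  rw [← hsnoc, hmap] at h1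
  have h2 := hcount p
  omega

end ReadK

namespace ReadK

/-! ### The reads of a sequence and their times -/

section Reads

variable {α : Type} [DecidableEq α]

/-- The entries of a sequence, each with the number of its occurrence. -/
def reads (T : List α) : List (α × ℕ) :=
  T.zipIdx.map fun e => (e.1, (T.take (e.2 + 1)).count e.1)

/-- The position of the `c`-th occurrence of `x`. -/
def readTime (T : List α) (c : ℕ) (x : α) : ℕ :=
  ∑ p ∈ Finset.range T.length, if (T.take (p + 1)).count x < c then 1 else 0

theorem map_fst_reads (T : List α) : (reads T).map Prod.fst = T := by
  simp [reads, Function.comp_def]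

theorem occurrences_eq_reads (T : List α) (I : Finset ℕ) :
    occurrences T I = ((reads T).filter fun e => decide (e.2 ∈ I)).map Prod.fst := by
  have h : T.zipIdx = (List.finRange T.length).map fun p => (T.get p, p.1) := by
    apply List.ext_getElem
    · simp
    · intro i h1 h2
      simp
  unfold occurrences reads
  rw [h, List.map_map, List.filter_map, List.map_map]
  rfl

theorem reads_append_singleton (T : List α) (x : α) :
    reads (T ++ [x]) = reads T ++ [(x, T.count x + 1)] := by
  unfold reads
  rw [List.zipIdx_append, List.map_append]
  congr 1
  · apply List.map_congr_left
    rintro ⟨y, p⟩ hp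
    have := List.mem_zipIdx hp
    simp only [Prod.mk.injEq, true_and]
    rw [List.take_append_of_le_length (by omega)]
  · simp [List.take_append, List.take_of_length_le]

theorem mem_reads (T : List α) (x : α) (c : ℕ) :
    (x, c) ∈ reads T ↔ 1 ≤ c ∧ c ≤ T.count x := by
  induction T using List.reverseRecOn with
  | nil =>
    simp [reads]
    omega
  | append_singleton T y ih =>
    rw [reads_append_singleton, List.mem_append, ih, List.count_append, List.mem_singleton,
      Prod.mk.injEq, List.count_singleton]
    by_cases hxy : y = x
    · subst hxy
      simp
      omega
    · simp [hxy, Ne.symm hxy]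

/-- A class keeps all occurrences of an element or none, so occurrence numbers survive the
restriction. -/
theorem reads_filter (T : List α) (q : α → Bool) :
    reads (T.filter q) = (reads T).filter fun e => q e.1 := by
  induction T using List.reverseRecOn with
  | nil => rfl
  | append_singleton T x ih =>
    rw [List.filter_append, reads_append_singleton, List.filter_append, ← ih]
    by_cases hq : q x
    · simp [hq, reads_append_singleton, List.count_filter hq]
    · simp [hq]

/-- The prefixes that end before position `p` contain fewer occurrences of `T[p]` than the one that
ends at `p`, and later ones do not; so `readTime` counts exactly the positions below `p`. -/
theorem readTime_eq (T : List α) (p : ℕ) (hp : p < T.length) :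
    readTime T ((T.take (p + 1)).count T[p]) T[p] = p := by
  have hmono : ∀ a b, a ≤ b → (T.take a).count T[p] ≤ (T.take b).count T[p] := fun a b hab =>
    List.Sublist.count_le _ (List.take_sublist_take_left hab)
  have hstep : (T.take (p + 1)).count T[p] = (T.take p).count T[p] + 1 := by
    rw [List.take_succ_eq_append_getElem hp, List.count_append]
    simp
  unfold readTime
  rw [Finset.sum_boole]
  have : (Finset.range T.length).filter
      (fun q => (T.take (q + 1)).count T[p] < (T.take (p + 1)).count T[p]) = Finset.range p := by
    ext q
    simp only [Finset.mem_filter, Finset.mem_range]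
    constructor
    · rintro ⟨-, h⟩
      by_contra hcon
      exact absurd h (not_lt.mpr (hmono _ _ (by omega)))
    · intro h
      refine ⟨by omega, ?_⟩
      have := hmono (q + 1) p (by omega)
      omega
  rw [this]
  simp

theorem pairwise_reads (T : List α) :
    (reads T).Pairwise fun a b => readTime T a.2 a.1 < readTime T b.2 b.1 := by
  rw [List.pairwise_iff_getElem]
  intro i j hi hj hij
  have hlen : (reads T).length = T.length := by simp [reads]
  have h : ∀ i (hi : i < (reads T).length), readTime T (reads T)[i].2 (reads T)[i].1 = i := by
    intro i hi
    simp only [reads, List.getElem_map, List.getElem_zipIdx, zero_add]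
    exact readTime_eq T i (by omega)
  rw [h, h]
  exact hij

theorem readTime_injective (T : List α) {x y : α} {c d : ℕ} (hc : (x, c) ∈ reads T)
    (hd : (y, d) ∈ reads T) (h : readTime T c x = readTime T d y) : x = y ∧ c = d := by
  have : Std.Symm fun a b : α × ℕ => readTime T a.2 a.1 ≠ readTime T b.2 b.1 :=
    ⟨fun _ _ h => Ne.symm h⟩
  have h1 := List.Pairwise.forall (R := fun a b : α × ℕ => readTime T a.2 a.1 ≠ readTime T b.2 b.1)
    ((pairwise_reads T).imp fun h => h.ne) hc hd
  by_contra hcon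
  exact h1 (fun he => hcon (Prod.mk.injEq .. ▸ he)) h

theorem readTime_lt_readTime (T : List α) {x : α} {c d : ℕ} (hc : 1 ≤ c) (hcd : c < d)
    (hd : d ≤ T.count x) : readTime T c x < readTime T d x := by
  refine lt_of_le_of_ne ?_ fun h => ?_
  · refine Finset.sum_le_sum fun p _ => ?_
    split_ifs <;> omega
  · have := readTime_injective T ((mem_reads T x c).mpr ⟨hc, by omega⟩)
      ((mem_reads T x d).mpr ⟨by omega, hd⟩) h
    omega

theorem readTime_one (T : List α) {x : α} (hx : x ∈ T) : readTime T 1 x = T.idxOf x := by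
  have hlt := List.idxOf_lt_length_of_mem hx
  have hget : T[T.idxOf x] = x := List.getElem_idxOf hlt
  have h := readTime_eq T (T.idxOf x) hlt
  rw [hget, List.take_succ_eq_append_getElem hlt, List.count_append, hget,
    List.count_eq_zero_of_not_mem] at h
  · simpa using h
  · intro hmem
    obtain ⟨i, hi, hix⟩ := List.getElem_of_mem hmem
    rw [List.length_take] at hi
    rw [List.getElem_take] at hix
    have : i < List.findIdx (fun a => a == x) T := by
      simp only [List.idxOf] at hi
      omega
    have := List.not_of_lt_findIdx this
    simp [hix] at this

/-- The reads of the class form one list, which is sorted both by the times in `T` and by the times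
in the filtered sequence. -/
theorem readTime_filter_lt (T : List α) (q : α → Bool) {x y : α} {c d : ℕ}
    (hx : q x = true) (hy : q y = true) (hc : (x, c) ∈ reads T) (hd : (y, d) ∈ reads T)
    (h : readTime T c x < readTime T d y) :
    readTime (T.filter q) c x < readTime (T.filter q) d y := by
  have h1 := pairwise_reads (T.filter q)
  have h2 := (pairwise_reads T).filter fun e => q e.1
  rw [← reads_filter] at h2
  let R : α × ℕ → α × ℕ → Prop := fun a b => readTime T a.2 a.1 < readTime T b.2 b.1 ↔
    readTime (T.filter q) a.2 a.1 < readTime (T.filter q) b.2 b.1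
  let R' : α × ℕ → α × ℕ → Prop := fun a b => R a b ∧ R b a
  have : Std.Symm R' := ⟨fun _ _ h => ⟨h.2, h.1⟩⟩
  have h3 : (reads (T.filter q)).Pairwise R' := by
    refine (h1.and h2).imp ?_
    rintro a b ⟨h4, h5⟩
    simp only [R', R]
    omega
  have h4 := List.Pairwise.forall h3 (a := (x, c)) (b := (y, d))
    (by rw [reads_filter]; simp [hc, hx]) (by rw [reads_filter]; simp [hd, hy])
    (fun he => by rw [Prod.mk.injEq] at he; rw [he.1, he.2] at h; exact lt_irrefl _ h)
  exact h4.1.mp h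

/-! ### Regular classes of variables -/

/-- A class of variables on which every read is monotone and any two reads interleave in blocks,
which are numbered by a level function. -/
structure RegularClass (k : ℕ) (T : List α) (q : α → Bool) : Prop where
  mono : ∀ c, 1 ≤ c → c ≤ k →
    (∀ x y, q x = true → q y = true → readTime T 1 x < readTime T 1 y →
      readTime T c x < readTime T c y) ∨
    (∀ x y, q x = true → q y = true → readTime T 1 x < readTime T 1 y →
      readTime T c y < readTime T c x)
  level : ∀ i j, 1 ≤ i → i < j → j ≤ k → ∃ lev : α → ℕ, ∀ x y, q x = true → q y = true →
    (readTime T i x < readTime T j y → lev x ≤ lev y) ∧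
    (readTime T j x < readTime T i y → lev x < lev y) ∧
    (readTime T i x < readTime T i y → lev x ≤ lev y) ∧
    (readTime T j x < readTime T j y → lev x ≤ lev y)

theorem RegularClass.perReadMonotone {k : ℕ} {T : List α} {q : α → Bool}
    (h : RegularClass k T q) (hT : ∀ x, T.count x = k) : PerReadMonotone k (T.filter q) := by
  intro c hc
  rw [Finset.mem_Icc] at hc
  have hk : 1 ≤ k := hc.1.trans hc.2
  have hread : ∀ x c, 1 ≤ c → c ≤ k → (x, c) ∈ reads T := fun x c h1 h2 =>
    (mem_reads T x c).mpr ⟨h1, by rw [hT]; exact h2⟩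
  have hfirst : ∀ x y, q x = true → q y = true → readTime T 1 x < readTime T 1 y →
      FirstReadLT (T.filter q) x y := by
    intro x y hx hy hxy
    have hmem : ∀ x, q x = true → x ∈ T.filter q := fun x hx => by
      rw [List.mem_filter]
      refine ⟨List.count_pos_iff.mp ?_, hx⟩
      rw [hT]
      omega
    rw [FirstReadLT, ← readTime_one _ (hmem x hx), ← readTime_one _ (hmem y hy)]
    exact readTime_filter_lt T q hx hy (hread x 1 le_rfl hk) (hread y 1 le_rfl hk) hxy
  have hsort : (((reads T).filter fun e => q e.1).filter fun e => decide (e.2 ∈ ({c} : Finset ℕ))).Pairwise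
      fun a b => (q a.1 = true ∧ q b.1 = true ∧ a.2 = c ∧ b.2 = c) ∧
        readTime T a.2 a.1 < readTime T b.2 b.1 := by
    refine List.Pairwise.imp_of_mem (fun {a b} ha hb hab => ⟨?_, hab⟩)
      (((pairwise_reads T).filter _).filter _)
    simp only [List.mem_filter, Finset.mem_singleton, decide_eq_true_eq] at ha hb
    exact ⟨ha.1.2, hb.1.2, ha.2, hb.2⟩
  have hne : ∀ x y, readTime T c x < readTime T c y →
      readTime T 1 x < readTime T 1 y ∨ readTime T 1 y < readTime T 1 x := by
    intro x y hxy
    rcases lt_trichotomy (readTime T 1 x) (readTime T 1 y) with h1 | h1 | h1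
    · exact Or.inl h1
    · have := (readTime_injective T (hread x 1 le_rfl hk) (hread y 1 le_rfl hk) h1).1
      rw [this] at hxy
      exact absurd hxy (lt_irrefl _)
    · exact Or.inr h1
  rw [occurrences_eq_reads, reads_filter, List.pairwise_map, List.pairwise_map]
  rcases h.mono c hc.1 hc.2 with hm | hm
  · left
    refine hsort.imp ?_
    rintro ⟨x, a⟩ ⟨y, b⟩ ⟨⟨hx, hy, rfl, rfl⟩, hxy⟩
    rcases hne x y hxy with h1 | h1
    · exact hfirst x y hx hy h1
    · exact absurd hxy (not_lt.mpr (hm y x hy hx h1).le)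
  · right
    refine hsort.imp ?_
    rintro ⟨x, a⟩ ⟨y, b⟩ ⟨⟨hx, hy, rfl, rfl⟩, hxy⟩
    rcases hne x y hxy with h1 | h1
    · exact absurd hxy (not_lt.mpr (hm x y hx hy h1).le)
    · exact hfirst y x hy hx h1

theorem filter_lt_succ {β : Type} (κ : β → ℕ) (v : ℕ) (L : List β)
    (hL : L.Pairwise fun a b => κ a ≤ κ b) :
    L.filter (fun a => decide (κ a < v + 1)) =
      L.filter (fun a => decide (κ a < v)) ++ L.filter (fun a => decide (κ a = v)) := by
  induction L with
  | nil => rfl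
  | cons a L ih =>
    rw [List.pairwise_cons] at hL
    have ih := ih hL.2
    rcases lt_trichotomy (κ a) v with h | h | h
    · have h1 : κ a < v + 1 := by omega
      have h2 : κ a ≠ v := by omega
      simp only [List.filter_cons, h, h1, h2, ih, decide_true, decide_false, if_true,
        Bool.false_eq_true, if_false, List.cons_append]
    · have h1 : κ a < v + 1 := by omega
      have h2 : ¬ κ a < v := by omega
      have h3 : L.filter (fun a => decide (κ a < v)) = [] := by
        rw [List.filter_eq_nil_iff]
        intro b hb
        have := hL.1 b hb
        simp
        omega
      rw [h3, List.nil_append] at ih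
      rw [List.filter_cons_of_pos (by simpa using h1), List.filter_cons_of_neg (by simpa using not_lt.mp h2),
        List.filter_cons_of_pos (by simpa using h), h3, ih, List.nil_append]
    · have h1 : ¬ κ a < v + 1 := by omega
      have h2 : ¬ κ a < v := by omega
      have h3 : κ a ≠ v := by omega
      rw [List.filter_cons_of_neg (by simpa using not_lt.mp h1), List.filter_cons_of_neg (by simpa using not_lt.mp h2),
        List.filter_cons_of_neg (by simpa using h3), ih]

theorem eq_flatten_filter {β : Type} (κ : β → ℕ) (N : ℕ) (L : List β)
    (hL : L.Pairwise fun a b => κ a ≤ κ b) :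
    L.filter (fun a => decide (κ a < 2 * N)) = ((List.range N).map fun v =>
      L.filter (fun a => decide (κ a = 2 * v)) ++
        L.filter (fun a => decide (κ a = 2 * v + 1))).flatten := by
  induction N with
  | zero => simp
  | succ N ih =>
    rw [show 2 * (N + 1) = 2 * N + 1 + 1 by ring, filter_lt_succ κ _ L hL,
      filter_lt_succ κ _ L hL, ih, List.range_succ]
    simp

/-- For `i < j` give a read the key `2 * lev`, plus one if it is a `j`-th read. The four conditions
on levels say that the key does not decrease along the sequence, so the sequence is the
concatenation of its fibres; keys `2 * v` and `2 * v + 1` yield the two halves of block `v`. -/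
theorem RegularClass.regularlyInterleaving {k : ℕ} {T : List α} {q : α → Bool}
    (h : RegularClass k T q) (hT : ∀ x, T.count x = k) :
    RegularlyInterleaving k (T.filter q) := by
  intro i hi j hj hij
  wlog hlt : i < j generalizing i j
  · have := this j hj i hi (Ne.symm hij) (by omega)
    rwa [Finset.pair_comm]
  rw [Finset.mem_Icc] at hi hj
  obtain ⟨lev, hlev⟩ := h.level i j hi.1 hlt hj.2
  let κ : α × ℕ → ℕ := fun e => 2 * lev e.1 + if e.2 = j then 1 else 0
  set L := ((reads T).filter fun e => q e.1).filter fun e => decide (e.2 ∈ ({i, j} : Finset ℕ))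
    with hLdef
  have hsortT : L.Pairwise fun a b => readTime T a.2 a.1 < readTime T b.2 b.1 :=
    ((pairwise_reads T).filter _).filter _
  have hmemL : ∀ x c, (x, c) ∈ L ↔ q x = true ∧ (c = i ∨ c = j) := by
    intro x c
    simp only [hLdef, List.mem_filter, mem_reads, hT, Finset.mem_insert, Finset.mem_singleton,
      decide_eq_true_eq]
    constructor
    · rintro ⟨⟨-, h1⟩, h2⟩
      exact ⟨h1, h2⟩
    · rintro ⟨h1, h2⟩
      refine ⟨⟨?_, h1⟩, h2⟩
      rcases h2 with rfl | rfl <;> omega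
  have hsort : L.Pairwise fun a b => κ a ≤ κ b := by
    refine List.Pairwise.imp_of_mem ?_ hsortT
    rintro ⟨x, c⟩ ⟨y, d⟩ hx hy hxy
    rw [hmemL] at hx hy
    obtain ⟨h1, h2, h3, h4⟩ := hlev x y hx.1 hy.1
    simp only at hxy
    simp only [κ]
    rcases hx.2 with rfl | rfl <;> rcases hy.2 with rfl | rfl
    · have := h3 hxy
      omega
    · have := h1 hxy
      split_ifs <;> omega
    · have := h2 hxy
      split_ifs <;> omega
    · have := h4 hxy
      omega
  have hnodup : ∀ v, ((L.filter fun a => decide (κ a = v)).map Prod.fst).Nodup := by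
    intro v
    rw [List.Nodup, List.pairwise_map]
    refine List.Pairwise.imp_of_mem ?_ (hsortT.filter _)
    rintro ⟨x, c⟩ ⟨y, d⟩ hx hy hxy hcon
    simp only [List.mem_filter, hmemL, decide_eq_true_eq, κ] at hx hy
    simp only at hxy hcon
    subst hcon
    have : c = d := by
      have h1 := hx.2
      have h2 := hy.2
      rcases hx.1.2 with rfl | rfl <;> rcases hy.1.2 with rfl | rfl <;> simp_all
    subst this
    exact lt_irrefl _ hxy
  have hA : ∀ v x, x ∈ (L.filter fun a => decide (κ a = 2 * v)).map Prod.fst ↔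
      q x = true ∧ lev x = v := by
    intro v x
    simp only [List.mem_map, List.mem_filter, decide_eq_true_eq, Prod.exists, κ]
    constructor
    · rintro ⟨y, c, ⟨h1, h2⟩, rfl⟩
      rw [hmemL] at h1
      refine ⟨h1.1, ?_⟩
      split_ifs at h2 <;> omega
    · rintro ⟨h1, rfl⟩
      exact ⟨x, i, ⟨(hmemL x i).mpr ⟨h1, Or.inl rfl⟩, by simp [hij]⟩, rfl⟩
  have hB : ∀ v x, x ∈ (L.filter fun a => decide (κ a = 2 * v + 1)).map Prod.fst ↔
      q x = true ∧ lev x = v := by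
    intro v x
    simp only [List.mem_map, List.mem_filter, decide_eq_true_eq, Prod.exists, κ]
    constructor
    · rintro ⟨y, c, ⟨h1, h2⟩, rfl⟩
      rw [hmemL] at h1
      refine ⟨h1.1, ?_⟩
      split_ifs at h2 <;> omega
    · rintro ⟨h1, rfl⟩
      exact ⟨x, j, ⟨(hmemL x j).mpr ⟨h1, Or.inr rfl⟩, by simp⟩, rfl⟩
  obtain ⟨N, hN⟩ : ∃ N, ∀ a ∈ L, κ a < 2 * N := by
    refine ⟨(L.map κ).sum + 1, fun a ha => ?_⟩
    have := List.single_le_sum (fun _ _ => Nat.zero_le _) _ (List.mem_map_of_mem (f := κ) ha)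
    omega
  have hflat := eq_flatten_filter κ N L hsort
  rw [List.filter_eq_self.mpr (fun a ha => by simpa using hN a ha)] at hflat
  refine ⟨(List.range N).map fun v => ((L.filter fun a => decide (κ a = 2 * v)).map Prod.fst,
    (L.filter fun a => decide (κ a = 2 * v + 1)).map Prod.fst), ?_, ?_, ?_⟩
  · rw [occurrences_eq_reads, reads_filter, ← hLdef]
    conv_lhs => rw [hflat]
    simp [List.map_flatten, Function.comp_def]
  · intro b hb
    obtain ⟨v, -, rfl⟩ := List.mem_map.mp hb
    refine ⟨hnodup _, ?_⟩
    rw [List.perm_ext_iff_of_nodup (hnodup _) (hnodup _)]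
    intro x
    rw [hA, hB]
  · rw [List.pairwise_map]
    refine List.nodup_range.imp ?_
    intro v v' hvv x hx hx'
    rw [hA] at hx hx'
    exact hvv (hx.2.symm.trans hx'.2)

theorem RegularClass.headVisits {k m : ℕ} {T : List α} {q : α → Bool}
    (h : RegularClass k T q) (hT : ∀ x, T.count x = k) (cell : Fin m → α)
    (hcell : ∀ x, q (cell x) = true)
    (hmono : ∀ x y, x < y → readTime T 1 (cell x) < readTime T 1 (cell y))
    (sel : α → Option (Fin m)) (hsel : ∀ a x, sel a = some x ↔ a = cell x) :
    HeadVisitsAtMost (2 * k) (T.filterMap sel) := by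
  let L : List (Fin m × ℕ) := (reads T).filterMap fun e => (sel e.1).map fun x => (x, e.2)
  have hL : L.map Prod.fst = T.filterMap sel := by
    conv_rhs => rw [← map_fst_reads T]
    rw [List.map_filterMap, List.filterMap_map]
    congr 1
    funext e
    simp only [Function.comp_apply]
    cases sel e.1 <;> rfl
  have hmemL : ∀ x c, (x, c) ∈ L ↔ 1 ≤ c ∧ c ≤ k := by
    intro x c
    simp only [L, List.mem_filterMap, Option.map_eq_some_iff, Prod.exists, Prod.mk.injEq]
    constructor
    · rintro ⟨a, d, hd, y, -, -, rfl⟩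
      rw [mem_reads, hT] at hd
      exact hd
    · intro hc
      exact ⟨cell x, c, (mem_reads T _ _).mpr (by rwa [hT]), x, (hsel _ _).mpr rfl, rfl, rfl⟩
  rw [← hL]
  refine headVisits_of_regular (fun c x => readTime T c (cell x)) L ?_ hmemL ?_ ?_ ?_ ?_ ?_
  · rw [List.pairwise_filterMap]
    refine (pairwise_reads T).imp ?_
    rintro ⟨a, c⟩ ⟨b, d⟩ hab x hx y hy
    simp only [Option.map_eq_some_iff] at hx hy
    obtain ⟨x, hx, rfl⟩ := hx
    obtain ⟨y, hy, rfl⟩ := hy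
    rw [hsel] at hx hy
    simp only [← hx, ← hy]
    exact hab
  · intro x
    rw [hL, List.count_filterMap, ← hT (cell x), List.count]
    refine List.countP_mono_left fun a _ ha => ?_
    rw [beq_iff_eq, hsel] at ha
    simp [ha]
  · exact fun x y hxy => hmono x y hxy
  · exact fun c d x hc hcd hd => readTime_lt_readTime T hc hcd (by rw [hT]; exact hd)
  · intro c hc hck
    rcases h.mono c hc hck with h1 | h1
    · exact Or.inl fun x y hxy => h1 _ _ (hcell x) (hcell y) (hmono x y hxy)
    · exact Or.inr fun x y hxy => h1 _ _ (hcell x) (hcell y) (hmono x y hxy)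
  · intro i j hi hij hj
    obtain ⟨lev, hlev⟩ := h.level i j hi hij hj
    refine ⟨fun x => lev (cell x), fun x y => ?_⟩
    have := hlev _ _ (hcell x) (hcell y)
    exact ⟨this.1, this.2.1⟩

end Reads

/-! ### Padded sequences -/

theorem count_padReads {n k : ℕ} (S : List (Fin n)) (hS : ∀ x, S.count x ≤ k) (x : Fin n) :
    (padReads k S).count x = k := by
  have h : ∀ l : List (Fin n), l.Nodup → (l.flatMap fun y => List.replicate (k - S.count y) y).count x
      = if x ∈ l then k - S.count x else 0 := by
    intro l
    induction l with
    | nil => simp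
    | cons y l ih =>
      intro hl
      rw [List.nodup_cons] at hl
      rw [List.flatMap_cons, List.count_append, ih hl.2, List.count_replicate]
      by_cases hxy : y = x
      · subst hxy
        simp [hl.1]
      · simp [hxy, Ne.symm hxy]
  rw [padReads, List.count_append, h _ (List.nodup_finRange n), if_pos (List.mem_finRange x)]
  have := hS x
  omega

theorem headVisits_sublist {m d : ℕ} {T T' : List (Fin m)} (h : HeadVisitsAtMost d T)
    (hT : T'.Sublist T) : HeadVisitsAtMost d T' := by
  obtain ⟨W, h1, h2, h3⟩ := h
  exact ⟨W, h1, hT.trans h2, h3⟩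

end ReadK

namespace ReadK

/-! ### Bounded search and ranks -/

/-- The least number below `n` that satisfies `P`, or `n` if there is none. -/
def least (P : ℕ → Prop) [DecidablePred P] : ℕ → ℕ
  | 0 => 0
  | n + 1 => if least P n < n then least P n else if P n then n else n + 1

theorem least_spec (P : ℕ → Prop) [DecidablePred P] (n : ℕ) :
    least P n ≤ n ∧ (least P n < n → P (least P n)) ∧ ∀ y < n, P y → least P n ≤ y := by
  induction n with
  | zero => simp [least]
  | succ n ih =>
    obtain ⟨h1, h2, h3⟩ := ih
    simp only [least]
    split_ifs with h4 h5
    · refine ⟨by omega, fun _ => h2 h4, fun y hy hP => ?_⟩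
      rcases Nat.lt_succ_iff_lt_or_eq.mp hy with h | rfl
      · exact h3 y h hP
      · omega
    · refine ⟨by omega, fun _ => h5, fun y hy hP => ?_⟩
      rcases Nat.lt_succ_iff_lt_or_eq.mp hy with h | rfl
      · have := h3 y h hP
        omega
      · exact le_rfl
    · refine ⟨le_rfl, fun h => absurd h (lt_irrefl _), fun y hy hP => ?_⟩
      rcases Nat.lt_succ_iff_lt_or_eq.mp hy with h | rfl
      · have := h3 y h hP
        omega
      · exact absurd hP h5

theorem least_lt {P : ℕ → Prop} [DecidablePred P] {n y : ℕ} (hy : y < n) (h : P y) :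
    least P n < n := ((least_spec P n).2.2 y hy h).trans_lt hy

theorem least_congr {P Q : ℕ → Prop} [DecidablePred P] [DecidablePred Q] (h : ∀ y, P y ↔ Q y)
    (n : ℕ) : least P n = least Q n := by
  induction n with
  | zero => rfl
  | succ n ih => simp only [least, ih, h]

/-- One round of the computation of ranks: the elements with key `τ` are ranked. -/
def rankStep (n : ℕ) (R : ℕ → ℕ → Prop) [DecidableRel R] (q : ℕ → ℕ) (τ : ℕ) (F : ℕ → ℕ) : ℕ → ℕ :=
  fun x => if x < n ∧ q x = τ then (Finset.range n).sup fun y => if R y x then F y + 1 else 0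
    else F x

/-- The ranks after the elements with keys below a bound have been treated. -/
def rank (n : ℕ) (R : ℕ → ℕ → Prop) [DecidableRel R] (q : ℕ → ℕ) : ℕ → ℕ → ℕ
  | 0 => fun _ => 0
  | τ + 1 => rankStep n R q τ (rank n R q τ)

section Rank

variable {n : ℕ} {R : ℕ → ℕ → Prop} [DecidableRel R] {q : ℕ → ℕ}

theorem rank_of_le {x : ℕ} (hx : n ≤ x) (τ : ℕ) : rank n R q τ x = 0 := by
  induction τ with
  | zero => rfl
  | succ τ ih =>
    simp only [rank, rankStep]
    rw [if_neg (by omega), ih]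

theorem rank_le (τ x : ℕ) : rank n R q τ x ≤ τ := by
  induction τ generalizing x with
  | zero => exact le_rfl
  | succ τ ih =>
    simp only [rank, rankStep]
    split_ifs with h
    · refine Finset.sup_le fun y _ => ?_
      have := ih y
      split_ifs <;> omega
    · exact (ih x).trans (by omega)

theorem rank_stable {x τ τ' : ℕ} (hx : q x < τ) (hτ : τ ≤ τ') :
    rank n R q τ' x = rank n R q τ x := by
  induction τ', hτ using Nat.le_induction with
  | base => rfl
  | succ τ' hτ ih =>
    simp only [rank, rankStep]
    rw [if_neg (by omega), ih]

/-- The key grows along `R`, so the predecessors of `x` have received their final ranks before round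
`q x`. Thus the rank is the number of elements before `x` in a longest `R`-chain ending there. -/
theorem rank_eq {N : ℕ} (hR : ∀ y x, y < n → x < n → R y x → q y < q x) {x : ℕ} (hx : x < n)
    (hN : q x < N) :
    rank n R q N x = (Finset.range n).sup fun y => if R y x then rank n R q N y + 1 else 0 := by
  rw [rank_stable (Nat.lt_succ_self (q x)) hN]
  simp only [rank, rankStep]
  rw [if_pos ⟨hx, trivial⟩]
  refine Finset.sup_congr rfl fun y hy => ?_
  rw [Finset.mem_range] at hy
  split_ifs with h
  · rw [rank_stable (τ := q x) (τ' := N) (hR y x hy hx h) hN.le]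
  · rfl

theorem rank_lt {N : ℕ} (hR : ∀ y x, y < n → x < n → R y x → q y < q x) {x y : ℕ} (hx : x < n)
    (hy : y < n) (hN : q x < N) (hyx : R y x) : rank n R q N y < rank n R q N x := by
  rw [rank_eq hR hx hN]
  have := Finset.le_sup (f := fun y => if R y x then rank n R q N y + 1 else 0)
    (Finset.mem_range.mpr hy)
  simp only [hyx, if_true] at this
  exact this

theorem exists_rank_pred {N : ℕ} (hR : ∀ y x, y < n → x < n → R y x → q y < q x) {x : ℕ}
    (hx : x < n) (hN : q x < N) (h0 : rank n R q N x ≠ 0) :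
    ∃ y < n, R y x ∧ rank n R q N y + 1 = rank n R q N x := by
  rw [rank_eq hR hx hN] at h0 ⊢
  obtain ⟨y, hy, hyx⟩ := Finset.exists_mem_eq_sup (Finset.range n) ⟨x, Finset.mem_range.mpr hx⟩
    fun y => if R y x then rank n R q N y + 1 else 0
  rw [hyx] at h0 ⊢
  split_ifs at h0 ⊢ with h
  · exact ⟨y, Finset.mem_range.mp hy, h, rfl⟩
  · exact absurd rfl h0

end Rank

/-! ### Labels of classes -/

/-- The label of a class is its least element; the classes of `lab` are split by `comp`. -/
def refine (n : ℕ) (lab comp : ℕ → ℕ) : ℕ → ℕ :=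
  fun x => if x < n then least (fun y => lab y = lab x ∧ comp y = comp x) n else 0

/-- Every class is labelled by one of its elements. -/
def IsLabelling (n : ℕ) (lab : ℕ → ℕ) : Prop :=
  ∀ x < n, lab x ≤ x ∧ lab (lab x) = lab x

theorem refine_lt {n : ℕ} {lab comp : ℕ → ℕ} {x : ℕ} (hx : x < n) : refine n lab comp x < n := by
  rw [refine, if_pos hx]
  exact least_lt hx ⟨rfl, rfl⟩

theorem refine_of_le {n : ℕ} {lab comp : ℕ → ℕ} {x : ℕ} (hx : n ≤ x) : refine n lab comp x = 0 := by
  rw [refine, if_neg (by omega)]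

theorem refine_eq_iff {n : ℕ} {lab comp : ℕ → ℕ} {x y : ℕ} (hx : x < n) (hy : y < n) :
    refine n lab comp x = refine n lab comp y ↔ lab x = lab y ∧ comp x = comp y := by
  constructor
  · intro h
    have h1 := refine_lt (lab := lab) (comp := comp) hx
    have h2 := refine_lt (lab := lab) (comp := comp) hy
    rw [refine, if_pos hx] at h h1
    rw [refine, if_pos hy] at h h2
    have h3 := (least_spec _ n).2.1 h1
    have h4 := (least_spec _ n).2.1 h2
    rw [h] at h3
    exact ⟨h3.1.symm.trans h4.1, h3.2.symm.trans h4.2⟩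
  · rintro ⟨h1, h2⟩
    rw [refine, if_pos hx, refine, if_pos hy]
    exact least_congr (fun z => by rw [h1, h2]) n

theorem refine_isLabelling (n : ℕ) (lab comp : ℕ → ℕ) : IsLabelling n (refine n lab comp) := by
  intro x hx
  have h1 := refine_lt (lab := lab) (comp := comp) hx
  refine ⟨?_, ?_⟩
  · rw [refine, if_pos hx]
    exact (least_spec _ n).2.2 x hx ⟨rfl, rfl⟩
  · rw [refine_eq_iff h1 hx]
    rw [refine, if_pos hx] at h1 ⊢
    exact (least_spec _ n).2.1 h1

/-- The number of classes. -/
def numClasses (n : ℕ) (lab : ℕ → ℕ) : ℕ := ((Finset.range n).image lab).card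

/-- A label belongs to the class that it names, so it is determined by its own old label and
component. -/
theorem numClasses_refine_le (n K : ℕ) (lab comp : ℕ → ℕ) (hcomp : ∀ x < n, comp x < K) :
    numClasses n (refine n lab comp) ≤ numClasses n lab * K := by
  rw [numClasses, numClasses]
  calc _ ≤ (((Finset.range n).image lab) ×ˢ Finset.range K).card := by
        rw [← Finset.card_image_of_injOn (s := (Finset.range n).image (refine n lab comp))
          (f := fun z => (lab z, comp z))]
        · refine Finset.card_le_card fun p hp => ?_
          simp only [Finset.mem_image, Finset.mem_range] at hp
          obtain ⟨z, ⟨x, hx, rfl⟩, rfl⟩ := hp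
          have := refine_lt (lab := lab) (comp := comp) hx
          simp only [Finset.mem_product, Finset.mem_image, Finset.mem_range]
          exact ⟨⟨_, this, rfl⟩, hcomp _ this⟩
        · intro z hz z' hz' h
          simp only [Finset.coe_image, Finset.coe_range, Set.mem_image, Set.mem_Iio] at hz hz'
          obtain ⟨x, hx, rfl⟩ := hz
          obtain ⟨y, hy, rfl⟩ := hz'
          rw [Prod.mk.injEq] at h
          have h1 := refine_lt (lab := lab) (comp := comp) hx
          have h2 := refine_lt (lab := lab) (comp := comp) hy
          have h3 := (refine_eq_iff h1 h2).mpr h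
          rwa [(refine_isLabelling n lab comp x hx).2, (refine_isLabelling n lab comp y hy).2] at h3
    _ = _ := by simp [Finset.card_product]

/-! ### Splitting classes into monotone ones -/

/-- `y` precedes `x` in both orders, both being unmarked elements of one class. -/
def monoRel (lab ext p q : ℕ → ℕ) (y x : ℕ) : Prop :=
  lab y = lab x ∧ ext y = 0 ∧ ext x = 0 ∧ p y < p x ∧ q y < q x

instance (lab ext p q : ℕ → ℕ) : DecidableRel (monoRel lab ext p q) := fun y x => by
  unfold monoRel
  infer_instance

/-- The ranks of the unmarked elements. -/
def monoRank (n N : ℕ) (lab ext p q : ℕ → ℕ) : ℕ → ℕ := rank n (monoRel lab ext p q) q N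

/-- An unmarked element that ends a chain with `K` elements, or `n`. -/
def chainTop (n N K : ℕ) (lab ext p q : ℕ → ℕ) : ℕ :=
  least (fun x => ext x = 0 ∧ monoRank n N lab ext p q x + 1 = K) n

/-- The elements of a chain with `K` elements, from the last one on. -/
def chainElem (n N K : ℕ) (lab ext p q : ℕ → ℕ) : ℕ → ℕ
  | 0 => chainTop n N K lab ext p q
  | i + 1 => least (fun y => monoRel lab ext p q y (chainElem n N K lab ext p q i) ∧
      monoRank n N lab ext p q y + 1 =
        monoRank n N lab ext p q (chainElem n N K lab ext p q i)) n

/-- A chain with `K` elements is marked by `j + 1`. -/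
def markStep (n N K : ℕ) (lab p q : ℕ → ℕ) (j : ℕ) (ext : ℕ → ℕ) : ℕ → ℕ :=
  fun x => if x < n ∧ ext x = 0 ∧ chainTop n N K lab ext p q < n ∧
    (∃ i < K, chainElem n N K lab ext p q i = x) then j + 1 else ext x

/-- The marks after a number of rounds. -/
def mark (n N K : ℕ) (lab p q : ℕ → ℕ) : ℕ → ℕ → ℕ
  | 0 => fun _ => 0
  | j + 1 => markStep n N K lab p q j (mark n N K lab p q j)

/-- Marked elements are split by their marks and unmarked ones by their ranks. -/
def monoComp (n N K : ℕ) (lab p q : ℕ → ℕ) : ℕ → ℕ :=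
  fun x => if mark n N K lab p q n x = 0 then
      2 * monoRank n N lab (mark n N K lab p q n) p q x
    else 2 * mark n N K lab p q n x + 1

section Mono

variable {n N K : ℕ} {lab p q : ℕ → ℕ}

theorem monoRel_key {ext : ℕ → ℕ} (y x : ℕ) (_ : y < n) (_ : x < n)
    (h : monoRel lab ext p q y x) : q y < q x := h.2.2.2.2

/-- An element of positive rank has a predecessor of rank exactly one less, where the supremum is
attained. Starting from rank `K - 1`, the search therefore succeeds until `K` elements are found. -/
theorem chainElem_spec {ext : ℕ → ℕ} (hN : ∀ x < n, q x < N)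
    (htop : chainTop n N K lab ext p q < n) (i : ℕ) (hi : i < K) :
    chainElem n N K lab ext p q i < n ∧ ext (chainElem n N K lab ext p q i) = 0 ∧
      monoRank n N lab ext p q (chainElem n N K lab ext p q i) + 1 + i = K := by
  induction i with
  | zero =>
    have := (least_spec _ n).2.1 htop
    exact ⟨htop, this.1, this.2⟩
  | succ i ih =>
    obtain ⟨h1, h2, h3⟩ := ih (by omega)
    obtain ⟨y, hy, hyx, hr⟩ := exists_rank_pred (N := N) (R := monoRel lab ext p q) monoRel_key h1
      (hN _ h1) (by unfold monoRank at h3; omega)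
    have h4 : chainElem n N K lab ext p q (i + 1) < n := least_lt hy ⟨hyx, hr⟩
    have h5 := (least_spec _ n).2.1 h4
    refine ⟨h4, h5.1.2.1, ?_⟩
    have h6 := h5.2
    change monoRank n N lab ext p q (chainElem n N K lab ext p q (i + 1)) + 1 = _ at h6
    omega

theorem chainElem_rel {ext : ℕ → ℕ} (hN : ∀ x < n, q x < N)
    (htop : chainTop n N K lab ext p q < n) (i i' : ℕ) (hii : i < i') (hi : i' < K) :
    monoRel lab ext p q (chainElem n N K lab ext p q i') (chainElem n N K lab ext p q i) := by
  induction i', hii using Nat.le_induction with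
  | base =>
    have h4 := (chainElem_spec hN htop (i + 1) hi).1
    exact ((least_spec _ n).2.1 h4).1
  | succ i' hii ih =>
    have h1 := ih (by omega)
    have h4 := (chainElem_spec hN htop (i' + 1) hi).1
    have h2 : monoRel lab ext p q (chainElem n N K lab ext p q (i' + 1))
      (chainElem n N K lab ext p q i') := ((least_spec _ n).2.1 h4).1
    exact ⟨h2.1.trans h1.1, h2.2.1, h1.2.2.1, h2.2.2.2.1.trans h1.2.2.2.1,
      h2.2.2.2.2.trans h1.2.2.2.2⟩

theorem mark_of_le {x : ℕ} (hx : n ≤ x) (j : ℕ) : mark n N K lab p q j x = 0 := by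
  induction j with
  | zero => rfl
  | succ j ih =>
    simp only [mark, markStep]
    rw [if_neg (by omega), ih]

theorem mark_le (j x : ℕ) : mark n N K lab p q j x ≤ j := by
  induction j with
  | zero => exact le_rfl
  | succ j ih =>
    simp only [mark, markStep]
    split_ifs <;> omega

theorem mark_stable {j j' x : ℕ} (hjj : j ≤ j') (h : mark n N K lab p q j x ≠ 0) :
    mark n N K lab p q j' x = mark n N K lab p q j x := by
  induction j', hjj using Nat.le_induction with
  | base => rfl
  | succ j' hjj ih =>
    rw [← ih]
    simp only [mark, markStep]
    rw [if_neg]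
    rw [ih]
    exact fun hcon => h hcon.2.1

/-- The elements with mark `j + 1` form a chain with `K` elements. -/
theorem exists_chain_of_mark {j r x : ℕ} (hx : mark n N K lab p q r x = j + 1) :
    chainTop n N K lab (mark n N K lab p q j) p q < n ∧
      ∃ i < K, chainElem n N K lab (mark n N K lab p q j) p q i = x := by
  induction r with
  | zero => exact absurd hx (by simp [mark])
  | succ r ih =>
    by_cases h : mark n N K lab p q r x = j + 1
    · exact ih h
    · simp only [mark, markStep] at hx
      split_ifs at hx with h1
      · obtain rfl : r = j := by omega
        exact h1.2.2
      · exact absurd hx h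

theorem mark_chainElem (hN : ∀ x < n, q x < N) {j r : ℕ} (hjr : j < r)
    (htop : chainTop n N K lab (mark n N K lab p q j) p q < n) (i : ℕ) (hi : i < K) :
    mark n N K lab p q r (chainElem n N K lab (mark n N K lab p q j) p q i) = j + 1 := by
  have h := chainElem_spec hN htop i hi
  have h1 : mark n N K lab p q (j + 1) (chainElem n N K lab (mark n N K lab p q j) p q i) = j + 1 := by
    simp only [mark, markStep]
    rw [if_pos ⟨h.1, h.2.1, htop, i, hi, rfl⟩]
  rw [mark_stable (Nat.succ_le_of_lt hjr) (by rw [h1]; omega), h1]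

/-- Every nonzero mark that occurs is carried by a whole chain of `K` elements, and the sets
carrying different marks are disjoint. -/
theorem card_mark_le (hN : ∀ x < n, q x < N) (r : ℕ) :
    ((Finset.range n).image (mark n N K lab p q r) \ {0}).card * K ≤ n := by
  set V := (Finset.range n).image (mark n N K lab p q r) \ {0} with hV
  calc V.card * K ≤ ∑ v ∈ V, ((Finset.range n).filter fun x => mark n N K lab p q r x = v).card := by
        rw [← smul_eq_mul, ← Finset.sum_const]
        refine Finset.sum_le_sum fun v hv => ?_
        simp only [hV, Finset.mem_sdiff, Finset.mem_image, Finset.mem_range,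
          Finset.mem_singleton] at hv
        obtain ⟨⟨x, hx, hxv⟩, hv0⟩ := hv
        obtain ⟨j, rfl⟩ := Nat.exists_eq_succ_of_ne_zero hv0
        obtain ⟨htop, -⟩ := exists_chain_of_mark hxv
        have hjr : j < r := by
          have := mark_le (n := n) (N := N) (K := K) (lab := lab) (p := p) (q := q) r x
          omega
        calc K = (Finset.range K).card := by simp
          _ = ((Finset.range K).image (chainElem n N K lab (mark n N K lab p q j) p q)).card := by
              rw [Finset.card_image_of_injOn]
              intro a ha b hb hab
              have h1 := chainElem_spec hN htop a (by simpa using ha)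
              have h2 := chainElem_spec hN htop b (by simpa using hb)
              rw [hab] at h1
              omega
          _ ≤ _ := by
              refine Finset.card_le_card fun y hy => ?_
              simp only [Finset.mem_image, Finset.mem_range] at hy
              obtain ⟨i, hi, rfl⟩ := hy
              simp only [Finset.mem_filter, Finset.mem_range]
              exact ⟨(chainElem_spec hN htop i hi).1, mark_chainElem hN hjr htop i hi⟩
    _ = ((Finset.range n).filter fun x => mark n N K lab p q r x ∈ V).card := by
        rw [Finset.card_eq_sum_card_fiberwise (f := mark n N K lab p q r) (t := V)]
        · refine Finset.sum_congr rfl fun v hv => ?_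
          congr 1
          ext x
          simp only [Finset.mem_filter]
          constructor
          · rintro ⟨h1, rfl⟩
            exact ⟨⟨h1, hv⟩, rfl⟩
          · rintro ⟨⟨h1, -⟩, h2⟩
            exact ⟨h1, h2⟩
        · intro x hx
          simpa using (Finset.mem_filter.mp hx).2
    _ ≤ n := by
        refine (Finset.card_filter_le _ _).trans ?_
        simp

/-- While a chain exists, the round marks at least its top, so the number of marked elements grows;
once there is none, the marks no longer change. -/
theorem chainTop_mark (hN : ∀ x < n, q x < N) (hK : 1 ≤ K) (j : ℕ) :
    chainTop n N K lab (mark n N K lab p q j) p q = n ∨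
      j ≤ ((Finset.range n).filter fun x => mark n N K lab p q j x ≠ 0).card := by
  induction j with
  | zero => exact Or.inr (Nat.zero_le _)
  | succ j ih =>
    by_cases htop : chainTop n N K lab (mark n N K lab p q j) p q < n
    · right
      have hj := ih.resolve_left (by omega)
      refine lt_of_le_of_lt hj (Finset.card_lt_card ?_)
      rw [Finset.ssubset_iff_of_subset]
      · refine ⟨chainElem n N K lab (mark n N K lab p q j) p q 0, ?_, ?_⟩
        · simp only [Finset.mem_filter, Finset.mem_range]
          exact ⟨htop, by rw [mark_chainElem hN (Nat.lt_succ_self j) htop 0 hK]; omega⟩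
        · simp only [Finset.mem_filter, Finset.mem_range, not_and, not_not]
          exact fun _ => (chainElem_spec hN htop 0 hK).2.1
      · intro x hx
        simp only [Finset.mem_filter] at hx ⊢
        exact ⟨hx.1, by rw [mark_stable (Nat.le_succ j) hx.2]; exact hx.2⟩
    · left
      have : mark n N K lab p q (j + 1) = mark n N K lab p q j := by
        funext x
        simp only [mark, markStep]
        rw [if_neg]
        exact fun h => htop h.2.2.1
      rw [this]
      exact le_antisymm (least_spec _ n).1 (not_lt.mp htop)

/-- After `n` rounds there is no chain with `K` unmarked elements. -/
theorem monoRank_lt (hN : ∀ x < n, q x < N) (hK : 1 ≤ K) {x : ℕ} (hx : x < n)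
    (hx0 : mark n N K lab p q n x = 0) :
    monoRank n N lab (mark n N K lab p q n) p q x + 1 < K := by
  have htop : chainTop n N K lab (mark n N K lab p q n) p q = n := by
    refine (chainTop_mark hN hK n).resolve_right fun h => ?_
    have h1 : (Finset.range n).filter (fun x => mark n N K lab p q n x ≠ 0) = Finset.range n := by
      apply Finset.eq_of_subset_of_card_le (Finset.filter_subset _ _)
      simpa using h
    have h2 : x ∈ (Finset.range n).filter (fun x => mark n N K lab p q n x ≠ 0) := by
      rw [h1]
      simpa using hx
    exact (Finset.mem_filter.mp h2).2 hx0
  set ext := mark n N K lab p q n with hext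
  by_contra hcon
  -- From an unmarked element of rank at least `K - 1` one can go down, one rank at a time, to rank
  -- exactly `K - 1`, where a chain would still end.
  have key : ∀ d x, x < n → ext x = 0 → monoRank n N lab ext p q x + 1 = K + d → False := by
    intro d
    induction d with
    | zero =>
      intro x hx h0 h1
      have := least_lt (P := fun x => ext x = 0 ∧ monoRank n N lab ext p q x + 1 = K) hx
        ⟨h0, by omega⟩
      change chainTop n N K lab ext p q < n at this
      omega
    | succ d ih =>
      intro x hx h0 h1
      obtain ⟨y, hy, hyx, hr⟩ := exists_rank_pred (N := N) (R := monoRel lab ext p q) monoRel_key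
        hx (hN _ hx) (by unfold monoRank at h1; omega)
      refine ih y hy hyx.2.1 ?_
      unfold monoRank at h1 ⊢
      omega
  exact key _ x hx hx0 (Nat.add_sub_of_le (not_lt.mp hcon)).symm

/-- Elements of one new class are read in the same order or in opposite orders. -/
theorem monoComp_mono (hN : ∀ x < n, q x < N) (hq : ∀ x y, x < n → y < n → q x = q y → x = y) :
    ∀ v l, (∀ x y, x < n → y < n → lab x = l → lab y = l → monoComp n N K lab p q x = v →
        monoComp n N K lab p q y = v → p x < p y → q x < q y) ∨
      (∀ x y, x < n → y < n → lab x = l → lab y = l → monoComp n N K lab p q x = v →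
        monoComp n N K lab p q y = v → p x < p y → q y < q x) := by
  intro v l
  rcases Nat.even_or_odd' v with ⟨u, hu | hu⟩
  -- Even components consist of unmarked elements of equal rank. No two of them are related by
  -- `monoRel`, so the two orders are opposite.
  · right
    intro x y hx hy hlx hly hcx hcy hxy
    unfold monoComp at hcx hcy
    split_ifs at hcx hcy with h1 h2
    · by_contra hcon
      have hne : q x ≠ q y := fun h => by
        rw [hq x y hx hy h] at hxy
        exact lt_irrefl _ hxy
      have := rank_lt (R := monoRel lab (mark n N K lab p q n) p q) (q := q) (N := N) monoRel_key
        hy hx (hN y hy) ⟨hlx.trans hly.symm, h1, h2, hxy, by omega⟩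
      unfold monoRank at hcx hcy
      omega
    all_goals omega
  -- Elements with the same odd component lie in one chain, which increases in both orders.
  · left
    intro x y hx hy hlx hly hcx hcy hxy
    unfold monoComp at hcx hcy
    split_ifs at hcx hcy with h1 h2
    all_goals first | omega | skip
    obtain ⟨j, hj⟩ := Nat.exists_eq_succ_of_ne_zero h1
    obtain ⟨htop, i, hi, rfl⟩ := exists_chain_of_mark hj
    obtain ⟨-, i', hi', rfl⟩ := exists_chain_of_mark (n := n) (N := N) (K := K) (lab := lab) (p := p) (q := q)
      (j := j) (r := n) (x := y) (by omega)
    rcases lt_trichotomy i i' with h | rfl | h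
    · have := (chainElem_rel hN htop i i' h hi').2.2.2.1
      omega
    · exact absurd hxy (lt_irrefl _)
    · exact (chainElem_rel hN htop i' i h hi).2.2.2.2

theorem mark_lab (hN : ∀ x < n, q x < N) {x y : ℕ}
    (hx : mark n N K lab p q n x ≠ 0) (hxy : mark n N K lab p q n x = mark n N K lab p q n y) :
    lab x = lab y := by
  obtain ⟨j, hj⟩ := Nat.exists_eq_succ_of_ne_zero hx
  obtain ⟨htop, i, hi, rfl⟩ := exists_chain_of_mark hj
  obtain ⟨-, i', hi', rfl⟩ := exists_chain_of_mark (hxy ▸ hj)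
  rcases lt_trichotomy i i' with h | rfl | h
  · exact (chainElem_rel hN htop i i' h hi').1.symm
  · rfl
  · exact (chainElem_rel hN htop i' i h hi).1

/-- Each chain lies in one old class and becomes one new class, and there are at most `n / K`
disjoint chains of `K` elements. The unmarked elements of an old class have at most `K - 1`
different ranks. -/
theorem numClasses_mono_le (hN : ∀ x < n, q x < N) (hK : 1 ≤ K) :
    numClasses n (refine n lab (monoComp n N K lab p q)) ≤
      n / K + numClasses n lab * (K - 1) := by
  classical
  set lab' := refine n lab (monoComp n N K lab p q) with hlab'
  set E := mark n N K lab p q n with hE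
  have hsplit : (Finset.range n).image lab' =
      ((Finset.range n).filter fun x => E x ≠ 0).image lab' ∪
        ((Finset.range n).filter fun x => E x = 0).image lab' := by
    rw [← Finset.image_union]
    congr 1
    ext x
    simp only [Finset.mem_union, Finset.mem_filter]
    tauto
  rw [numClasses, hsplit]
  refine (Finset.card_union_le _ _).trans (add_le_add ?_ ?_)
  · rw [Nat.le_div_iff_mul_le hK]
    refine le_trans (Nat.mul_le_mul_right _ ?_) (card_mark_le (lab := lab) (p := p) (K := K) hN n)
    calc _ ≤ (((Finset.range n).image E \ {0}).image fun v =>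
          lab' (least (fun x => E x = v) n)).card := by
          refine Finset.card_le_card fun z hz => ?_
          simp only [Finset.mem_image, Finset.mem_filter, Finset.mem_range, Finset.mem_sdiff,
            Finset.mem_singleton] at hz ⊢
          obtain ⟨x, ⟨hx, hx0⟩, rfl⟩ := hz
          refine ⟨E x, ⟨⟨x, hx, rfl⟩, hx0⟩, ?_⟩
          have h1 : least (fun y => E y = E x) n < n := least_lt hx rfl
          have h2 := (least_spec (fun y => E y = E x) n).2.1 h1
          rw [hlab', refine_eq_iff h1 hx]
          refine ⟨(mark_lab hN hx0 h2.symm).symm, ?_⟩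
          unfold monoComp
          rw [← hE, h2]
          rw [if_neg hx0, if_neg hx0]
      _ ≤ _ := Finset.card_image_le
  · calc _ ≤ (((Finset.range n).image lab) ×ˢ (Finset.range (K - 1))).card := by
          refine le_trans (Finset.card_le_card (t := ((((Finset.range n).image lab) ×ˢ
            (Finset.range (K - 1))).image fun e => lab' (least (fun x => lab x = e.1 ∧
              monoComp n N K lab p q x = 2 * e.2) n))) fun z hz => ?_) Finset.card_image_le
          simp only [Finset.mem_image, Finset.mem_filter, Finset.mem_range, Finset.mem_product,
            Prod.exists] at hz ⊢
          obtain ⟨x, ⟨hx, hx0⟩, rfl⟩ := hz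
          have hr := monoRank_lt (lab := lab) (p := p) hN hK hx hx0
          rw [← hE] at hr
          have hc : monoComp n N K lab p q x = 2 * monoRank n N lab E p q x := by
            unfold monoComp
            rw [if_pos hx0]
          refine ⟨lab x, monoRank n N lab E p q x, ⟨⟨x, hx, rfl⟩, by omega⟩, ?_⟩
          have h1 : least (fun y => lab y = lab x ∧
              monoComp n N K lab p q y = 2 * monoRank n N lab E p q x) n < n :=
            least_lt hx ⟨rfl, hc⟩
          have h2 := (least_spec (fun y => lab y = lab x ∧
              monoComp n N K lab p q y = 2 * monoRank n N lab E p q x) n).2.1 h1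
          rw [hlab', refine_eq_iff h1 hx, hc]
          exact h2
      _ = _ := by simp [Finset.card_product, numClasses]

end Mono

end ReadK

namespace ReadK

/-! ### Splitting classes into regularly interleaving ones -/

/-- The second read of `y` precedes the first read of `x`. -/
def pairRel (lab a b : ℕ → ℕ) (y x : ℕ) : Prop := lab y = lab x ∧ b y < a x

instance (lab a b : ℕ → ℕ) : DecidableRel (pairRel lab a b) := fun y x => by
  unfold pairRel
  infer_instance

/-- The number of the block of an element. -/
def pairLevel (n N : ℕ) (lab a b : ℕ → ℕ) : ℕ → ℕ := rank n (pairRel lab a b) a N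

section Pair

variable {n N : ℕ} {lab a b : ℕ → ℕ}

theorem pairRel_key (hab : ∀ x < n, a x < b x) (y x : ℕ) (hy : y < n) (_ : x < n)
    (h : pairRel lab a b y x) : a y < a x := (hab y hy).trans h.2

theorem pairLevel_lt (hN : ∀ x < n, a x < N) (hab : ∀ x < n, a x < b x) {x y : ℕ} (hx : x < n)
    (hy : y < n) (hxy : lab x = lab y) (h : b x < a y) :
    pairLevel n N lab a b x < pairLevel n N lab a b y :=
  rank_lt (pairRel_key hab) hy hx (hN y hy) ⟨hxy, h⟩

theorem exists_pairLevel_pred (hN : ∀ x < n, a x < N) (hab : ∀ x < n, a x < b x) {x : ℕ}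
    (hx : x < n) (h0 : pairLevel n N lab a b x ≠ 0) :
    ∃ z < n, lab z = lab x ∧ b z < a x ∧
      pairLevel n N lab a b z + 1 = pairLevel n N lab a b x := by
  obtain ⟨z, hz, ⟨h1, h2⟩, h3⟩ := exists_rank_pred (R := pairRel lab a b) (pairRel_key hab) hx
    (hN x hx) h0
  exact ⟨z, hz, h1, h2, h3⟩

/-- Whatever ends before `x` starts also ends before `y` starts, so `y` inherits the predecessors of
`x`. -/
theorem pairLevel_mono (hN : ∀ x < n, a x < N) (hab : ∀ x < n, a x < b x) {x y : ℕ} (hx : x < n)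
    (hy : y < n) (hxy : lab x = lab y) (h : a x ≤ a y) :
    pairLevel n N lab a b x ≤ pairLevel n N lab a b y := by
  by_cases h0 : pairLevel n N lab a b x = 0
  · omega
  · obtain ⟨z, hz, h1, h2, h3⟩ := exists_pairLevel_pred hN hab hx h0
    have := pairLevel_lt hN hab hz hy (h1.trans hxy) (h2.trans_le h)
    omega

/-- Blocks of equal parity do not overlap. -/
theorem pairLevel_regular (hN : ∀ x < n, a x < N) (hab : ∀ x < n, a x < b x)
    (l : ℕ)
    (hdir : (∀ x y, x < n → y < n → lab x = l → lab y = l → a x < a y → b x < b y) ∨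
      (∀ x y, x < n → y < n → lab x = l → lab y = l → a x < a y → b y < b x))
    (x y : ℕ) (hx : x < n) (hy : y < n) (hlx : lab x = l) (hly : lab y = l)
    (hpar : pairLevel n N lab a b x % 2 = pairLevel n N lab a b y % 2) :
    (a x < b y → pairLevel n N lab a b x ≤ pairLevel n N lab a b y) ∧
    (b x < a y → pairLevel n N lab a b x < pairLevel n N lab a b y) ∧
    (a x < a y → pairLevel n N lab a b x ≤ pairLevel n N lab a b y) ∧
    (b x < b y → pairLevel n N lab a b x ≤ pairLevel n N lab a b y) := by
  have hxy : lab x = lab y := hlx.trans hly.symm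
  refine ⟨?_, pairLevel_lt hN hab hx hy hxy, fun h => pairLevel_mono hN hab hx hy hxy h.le, ?_⟩ <;>
    rcases hdir with hdir | hdir
  -- Second reads in the order of the first ones. By parity, a failure means that the level of `x`
  -- exceeds that of `y` by at least two. A predecessor `z` of `x` one level lower then starts after
  -- `y`, hence ends after it, and `b y < b z < a x`.
  · intro h
    by_contra hcon
    have h0 : pairLevel n N lab a b x ≠ 0 := by omega
    obtain ⟨z, hz, h1, h2, h3⟩ := exists_pairLevel_pred hN hab hx h0
    have h4 : a y < a z := by
      by_contra h5
      have := pairLevel_mono (N := N) hN hab hz hy (h1.trans hxy) (not_lt.mp h5)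
      omega
    have := hdir y z hy hz hly (h1.trans hlx) h4
    omega
  -- Second reads in the reverse order: the intervals are nested, so none precedes another and all
  -- levels are zero.
  · intro _
    by_contra hcon
    obtain ⟨z, hz, h1, h2, -⟩ := exists_pairLevel_pred (N := N) (lab := lab) hN hab hx
      (by omega)
    have h3 := hab z hz
    have h4 := hab x hx
    have := hdir z x hz hx (h1.trans hlx) hlx (by omega)
    omega
  · intro h
    refine pairLevel_mono hN hab hx hy hxy ?_
    by_contra hcon
    have := hdir y x hy hx hly hlx (not_le.mp hcon)
    omega
  · intro _
    by_contra hcon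
    obtain ⟨z, hz, h1, h2, -⟩ := exists_pairLevel_pred (N := N) (lab := lab) hN hab hx
      (by omega)
    have h3 := hab z hz
    have h4 := hab x hx
    have := hdir z x hz hx (h1.trans hlx) hlx (by omega)
    omega

end Pair

/-! ### The partition -/

/-- Iterated square roots of `n`, rounded up. -/
def rootCeil (n : ℕ) : ℕ → ℕ
  | 0 => n
  | r + 1 => least (fun s => rootCeil n r ≤ s * s) (rootCeil n r + 1)

/-- The classes after the reads `2, …, r + 1` have been made monotone. -/
def monoLab (n N : ℕ) (ρ : ℕ → ℕ → ℕ) : ℕ → ℕ → ℕ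
  | 0 => fun _ => 0
  | r + 1 => refine n (monoLab n N ρ r)
      (monoComp n N (rootCeil n (r + 1)) (monoLab n N ρ r) (ρ 1) (ρ (r + 2)))

/-- The classes after a number of pairs of reads have been made to interleave regularly. -/
def pairLab (n k N : ℕ) (ρ : ℕ → ℕ → ℕ) : ℕ → ℕ → ℕ
  | 0 => monoLab n N ρ (k - 1)
  -- The number `p` encodes the reads `p / k + 1` and `p % k + 1`; the classes are split only when
  -- the former is smaller.
  | p + 1 => refine n (pairLab n k N ρ p) fun x => if p / k < p % k then
      pairLevel n N (pairLab n k N ρ p) (ρ (p / k + 1)) (ρ (p % k + 1)) x % 2 else 0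

/-- The final classes. -/
def finalLab (n k N : ℕ) (ρ : ℕ → ℕ → ℕ) : ℕ → ℕ := pairLab n k N ρ (k * k)

theorem monoLab_eq_of_le {n N : ℕ} {ρ : ℕ → ℕ → ℕ} {r r' : ℕ} (hr : r ≤ r') {x y : ℕ} (hx : x < n)
    (hy : y < n) (h : monoLab n N ρ r' x = monoLab n N ρ r' y) :
    monoLab n N ρ r x = monoLab n N ρ r y := by
  induction r', hr using Nat.le_induction with
  | base => exact h
  | succ r' _ ih => exact ih ((refine_eq_iff hx hy).mp h).1

theorem pairLab_eq_of_le {n k N : ℕ} {ρ : ℕ → ℕ → ℕ} {r r' : ℕ} (hr : r ≤ r') {x y : ℕ}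
    (hx : x < n) (hy : y < n) (h : pairLab n k N ρ r' x = pairLab n k N ρ r' y) :
    pairLab n k N ρ r x = pairLab n k N ρ r y := by
  induction r', hr using Nat.le_induction with
  | base => exact h
  | succ r' _ ih => exact ih ((refine_eq_iff hx hy).mp h).1

theorem finalLab_isLabelling {n k N : ℕ} {ρ : ℕ → ℕ → ℕ} (hk : 1 ≤ k) :
    IsLabelling n (finalLab n k N ρ) := by
  obtain ⟨p, hp⟩ : ∃ p, k * k = p + 1 := ⟨k * k - 1, by
    have : 1 ≤ k * k := Nat.mul_pos hk hk
    omega⟩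
  rw [finalLab, hp]
  exact refine_isLabelling _ _ _

section Times

/-- The properties of the reading times of a sequence that reads each of `n` variables `k` times. -/
structure IsTimes (n k N : ℕ) (ρ : ℕ → ℕ → ℕ) : Prop where
  lt_bound : ∀ c x, 1 ≤ c → c ≤ k → x < n → ρ c x < N
  lt_of_lt : ∀ c d x, 1 ≤ c → c < d → d ≤ k → x < n → ρ c x < ρ d x
  inj : ∀ c x y, 1 ≤ c → c ≤ k → x < n → y < n → ρ c x = ρ c y → x = y

variable {n k N : ℕ} {ρ : ℕ → ℕ → ℕ}

theorem pairLab_mono (h : IsTimes n k N ρ) (r x₀ : ℕ) (hx₀ : x₀ < n) (c : ℕ) (hc : 1 ≤ c)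
    (hck : c ≤ k) :
    (∀ x y, x < n → y < n → pairLab n k N ρ r x = pairLab n k N ρ r x₀ →
      pairLab n k N ρ r y = pairLab n k N ρ r x₀ → ρ 1 x < ρ 1 y → ρ c x < ρ c y) ∨
    (∀ x y, x < n → y < n → pairLab n k N ρ r x = pairLab n k N ρ r x₀ →
      pairLab n k N ρ r y = pairLab n k N ρ r x₀ → ρ 1 x < ρ 1 y → ρ c y < ρ c x) := by
  obtain rfl | hc1 := Nat.eq_or_lt_of_le hc
  · exact Or.inl fun x y _ _ _ _ h => h
  obtain ⟨s, rfl⟩ := Nat.exists_eq_add_of_le' (Nat.succ_le_of_lt hc1)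
  have hstep : ∀ x < n, pairLab n k N ρ r x = pairLab n k N ρ r x₀ →
      monoLab n N ρ (s + 1) x = monoLab n N ρ (s + 1) x₀ := fun x hx hxx =>
    monoLab_eq_of_le (by omega) hx hx₀ (pairLab_eq_of_le (Nat.zero_le r) hx hx₀ hxx)
  have key := monoComp_mono (n := n) (N := N) (K := rootCeil n (s + 1)) (lab := monoLab n N ρ s)
    (p := ρ 1) (q := ρ (s + 2)) (fun x hx => h.lt_bound _ x (by omega) hck hx)
    (fun x y hx hy hxy => h.inj _ x y (by omega) hck hx hy hxy)
    (monoComp n N (rootCeil n (s + 1)) (monoLab n N ρ s) (ρ 1) (ρ (s + 2)) x₀) (monoLab n N ρ s x₀)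
  refine key.imp (fun hm x y hx hy hxx hyx => ?_) (fun hm x y hx hy hxx hyx => ?_)
  · have h1 := (refine_eq_iff hx hx₀).mp (hstep x hx hxx)
    have h2 := (refine_eq_iff hy hx₀).mp (hstep y hy hyx)
    exact hm x y hx hy h1.1 h2.1 h1.2 h2.2
  · have h1 := (refine_eq_iff hx hx₀).mp (hstep x hx hxx)
    have h2 := (refine_eq_iff hy hx₀).mp (hstep y hy hyx)
    exact hm x y hx hy h1.1 h2.1 h1.2 h2.2

/-- Both reads are compared with the first one: equal directions compose to an increasing relation,
opposite ones to a decreasing one. -/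
theorem pairLab_directions (h : IsTimes n k N ρ) (r x₀ : ℕ) (hx₀ : x₀ < n) (i j : ℕ) (hi : 1 ≤ i)
    (hij : i < j) (hj : j ≤ k) :
    (∀ x y, x < n → y < n → pairLab n k N ρ r x = pairLab n k N ρ r x₀ →
      pairLab n k N ρ r y = pairLab n k N ρ r x₀ → ρ i x < ρ i y → ρ j x < ρ j y) ∨
    (∀ x y, x < n → y < n → pairLab n k N ρ r x = pairLab n k N ρ r x₀ →
      pairLab n k N ρ r y = pairLab n k N ρ r x₀ → ρ i x < ρ i y → ρ j y < ρ j x) := by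
  have hne : ∀ x y, x < n → y < n → ρ i x < ρ i y → ρ 1 x < ρ 1 y ∨ ρ 1 y < ρ 1 x := by
    intro x y hx hy hxy
    rcases lt_trichotomy (ρ 1 x) (ρ 1 y) with h1 | h1 | h1
    · exact Or.inl h1
    · rw [h.inj 1 x y le_rfl (by omega) hx hy h1] at hxy
      exact absurd hxy (lt_irrefl _)
    · exact Or.inr h1
  rcases pairLab_mono h r x₀ hx₀ i hi (by omega) with h1 | h1 <;>
    rcases pairLab_mono h r x₀ hx₀ j (by omega) hj with h2 | h2
  · left
    intro x y hx hy hxx hyx hxy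
    rcases hne x y hx hy hxy with h3 | h3
    · exact h2 x y hx hy hxx hyx h3
    · exact absurd hxy (not_lt.mpr (h1 y x hy hx hyx hxx h3).le)
  · right
    intro x y hx hy hxx hyx hxy
    rcases hne x y hx hy hxy with h3 | h3
    · exact h2 x y hx hy hxx hyx h3
    · exact absurd hxy (not_lt.mpr (h1 y x hy hx hyx hxx h3).le)
  · right
    intro x y hx hy hxx hyx hxy
    rcases hne x y hx hy hxy with h3 | h3
    · exact absurd hxy (not_lt.mpr (h1 x y hx hy hxx hyx h3).le)
    · exact h2 y x hy hx hyx hxx h3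
  · left
    intro x y hx hy hxx hyx hxy
    rcases hne x y hx hy hxy with h3 | h3
    · exact absurd hxy (not_lt.mpr (h1 x y hx hy hxx hyx h3).le)
    · exact h2 y x hy hx hyx hxx h3

theorem finalLab_level (h : IsTimes n k N ρ) (x₀ : ℕ) (hx₀ : x₀ < n) (i j : ℕ)
    (hi : 1 ≤ i) (hij : i < j) (hj : j ≤ k) :
    ∃ lev : ℕ → ℕ, ∀ x y, x < n → y < n → finalLab n k N ρ x = finalLab n k N ρ x₀ →
      finalLab n k N ρ y = finalLab n k N ρ x₀ →
      (ρ i x < ρ j y → lev x ≤ lev y) ∧ (ρ j x < ρ i y → lev x < lev y) ∧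
      (ρ i x < ρ i y → lev x ≤ lev y) ∧ (ρ j x < ρ j y → lev x ≤ lev y) := by
  set p := (i - 1) * k + (j - 1) with hp
  have hk : 0 < k := by omega
  have hdiv : p / k = i - 1 := by
    rw [hp, mul_comm, Nat.mul_add_div hk, Nat.div_eq_of_lt (by omega), add_zero]
  have hmod : p % k = j - 1 := by
    rw [hp, mul_comm, Nat.mul_add_mod, Nat.mod_eq_of_lt (by omega)]
  have hpk : p + 1 ≤ k * k := by
    have : (i - 1 + 1) * k ≤ k * k := Nat.mul_le_mul_right _ (by omega)
    rw [add_mul, one_mul] at this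
    omega
  refine ⟨pairLevel n N (pairLab n k N ρ p) (ρ i) (ρ j), fun x y hx hy hxx hyx => ?_⟩
  have h1 := (refine_eq_iff hx hx₀).mp (pairLab_eq_of_le hpk hx hx₀ hxx)
  have h2 := (refine_eq_iff hy hx₀).mp (pairLab_eq_of_le hpk hy hx₀ hyx)
  simp only [hdiv, hmod] at h1 h2
  rw [if_pos (by omega), if_pos (by omega), Nat.sub_add_cancel hi,
    Nat.sub_add_cancel (by omega : 1 ≤ j)] at h1 h2
  exact pairLevel_regular (fun x hx => h.lt_bound i x hi (by omega) hx)
    (fun x hx => h.lt_of_lt i j x hi hij hj hx)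
    (pairLab n k N ρ p x₀) (pairLab_directions h p x₀ hx₀ i j hi hij hj) x y hx hy h1.1 h2.1
    (h1.2.trans h2.2.symm)

/-! ### The number of classes -/

/-- Rounding up after every square root still gives the least integer whose `2 ^ r`-th power is at
least `n`: if `u` is the next value after `v`, then `(u - 1) * (u - 1) ≤ v - 1` by integrality, and
the strict bound for `v - 1` carries over. -/
theorem rootCeil_spec (hn : 1 ≤ n) (r : ℕ) :
    1 ≤ rootCeil n r ∧ n ≤ rootCeil n r ^ 2 ^ r ∧ (rootCeil n r - 1) ^ 2 ^ r < n := by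
  induction r with
  | zero =>
    simp [rootCeil]
    omega
  | succ r ih =>
    obtain ⟨h1, h2, h3⟩ := ih
    set v := rootCeil n r with hv
    have hlt : rootCeil n (r + 1) < v + 1 := least_lt (Nat.lt_succ_self v) (Nat.le_mul_self v)
    have hspec : v ≤ rootCeil n (r + 1) * rootCeil n (r + 1) :=
      (least_spec (fun s => v ≤ s * s) (v + 1)).2.1 hlt
    have hmin : ∀ s, s < v + 1 → v ≤ s * s → rootCeil n (r + 1) ≤ s :=
      (least_spec (fun s => v ≤ s * s) (v + 1)).2.2
    generalize rootCeil n (r + 1) = u at hlt hspec hmin ⊢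
    have hu : 1 ≤ u := by
      by_contra hcon
      have : u = 0 := by omega
      subst this
      omega
    refine ⟨hu, ?_, ?_⟩
    · calc n ≤ v ^ 2 ^ r := h2
        _ ≤ (u * u) ^ 2 ^ r := Nat.pow_le_pow_left hspec _
        _ = u ^ 2 ^ (r + 1) := by rw [← sq, ← pow_mul, pow_succ 2 r, mul_comm]
    · have h4 : (u - 1) * (u - 1) ≤ v - 1 := by
        by_contra hcon
        have := hmin (u - 1) (by omega) (by omega)
        omega
      calc (u - 1) ^ 2 ^ (r + 1) = ((u - 1) * (u - 1)) ^ 2 ^ r := by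
            rw [← sq, ← pow_mul, pow_succ 2 r, mul_comm]
        _ ≤ (v - 1) ^ 2 ^ r := Nat.pow_le_pow_left h4 _
        _ < n := h3

/-- Let `s = 1 / 2 ^ (r + 1)` and let `K` be `n ^ s` rounded up. The step creates at most `n / K ≤ n
^ (1 - s)` chains and multiplies the previous `(r + 1) * n ^ (1 - 2 * s)` classes by `K - 1 ≤ n ^
s`; this choice of `K` balances the exponents of the two terms. -/
theorem numClasses_monoLab_le (h : IsTimes n k N ρ) (hn : 1 ≤ n) (r : ℕ) (hr : r + 1 ≤ k) :
    (numClasses n (monoLab n N ρ r) : ℝ) ≤ (r + 1) * (n : ℝ) ^ (1 - 1 / (2 : ℝ) ^ r) := by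
  have hn0 : (0 : ℝ) < n := by exact_mod_cast hn
  induction r with
  | zero =>
    have : numClasses n (monoLab n N ρ 0) ≤ 1 := by
      rw [numClasses, Finset.card_le_one]
      intro a ha b hb
      simp only [monoLab, Finset.mem_image] at ha hb
      obtain ⟨_, _, rfl⟩ := ha
      obtain ⟨_, _, rfl⟩ := hb
      rfl
    simpa using this
  | succ r ih =>
    have ih := ih (by omega)
    obtain ⟨hK1, hK2, hK3⟩ := rootCeil_spec hn (r + 1)
    have hcount := numClasses_mono_le (n := n) (N := N) (K := rootCeil n (r + 1))
      (lab := monoLab n N ρ r) (p := ρ 1) (q := ρ (r + 2))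
      (fun x hx => h.lt_bound _ x (by omega) (by omega) hx) hK1
    change numClasses n (monoLab n N ρ (r + 1)) ≤ _ at hcount
    generalize rootCeil n (r + 1) = K at hK1 hK2 hK3 hcount
    set s : ℝ := 1 / (2 : ℝ) ^ (r + 1) with hs
    have hs2 : 1 / (2 : ℝ) ^ r = 2 * s := by
      rw [hs, pow_succ]
      field_simp
    have hroot : ∀ u : ℝ, 0 ≤ u → (u ^ 2 ^ (r + 1)) ^ s = u := by
      intro u hu
      rw [hs, one_div, show ((2 : ℝ) ^ (r + 1)) = ((2 ^ (r + 1) : ℕ) : ℝ) by push_cast; ring]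
      exact Real.pow_rpow_inv_natCast hu (by positivity)
    have hspos : 0 ≤ s := by positivity
    have hKlow : (n : ℝ) ^ s ≤ K := by
      rw [← hroot K (Nat.cast_nonneg K)]
      exact Real.rpow_le_rpow hn0.le (by exact_mod_cast hK2) hspos
    have hKup : ((K - 1 : ℕ) : ℝ) ≤ (n : ℝ) ^ s := by
      rw [← hroot ((K - 1 : ℕ) : ℝ) (Nat.cast_nonneg _)]
      exact Real.rpow_le_rpow (by positivity) (by exact_mod_cast hK3.le) hspos
    have hns : 0 < (n : ℝ) ^ s := Real.rpow_pos_of_pos hn0 s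
    calc (numClasses n (monoLab n N ρ (r + 1)) : ℝ)
        ≤ ((n / K + numClasses n (monoLab n N ρ r) * (K - 1) : ℕ) : ℝ) := by exact_mod_cast hcount
      _ = ((n / K : ℕ) : ℝ) + numClasses n (monoLab n N ρ r) * ((K - 1 : ℕ) : ℝ) := by push_cast; ring
      _ ≤ (n : ℝ) / K + ((r + 1) * (n : ℝ) ^ (1 - 2 * s)) * (n : ℝ) ^ s := by
          rw [hs2] at ih
          exact add_le_add Nat.cast_div_le (mul_le_mul ih hKup (Nat.cast_nonneg _) (by positivity))
      _ ≤ (n : ℝ) / (n : ℝ) ^ s + ((r + 1) * (n : ℝ) ^ (1 - 2 * s)) * (n : ℝ) ^ s := by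
          gcongr
      _ = (n : ℝ) ^ (1 - s) + (r + 1) * (n : ℝ) ^ (1 - s) := by
          rw [mul_assoc, ← Real.rpow_add hn0, Real.rpow_sub hn0, Real.rpow_one]
          congr 2
          rw [show 1 - 2 * s + s = 1 - s by ring, Real.rpow_sub hn0, Real.rpow_one]
      _ = _ := by push_cast; ring

theorem numClasses_pairLab_le (r : ℕ) :
    numClasses n (pairLab n k N ρ r) ≤ numClasses n (monoLab n N ρ (k - 1)) * 2 ^ r := by
  induction r with
  | zero => simp [pairLab]
  | succ r ih =>
    calc _ ≤ numClasses n (pairLab n k N ρ r) * 2 := by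
          refine numClasses_refine_le n 2 _ _ fun x _ => ?_
          split_ifs <;> omega
      _ ≤ _ := by
          rw [pow_succ, ← mul_assoc]
          exact Nat.mul_le_mul_right _ ih

/-- Each of the `k * k` parity steps at most doubles the number of classes. The factor `k` from the
monotone steps is absorbed into `exp (k ^ 2)` because `k ≤ 1 + (1 - log 2) * k ^ 2`. -/
theorem numClasses_finalLab_le (h : IsTimes n k N ρ) (hn : 1 ≤ n) (hk : 2 ≤ k) :
    (numClasses n (finalLab n k N ρ) : ℝ) ≤
      Real.exp ((k : ℝ) ^ 2) * (n : ℝ) ^ (1 - 1 / (2 : ℝ) ^ (k - 1)) := by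
  have hn0 : (0 : ℝ) < n := by exact_mod_cast hn
  have h1 : (numClasses n (finalLab n k N ρ) : ℝ) ≤
      numClasses n (monoLab n N ρ (k - 1)) * 2 ^ (k * k) := by
    exact_mod_cast numClasses_pairLab_le (n := n) (k := k) (N := N) (ρ := ρ) (k * k)
  have h2 := numClasses_monoLab_le h hn (k - 1) (by omega)
  rw [show ((k - 1 : ℕ) : ℝ) + 1 = k by rw [Nat.cast_sub (by omega)]; simp] at h2
  have h3 : (k : ℝ) * 2 ^ (k * k) ≤ Real.exp ((k : ℝ) ^ 2) := by
    have h4 : (2 : ℝ) ^ (k * k) = Real.exp (Real.log 2 * (k : ℝ) ^ 2) := by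
      rw [Real.exp_mul, Real.exp_log (by norm_num), ← Real.rpow_natCast]
      congr 1
      push_cast
      ring
    have h5 : (k : ℝ) ≤ Real.exp ((1 - Real.log 2) * (k : ℝ) ^ 2) := by
      have h6 := Real.add_one_le_exp ((1 - Real.log 2) * (k : ℝ) ^ 2)
      have h7 := Real.log_two_lt_d9
      nlinarith [sq_nonneg ((k : ℝ) - 2), sq_nonneg (k : ℝ)]
    calc (k : ℝ) * 2 ^ (k * k) ≤ Real.exp ((1 - Real.log 2) * (k : ℝ) ^ 2) *
          Real.exp (Real.log 2 * (k : ℝ) ^ 2) := by rw [h4]; gcongr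
      _ = _ := by rw [← Real.exp_add]; congr 1; ring
  calc _ ≤ _ := h1
    _ ≤ (k * (n : ℝ) ^ (1 - 1 / (2 : ℝ) ^ (k - 1))) * 2 ^ (k * k) := by gcongr
    _ = (k * 2 ^ (k * k)) * (n : ℝ) ^ (1 - 1 / (2 : ℝ) ^ (k - 1)) := by ring
    _ ≤ _ := by gcongr

end Times

end ReadK

namespace Ram

/-! ### Functions computed by programs in polynomial time -/

/-- The data that a program is started on. -/
structure Inst where
  n : ℕ
  k : ℕ
  w : ℕ
  e : ℕ
  S : List (Fin n)
  count_le : ∀ x, S.count x ≤ k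
  s : ℕ
  y : Fin s → Bool

def Inst.state (I : Inst) : State := input I.n I.k I.w I.e I.S I.y

/-- Running times are measured in this quantity. -/
def Inst.size (I : Inst) : ℕ := I.n + I.k + Nat.size I.w + I.e

/-- A context provides an instance and the values of finitely many local variables. -/
class Ctx (Γ : Type) where
  base : Γ → Inst
  vals : Γ → List ℕ

instance : Ctx Inst := ⟨fun I => I, fun _ => []⟩

instance {Γ : Type} [Ctx Γ] : Ctx (Γ × ℕ) := ⟨fun p => Ctx.base p.1, fun p => p.2 :: Ctx.vals p.1⟩

section Bounds

variable {Γ Δ : Type} [Ctx Γ] [Ctx Δ]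

/-- The size of an instance together with the bit lengths of the local variables. -/
def sz (γ : Γ) : ℕ := (Ctx.base γ).size + ((Ctx.vals γ).map Nat.size).sum

theorem sz_pair (p : Γ × ℕ) : sz p = sz p.1 + Nat.size p.2 := by
  simp only [sz, Ctx.base, Ctx.vals, List.map_cons, List.sum_cons]
  omega

/-- Polynomially bounded functions. -/
def PB (g : Γ → ℕ) : Prop := ∃ e, ∀ γ, g γ ≤ (sz γ + 2) ^ e

theorem PB.mono {g h : Γ → ℕ} (hh : PB h) (hgh : ∀ γ, g γ ≤ h γ) : PB g := by
  obtain ⟨e, he⟩ := hh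
  exact ⟨e, fun γ => (hgh γ).trans (he γ)⟩

theorem PB.sz : PB (fun γ : Γ => sz γ) := ⟨1, fun γ => by rw [pow_one]; exact Nat.le_add_right _ _⟩

theorem PB.const (c : ℕ) : PB (fun _ : Γ => c) := by
  refine ⟨c, fun γ => Nat.lt_two_pow_self.le.trans ?_⟩
  exact Nat.pow_le_pow_left (by omega) c

theorem PB.mul {g h : Γ → ℕ} (hg : PB g) (hh : PB h) : PB (fun γ => g γ * h γ) := by
  obtain ⟨a, ha⟩ := hg
  obtain ⟨b, hb⟩ := hh
  exact ⟨a + b, fun γ => by rw [pow_add]; exact Nat.mul_le_mul (ha γ) (hb γ)⟩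

theorem PB.add {g h : Γ → ℕ} (hg : PB g) (hh : PB h) : PB (fun γ => g γ + h γ) := by
  obtain ⟨a, ha⟩ := hg
  obtain ⟨b, hb⟩ := hh
  refine ⟨a + b + 1, fun γ => ?_⟩
  have h1 : (Ram.sz γ + 2) ^ a ≤ (Ram.sz γ + 2) ^ (a + b) := Nat.pow_le_pow_right (by omega) (by omega)
  have h2 : (Ram.sz γ + 2) ^ b ≤ (Ram.sz γ + 2) ^ (a + b) := Nat.pow_le_pow_right (by omega) (by omega)
  have h3 : 2 * (Ram.sz γ + 2) ^ (a + b) ≤ (Ram.sz γ + 2) ^ (a + b + 1) := by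
    rw [pow_succ, mul_comm]
    exact Nat.mul_le_mul_left _ (by omega)
  have := ha γ
  have := hb γ
  dsimp only
  omega

theorem PB.pow {g : Γ → ℕ} (hg : PB g) (e : ℕ) : PB (fun γ => g γ ^ e) := by
  obtain ⟨a, ha⟩ := hg
  exact ⟨a * e, fun γ => by rw [pow_mul]; exact Nat.pow_le_pow_left (ha γ) e⟩

theorem PB.comp {g : Γ → ℕ} (hg : PB g) {φ : Δ → Γ} (hφ : PB fun δ => Ram.sz (φ δ)) :
    PB (fun δ => g (φ δ)) := by
  obtain ⟨e, he⟩ := hg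
  exact ((hφ.add (PB.const 2)).pow e).mono fun δ => he (φ δ)

/-- A bound in an extended context gives one for all short values of the new variable. -/
theorem PB.extend {g : Γ × ℕ → ℕ} (hg : PB g) {h : Γ → ℕ} (hh : PB h) :
    ∃ g' : Γ → ℕ, PB g' ∧ ∀ γ x, Nat.size x ≤ h γ → g (γ, x) ≤ g' γ := by
  obtain ⟨e, he⟩ := hg
  refine ⟨fun γ => (Ram.sz γ + h γ + 2) ^ e, ((PB.sz.add hh).add (PB.const 2)).pow e,
    fun γ x hx => (he (γ, x)).trans (Nat.pow_le_pow_left ?_ e)⟩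
  rw [sz_pair]
  dsimp only
  omega

theorem PB.size {g : Γ → ℕ} (hg : PB g) : PB (fun γ => Nat.size (g γ)) :=
  hg.mono fun _ => Nat.size_le.mpr Nat.lt_two_pow_self

end Bounds

/-! ### Runs that keep the arrays and the lower variables -/

/-- The program takes `σ` to `σ'` at cost at most `T`, keeping the arrays and the variables
below `b`. -/
def Runs (b : ℕ) (c : Cmd) (σ σ' : State) (T : ℕ) : Prop :=
  (∃ T', Exec c σ σ' T' ∧ T' ≤ T) ∧ σ'.arr = σ.arr ∧ ∀ x < b, σ'.var x = σ.var x

theorem Runs.seq {b : ℕ} {c₁ c₂ : Cmd} {σ σ₁ σ₂ : State} {T₁ T₂ : ℕ} (h₁ : Runs b c₁ σ σ₁ T₁)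
    (h₂ : Runs b c₂ σ₁ σ₂ T₂) : Runs b (.seq c₁ c₂) σ σ₂ (T₁ + T₂) := by
  obtain ⟨⟨t₁, e₁, l₁⟩, a₁, v₁⟩ := h₁
  obtain ⟨⟨t₂, e₂, l₂⟩, a₂, v₂⟩ := h₂
  exact ⟨⟨_, e₁.seq e₂, by omega⟩, a₂.trans a₁, fun x hx => (v₂ x hx).trans (v₁ x hx)⟩

theorem Runs.weaken {b b' : ℕ} {c : Cmd} {σ σ' : State} {T T' : ℕ} (h : Runs b c σ σ' T)
    (hb : b' ≤ b) (hT : T ≤ T') : Runs b' c σ σ' T' := by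
  obtain ⟨⟨t, e, l⟩, a, v⟩ := h
  exact ⟨⟨t, e, l.trans hT⟩, a, fun x hx => v x (hx.trans_le hb)⟩

theorem Runs.skip (b : ℕ) (σ : State) : Runs b .skip σ σ 1 :=
  ⟨⟨1, .skip σ, le_rfl⟩, rfl, fun _ _ => rfl⟩

/-- The state after an assignment. -/
def State.set (σ : State) (x v : ℕ) : State := ⟨Function.update σ.var x v, σ.arr⟩

@[simp] theorem State.set_same (σ : State) (x v : ℕ) : (σ.set x v).var x = v := by simp [State.set]

theorem State.set_ne (σ : State) {x y : ℕ} (v : ℕ) (h : y ≠ x) : (σ.set x v).var y = σ.var y := by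
  simp [State.set, h]

@[simp] theorem State.set_arr (σ : State) (x v : ℕ) : (σ.set x v).arr = σ.arr := rfl

theorem Runs.assign {b x : ℕ} (hx : b ≤ x) (e : Expr) (σ : State) :
    Runs b (.assign x e) σ (σ.set x (e.eval σ)) (e.cost σ + 1) :=
  ⟨⟨_, .assign x e σ, le_rfl⟩, rfl, fun y hy => State.set_ne _ _ (by omega)⟩

theorem Runs.ite {b : ℕ} {e : Expr} {c₁ c₂ : Cmd} {σ σ' : State} {T : ℕ}
    (h₁ : e.eval σ ≠ 0 → Runs b c₁ σ σ' T) (h₂ : e.eval σ = 0 → Runs b c₂ σ σ' T) :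
    Runs b (.ite e c₁ c₂) σ σ' (e.cost σ + 1 + T) := by
  by_cases h : e.eval σ = 0
  · obtain ⟨⟨t, ht, l⟩, a, v⟩ := h₂ h
    exact ⟨⟨_, .iteFalse h ht, by omega⟩, a, v⟩
  · obtain ⟨⟨t, ht, l⟩, a, v⟩ := h₁ h
    exact ⟨⟨_, .iteTrue h ht, by omega⟩, a, v⟩

/-- A loop that is executed `m` times, with an invariant. -/
theorem Exec.loop {e : Expr} {c : Cmd} {T E m : ℕ} {Inv : ℕ → State → Prop}
    (hE : ∀ i ≤ m, ∀ σ, Inv i σ → (e.eval σ ≠ 0 ↔ i < m) ∧ e.cost σ ≤ E)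
    (hrun : ∀ i < m, ∀ σ, Inv i σ → ∃ σ', (∃ t ≤ T, Exec c σ σ' t) ∧ Inv (i + 1) σ')
    {σ : State} (h0 : Inv 0 σ) :
    ∃ σ', (∃ t ≤ (m + 1) * (E + 1 + T), Exec (.loop e c) σ σ' t) ∧ Inv m σ' := by
  suffices H : ∀ j ≤ m, ∀ σ, Inv (m - j) σ →
      ∃ σ', (∃ t ≤ (j + 1) * (E + 1 + T), Exec (.loop e c) σ σ' t) ∧ Inv m σ' from
    H m le_rfl σ (by rwa [Nat.sub_self])
  intro j
  induction j with
  | zero =>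
    intro _ σ hσ
    have h := hE m le_rfl σ hσ
    simp only [lt_irrefl, iff_false, not_not] at h
    exact ⟨σ, ⟨_, by omega, .loopFalse h.1⟩, hσ⟩
  | succ j ih =>
    intro hj σ hσ
    have h := hE _ (by omega) σ hσ
    obtain ⟨σ₁, ⟨t₁, l₁, e₁⟩, h₁⟩ := hrun _ (by omega) σ hσ
    rw [show m - (j + 1) + 1 = m - j by omega] at h₁
    obtain ⟨σ₂, ⟨t₂, l₂, e₂⟩, h₂⟩ := ih (by omega) σ₁ h₁
    refine ⟨σ₂, ⟨_, ?_, .loopTrue (h.1.mpr (by omega)) e₁ e₂⟩, h₂⟩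
    have : (j + 1 + 1) * (E + 1 + T) = (j + 1) * (E + 1 + T) + (E + 1 + T) := by ring
    omega

/-! ### Computable functions on contexts -/

section PT

variable {Γ Δ Θ : Type} [Ctx Γ] [Ctx Δ] [Ctx Θ]

/-- The state holds the instance, and the local variables in the given places. -/
def Valid (γ : Γ) (locs : List ℕ) (σ : State) : Prop :=
  (∀ x < 6, σ.var x = (Ctx.base γ).state.var x) ∧ σ.arr 0 = (Ctx.base γ).state.arr 0 ∧
    σ.arr 1 = (Ctx.base γ).state.arr 1 ∧ locs.map σ.var = Ctx.vals γ

theorem Valid.frame {γ : Γ} {locs : List ℕ} {σ σ' : State} {b : ℕ} (h : Valid γ locs σ)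
    (hl : ∀ l ∈ locs, l < b) (hb : 6 ≤ b) (ha : σ'.arr = σ.arr)
    (hv : ∀ x < b, σ'.var x = σ.var x) : Valid γ locs σ' := by
  obtain ⟨h1, h2, h3, h4⟩ := h
  refine ⟨fun x hx => (hv x (by omega)).trans (h1 x hx), ha ▸ h2, ha ▸ h3, ?_⟩
  rw [← h4]
  exact List.map_congr_left fun l hl' => hv l (hl l hl')

theorem Valid.runs {γ : Γ} {locs : List ℕ} {σ σ' : State} {b T : ℕ} {c : Cmd} (h : Valid γ locs σ)
    (hl : ∀ l ∈ locs, l < b) (hb : 6 ≤ b) (hr : Runs b c σ σ' T) : Valid γ locs σ' :=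
  h.frame hl hb hr.2.1 hr.2.2

theorem Valid.cons {γ : Γ} {l : ℕ} {locs : List ℕ} {σ : State} (h : Valid γ locs σ) {x : ℕ}
    (hx : σ.var l = x) : Valid (γ, x) (l :: locs) σ := by
  obtain ⟨h1, h2, h3, h4⟩ := h
  exact ⟨h1, h2, h3, by simp [Ctx.vals, h4, hx]⟩

/-- Functions computed in polynomial time, by programs that use only variables from a given
number on, where they leave the result. -/
def PT (f : Γ → ℕ) : Prop :=
  ∃ g : Γ → ℕ, PB g ∧ (∀ γ, Nat.size (f γ) ≤ g γ) ∧
    ∀ (locs : List ℕ) (b : ℕ), (∀ l ∈ locs, l < b) → 6 ≤ b → ∃ c : Cmd,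
      ∀ γ σ, Valid γ locs σ → ∃ σ', Runs b c σ σ' (g γ) ∧ σ'.var b = f γ

/-- Maps between contexts with the same instance, whose values are computed in polynomial time. -/
class Sub (φ : Δ → Γ) : Prop where
  base_eq : ∀ δ, Ctx.base (φ δ) = Ctx.base δ
  pb : PB fun δ => sz (φ δ)
  run : ∃ g : Δ → ℕ, PB g ∧ ∀ (locs : List ℕ) (b : ℕ), (∀ l ∈ locs, l < b) → 6 ≤ b →
    ∃ (c : Cmd) (locs' : List ℕ) (b' : ℕ), b ≤ b' ∧ (∀ l ∈ locs', l < b') ∧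
      ∀ δ σ, Valid δ locs σ → ∃ σ', Runs b c σ σ' (g δ) ∧ Valid (φ δ) locs' σ'

instance Sub.id : Sub (fun γ : Γ => γ) :=
  ⟨fun _ => rfl, PB.sz, fun _ => 1, PB.const 1, fun locs b hl _ =>
    ⟨.skip, locs, b, le_rfl, hl, fun _ σ h => ⟨σ, Runs.skip b σ, h⟩⟩⟩

instance Sub.fst (φ : Δ → Γ × ℕ) [h : Sub φ] : Sub (fun δ => (φ δ).1) := by
  obtain ⟨h1, h2, g, hg, h3⟩ := h
  refine ⟨h1, h2.mono fun δ => ?_, g, hg, fun locs b hl hb => ?_⟩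
  · have := sz_pair (φ δ)
    omega
  · obtain ⟨c, locs', b', hb', hl', h⟩ := h3 locs b hl hb
    refine ⟨c, locs'.tail, b', hb', fun l hl => hl' l (List.mem_of_mem_tail hl), fun δ σ hσ => ?_⟩
    obtain ⟨σ', hr, v1, v2, v3, v4⟩ := h δ σ hσ
    refine ⟨σ', hr, v1, v2, v3, ?_⟩
    rw [List.map_tail, v4]
    rfl

/-- The new value is computed first and kept in variable `b`; the program for `φ` works above it. -/
theorem Sub.pair (φ : Δ → Γ) [h : Sub φ] {f : Δ → ℕ} (hf : PT f) : Sub (fun δ => (φ δ, f δ)) := by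
  obtain ⟨h1, h2, g, hg, h3⟩ := h
  obtain ⟨g', hg', hs, hf⟩ := hf
  refine ⟨h1, ?_, fun δ => g' δ + g δ, hg'.add hg, fun locs b hl hb => ?_⟩
  · refine (h2.add hg').mono fun δ => ?_
    rw [sz_pair]
    exact Nat.add_le_add_left (hs δ) _
  · obtain ⟨c₁, hc₁⟩ := hf locs b hl hb
    obtain ⟨c, locs', b', hb', hl', h⟩ := h3 locs (b + 1) (fun l hl' => (hl l hl').trans (by omega))
      (by omega)
    refine ⟨.seq c₁ c, b :: locs', b', by omega, ?_, fun δ σ hσ => ?_⟩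
    · intro l hl
      rcases List.mem_cons.mp hl with rfl | hl
      · omega
      · exact hl' l hl
    · obtain ⟨σ₁, r₁, e₁⟩ := hc₁ δ σ hσ
      obtain ⟨σ₂, r₂, v⟩ := h δ σ₁ (hσ.runs hl hb r₁)
      exact ⟨σ₂, r₁.seq (r₂.weaken (by omega) le_rfl),
        v.cons ((r₂.2.2 b (by omega)).trans e₁)⟩

theorem PT.of_eq {f f' : Γ → ℕ} (hf : PT f) (h : ∀ γ, f γ = f' γ) : PT f' := by
  rwa [← funext h]

/-- The values of `φ` may occupy variables up to `b'`, so `f` is run above them and its result is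
copied down to `b`. -/
theorem PT.comp {f : Γ → ℕ} (hf : PT f) (φ : Δ → Γ) [h : Sub φ] : PT (fun δ => f (φ δ)) := by
  obtain ⟨h1, h2, g, hg, h3⟩ := h
  obtain ⟨g', hg', hs, hf⟩ := hf
  refine ⟨fun δ => g δ + (g' (φ δ) + (g' (φ δ) + 2)),
    hg.add ((hg'.comp h2).add ((hg'.comp h2).add (PB.const 2))),
    fun δ => (hs (φ δ)).trans (by dsimp only; omega), fun locs b hl hb => ?_⟩
  obtain ⟨c, locs', b', hb', hl', h⟩ := h3 locs b hl hb
  obtain ⟨c₁, hc₁⟩ := hf locs' b' hl' (by omega)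
  refine ⟨.seq c (.seq c₁ (.assign b (.var b'))), fun δ σ hσ => ?_⟩
  obtain ⟨σ₁, r₁, v₁⟩ := h δ σ hσ
  obtain ⟨σ₂, r₂, e₂⟩ := hc₁ (φ δ) σ₁ v₁
  refine ⟨_, r₁.seq ((r₂.weaken hb' le_rfl).seq ((Runs.assign le_rfl _ σ₂).weaken le_rfl ?_)), ?_⟩
  · simp only [Expr.cost, e₂]
    have := hs (φ δ)
    omega
  · simp [Expr.eval, e₂]

/-- Local variables of a context act as bound variables; an argument is substituted by extending `φ`
with its computed value. -/
theorem PT.app {F : Γ → ℕ → ℕ} (hF : PT fun p : Γ × ℕ => F p.1 p.2) {φ : Δ → Γ} [Sub φ]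
    {G : Δ → ℕ} (hG : PT G) : PT fun δ => F (φ δ) (G δ) :=
  haveI := Sub.pair φ hG
  hF.comp fun δ => (φ δ, G δ)

theorem PT.app₂ {F : Γ → ℕ → ℕ → ℕ} (hF : PT fun p : (Γ × ℕ) × ℕ => F p.1.1 p.1.2 p.2) {φ : Δ → Γ}
    [Sub φ] {G H : Δ → ℕ} (hG : PT G) (hH : PT H) : PT fun δ => F (φ δ) (G δ) (H δ) :=
  haveI := Sub.pair φ hG
  haveI := Sub.pair (fun δ => (φ δ, G δ)) hH
  hF.comp fun δ => ((φ δ, G δ), H δ)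

/-- An expression in the input variables and one computed value. -/
theorem PT.expr {f : Γ → ℕ} (hf : PT f) {h : Γ → ℕ} (E : ℕ → Expr) {g : Γ → ℕ} (hg : PB g)
    (hE : ∀ γ σ b, (∀ x < 6, σ.var x = (Ctx.base γ).state.var x) →
      σ.arr 0 = (Ctx.base γ).state.arr 0 → σ.arr 1 = (Ctx.base γ).state.arr 1 → σ.var b = f γ →
      (E b).eval σ = h γ ∧ (E b).cost σ ≤ g γ) (hh : ∀ γ, Nat.size (h γ) ≤ g γ) : PT h := by
  obtain ⟨g', hg', -, hf⟩ := hf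
  refine ⟨fun γ => g' γ + (g γ + 1), hg'.add (hg.add (PB.const 1)),
    fun γ => (hh γ).trans (by dsimp only; omega), fun locs b hl hb => ?_⟩
  obtain ⟨c, hc⟩ := hf locs b hl hb
  refine ⟨.seq c (.assign b (E b)), fun γ σ hσ => ?_⟩
  obtain ⟨σ₁, r₁, e₁⟩ := hc γ σ hσ
  have v := hσ.runs hl hb r₁
  obtain ⟨h1, h2⟩ := hE γ σ₁ b v.1 v.2.1 v.2.2.1 e₁
  exact ⟨_, r₁.seq ((Runs.assign le_rfl _ σ₁).weaken le_rfl (by omega)), by simp [h1]⟩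

theorem PT.const (c : ℕ) : PT (fun _ : Γ => c) := by
  refine ⟨fun _ => Nat.size c + 2, PB.const _, fun _ => by dsimp only; omega, fun locs b hl hb =>
    ⟨.assign b (.lit c), fun γ σ _ => ⟨_, Runs.assign le_rfl _ σ, by simp [Expr.eval]⟩⟩⟩

theorem PT.var : PT (fun p : Γ × ℕ => p.2) := by
  refine ⟨fun p => sz p + 2, PB.sz.add (PB.const 2), fun p => ?_, fun locs b hl hb => ?_⟩
  · dsimp only
    rw [sz_pair]
    omega
  · refine ⟨.assign b (.var (locs.getD 0 0)), fun p σ hσ => ?_⟩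
    have h1 : σ.var (locs.getD 0 0) = p.2 := by
      have := hσ.2.2.2
      rcases locs with _ | ⟨l, locs⟩
      · simp [Ctx.vals] at this
      · simp only [Ctx.vals, List.map_cons, List.cons.injEq] at this
        exact this.1
    refine ⟨_, (Runs.assign le_rfl _ σ).weaken le_rfl ?_, ?_⟩
    · simp only [Expr.cost, h1]
      rw [sz_pair]
      omega
    · rw [State.set_same, Expr.eval, h1]

theorem PT.snd (φ : Δ → Γ × ℕ) [Sub φ] : PT (fun δ => (φ δ).2) := PT.var.comp φ

theorem PT.weak {f : Γ → ℕ} (hf : PT f) : PT (fun p : Γ × ℕ => f p.1) := hf.comp fun p : Γ × ℕ => p.1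

/-! ### Inputs -/

theorem PT.input (x : ℕ) (hx : x < 6) {g : Γ → ℕ} (hg : PB g)
    (h : ∀ γ, Nat.size ((Ctx.base γ).state.var x) ≤ g γ) :
    PT (fun γ : Γ => (Ctx.base γ).state.var x) :=
  (PT.const 0).expr (fun _ => .var x) (hg.add (PB.const 1))
    (fun γ σ b h1 _ _ _ => ⟨by simp [Expr.eval, h1 x hx], by
      simp only [Expr.cost, h1 x hx]
      exact Nat.add_le_add_right (h γ) 1⟩) fun γ => (h γ).trans (by omega)

theorem size_le_self (x : ℕ) : Nat.size x ≤ x := Nat.size_le.mpr Nat.lt_two_pow_self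

theorem PT.n : PT (fun γ : Γ => (Ctx.base γ).n) :=
  PT.input (Γ := Γ) 0 (by omega) PB.sz fun γ => (size_le_self _).trans (by
    change (Ctx.base γ).n ≤ _
    simp only [Ram.sz, Inst.size]
    omega)

theorem PB.n : PB (fun γ : Γ => (Ctx.base γ).n) := PB.sz.mono fun γ => by
  simp only [Ram.sz, Inst.size]
  omega

theorem PB.k : PB (fun γ : Γ => (Ctx.base γ).k) := PB.sz.mono fun γ => by
  simp only [Ram.sz, Inst.size]
  omega

theorem PB.e : PB (fun γ : Γ => (Ctx.base γ).e) := PB.sz.mono fun γ => by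
  simp only [Ram.sz, Inst.size]
  omega

theorem PB.size_w : PB (fun γ : Γ => Nat.size (Ctx.base γ).w) := PB.sz.mono fun γ => by
  simp only [Ram.sz, Inst.size]
  omega

/-- The length of `S` is not part of the size of an instance; the bound on the number of reads of
each variable makes it polynomial. -/
theorem Inst.length_le (I : Inst) : I.S.length ≤ I.n * I.k := by
  have h : I.S.length = ∑ x, I.S.count x := by
    rw [← List.sum_toFinset_count_eq_length]
    exact Finset.sum_subset (Finset.subset_univ _) fun x _ hx => by
      simpa [List.count_eq_zero] using hx
  rw [h]
  calc _ ≤ ∑ _x : Fin I.n, I.k := Finset.sum_le_sum fun x _ => I.count_le x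
    _ = _ := by simp

theorem PB.length : PB (fun γ : Γ => (Ctx.base γ).S.length) :=
  (PB.n.mul PB.k).mono fun γ => (Ctx.base γ).length_le

theorem PT.k : PT (fun γ : Γ => (Ctx.base γ).k) :=
  PT.input (Γ := Γ) 1 (by omega) PB.k fun γ => size_le_self _

theorem PT.w : PT (fun γ : Γ => (Ctx.base γ).w) :=
  PT.input (Γ := Γ) 2 (by omega) PB.size_w fun γ => le_rfl

theorem PT.e : PT (fun γ : Γ => (Ctx.base γ).e) :=
  PT.input (Γ := Γ) 3 (by omega) PB.e fun γ => size_le_self _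

theorem PT.length : PT (fun γ : Γ => (Ctx.base γ).S.length) :=
  PT.input (Γ := Γ) 4 (by omega) PB.length fun γ => size_le_self _

/-- The entries of the input sequence. -/
def Inst.read (I : Inst) (i : ℕ) : ℕ := (I.S.map Fin.val).getD i 0

/-- The bits of the seed. -/
def Inst.bit (I : Inst) (i : ℕ) : ℕ := ((List.ofFn I.y).map Bool.toNat).getD i 0

theorem Inst.read_le (I : Inst) (i : ℕ) : I.read i ≤ I.n := by
  unfold Inst.read
  rw [List.getD_eq_getElem?_getD, List.getElem?_map]
  rcases I.S[i]? with _ | x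
  · simp
  · simp [x.2.le]

theorem Inst.bit_le (I : Inst) (i : ℕ) : I.bit i ≤ 1 := by
  unfold Inst.bit
  rw [List.getD_eq_getElem?_getD, List.getElem?_map]
  rcases (List.ofFn I.y)[i]? with _ | x
  · simp
  · cases x <;> simp

theorem PT.read {f : Γ → ℕ} (hf : PT f) : PT (fun γ => (Ctx.base γ).read (f γ)) := by
  have hf' := hf
  obtain ⟨g, hg, hs, -⟩ := hf'
  have hr : ∀ γ : Γ, Nat.size ((Ctx.base γ).read (f γ)) ≤ (Ctx.base γ).n := fun γ =>
    (size_le_self _).trans (Inst.read_le _ _)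
  refine hf.expr (fun b => .get 0 (.var b)) ((hg.add PB.n).add (PB.const 2))
    (fun γ σ b _ h2 _ h4 => ?_) fun γ => (hr γ).trans (by omega)
  have h : σ.arr 0 (σ.var b) = (Ctx.base γ).read (f γ) := by rw [h2, h4]; rfl
  refine ⟨h, ?_⟩
  simp only [Expr.cost, Expr.eval, h]
  have := hr γ
  have := hs γ
  rw [h4]
  omega

theorem PT.bit {f : Γ → ℕ} (hf : PT f) : PT (fun γ => (Ctx.base γ).bit (f γ)) := by
  have hf' := hf
  obtain ⟨g, hg, hs, -⟩ := hf'
  have hr : ∀ γ : Γ, Nat.size ((Ctx.base γ).bit (f γ)) ≤ 1 := fun γ =>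
    (size_le_self _).trans (Inst.bit_le _ _)
  refine hf.expr (fun b => .get 1 (.var b)) (hg.add (PB.const 3))
    (fun γ σ b _ _ h2 h4 => ?_) fun γ => (hr γ).trans (by omega)
  have h : σ.arr 1 (σ.var b) = (Ctx.base γ).bit (f γ) := by rw [h2, h4]; rfl
  refine ⟨h, ?_⟩
  simp only [Expr.cost, Expr.eval, h]
  have := hr γ
  have := hs γ
  rw [h4]
  omega

/-! ### Arithmetic and conditionals -/

theorem size_add_le (a b : ℕ) : Nat.size (a + b) ≤ Nat.size a + Nat.size b + 1 := by
  rw [Nat.size_le]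
  have h1 := Nat.lt_size_self a
  have h2 := Nat.lt_size_self b
  have h3 : 2 ^ Nat.size a ≤ 2 ^ (Nat.size a + Nat.size b) := Nat.pow_le_pow_right (by omega) (by omega)
  have h4 : 2 ^ Nat.size b ≤ 2 ^ (Nat.size a + Nat.size b) := Nat.pow_le_pow_right (by omega) (by omega)
  rw [pow_succ]
  omega

theorem size_mul_le (a b : ℕ) : Nat.size (a * b) ≤ Nat.size a + Nat.size b := by
  rw [Nat.size_le, pow_add]
  exact Nat.mul_lt_mul'' (Nat.lt_size_self a) (Nat.lt_size_self b)

theorem BinOp.size_eval_le (o : BinOp) (a b : ℕ) :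
    Nat.size (o.eval a b) ≤ Nat.size a + Nat.size b + 1 := by
  cases o
  · exact size_add_le a b
  · exact (Nat.size_le_size (Nat.sub_le a b)).trans (by omega)
  · exact (size_mul_le a b).trans (by omega)
  · exact (Nat.size_le_size (Nat.div_le_self a b)).trans (by omega)
  · exact (Nat.size_le_size (Nat.mod_le a b)).trans (by omega)

theorem PT.op (o : BinOp) {f₁ f₂ : Γ → ℕ} (h₁ : PT f₁) (h₂ : PT f₂) :
    PT (fun γ => o.eval (f₁ γ) (f₂ γ)) := by
  obtain ⟨g₁, p₁, s₁, h₁⟩ := h₁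
  obtain ⟨g₂, p₂, s₂, h₂⟩ := h₂
  refine ⟨fun γ => g₁ γ + (g₂ γ + (2 * (g₁ γ + g₂ γ) + 5)),
    p₁.add (p₂.add (((PB.const 2).mul (p₁.add p₂)).add (PB.const 5))), fun γ => ?_,
    fun locs b hl hb => ?_⟩
  · have := o.size_eval_le (f₁ γ) (f₂ γ)
    have := s₁ γ
    have := s₂ γ
    dsimp only
    omega
  · obtain ⟨c₁, hc₁⟩ := h₁ locs b hl hb
    obtain ⟨c₂, hc₂⟩ := h₂ locs (b + 1) (fun l hl' => (hl l hl').trans (by omega)) (by omega)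
    refine ⟨.seq c₁ (.seq c₂ (.assign b (.op o (.var b) (.var (b + 1))))), fun γ σ hσ => ?_⟩
    obtain ⟨σ₁, r₁, e₁⟩ := hc₁ γ σ hσ
    obtain ⟨σ₂, r₂, e₂⟩ := hc₂ γ σ₁ (hσ.runs hl hb r₁)
    have e₁' : σ₂.var b = f₁ γ := (r₂.2.2 b (by omega)).trans e₁
    refine ⟨_, r₁.seq ((r₂.weaken (by omega) le_rfl).seq
      ((Runs.assign le_rfl _ σ₂).weaken le_rfl ?_)), ?_⟩
    · simp only [Expr.cost, Expr.eval, e₁', e₂]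
      have := o.size_eval_le (f₁ γ) (f₂ γ)
      have := s₁ γ
      have := s₂ γ
      omega
    · simp [Expr.eval, e₁', e₂]

theorem PT.add {f₁ f₂ : Γ → ℕ} (h₁ : PT f₁) (h₂ : PT f₂) : PT (fun γ => f₁ γ + f₂ γ) :=
  h₁.op .add h₂

theorem PT.sub {f₁ f₂ : Γ → ℕ} (h₁ : PT f₁) (h₂ : PT f₂) : PT (fun γ => f₁ γ - f₂ γ) :=
  h₁.op .sub h₂

theorem PT.mul {f₁ f₂ : Γ → ℕ} (h₁ : PT f₁) (h₂ : PT f₂) : PT (fun γ => f₁ γ * f₂ γ) :=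
  h₁.op .mul h₂

theorem PT.div {f₁ f₂ : Γ → ℕ} (h₁ : PT f₁) (h₂ : PT f₂) : PT (fun γ => f₁ γ / f₂ γ) :=
  h₁.op .div h₂

theorem PT.mod {f₁ f₂ : Γ → ℕ} (h₁ : PT f₁) (h₂ : PT f₂) : PT (fun γ => f₁ γ % f₂ γ) :=
  h₁.op .mod h₂

/-- Predicates that are decided in polynomial time. -/
def PTP (P : Γ → Prop) : Prop := ∃ f : Γ → ℕ, PT f ∧ ∀ γ, f γ ≠ 0 ↔ P γ

theorem PTP.of_iff {P Q : Γ → Prop} (hP : PTP P) (h : ∀ γ, P γ ↔ Q γ) : PTP Q := by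
  obtain ⟨f, hf, hfP⟩ := hP
  exact ⟨f, hf, fun γ => (hfP γ).trans (h γ)⟩

theorem PT.ite {P : Γ → Prop} [∀ γ, Decidable (P γ)] (hP : PTP P) {f₁ f₂ : Γ → ℕ} (h₁ : PT f₁)
    (h₂ : PT f₂) : PT (fun γ => if P γ then f₁ γ else f₂ γ) := by
  obtain ⟨f, ⟨g, p, s, h⟩, hfP⟩ := hP
  obtain ⟨g₁, p₁, s₁, h₁⟩ := h₁
  obtain ⟨g₂, p₂, s₂, h₂⟩ := h₂
  refine ⟨fun γ => g γ + (g γ + 1 + 1 + (g₁ γ + g₂ γ)),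
    p.add (((p.add (PB.const 1)).add (PB.const 1)).add (p₁.add p₂)), fun γ => ?_,
    fun locs b hl hb => ?_⟩
  · have := s₁ γ
    have := s₂ γ
    dsimp only
    split_ifs <;> omega
  · obtain ⟨c, hc⟩ := h locs b hl hb
    obtain ⟨c₁, hc₁⟩ := h₁ locs b hl hb
    obtain ⟨c₂, hc₂⟩ := h₂ locs b hl hb
    refine ⟨.seq c (.ite (.var b) c₁ c₂), fun γ σ hσ => ?_⟩
    obtain ⟨σ₀, r₀, e₀⟩ := hc γ σ hσ
    have v := hσ.runs hl hb r₀
    have hcost : (Expr.var b).cost σ₀ ≤ g γ + 1 := by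
      simp only [Expr.cost, e₀]
      exact Nat.add_le_add_right (s γ) 1
    by_cases hγ : P γ
    · obtain ⟨σ₁, r₁, e₁⟩ := hc₁ γ σ₀ v
      have h0 : (Expr.var b).eval σ₀ ≠ 0 := by
        simp only [Expr.eval, e₀]
        exact (hfP γ).mpr hγ
      refine ⟨σ₁, r₀.seq ((Runs.ite (fun _ => r₁) fun h => absurd h h0).weaken le_rfl (by omega)), ?_⟩
      simp [e₁, hγ]
    · obtain ⟨σ₁, r₁, e₁⟩ := hc₂ γ σ₀ v
      have h0 : (Expr.var b).eval σ₀ = 0 := by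
        simp only [Expr.eval, e₀]
        by_contra h
        exact hγ ((hfP γ).mp h)
      refine ⟨σ₁, r₀.seq ((Runs.ite (fun h => absurd h0 h) fun _ => r₁).weaken le_rfl (by omega)), ?_⟩
      simp [e₁, hγ]

theorem PTP.lt {f₁ f₂ : Γ → ℕ} (h₁ : PT f₁) (h₂ : PT f₂) : PTP (fun γ => f₁ γ < f₂ γ) :=
  ⟨_, h₂.sub h₁, fun γ => by omega⟩

theorem PTP.le {f₁ f₂ : Γ → ℕ} (h₁ : PT f₁) (h₂ : PT f₂) : PTP (fun γ => f₁ γ ≤ f₂ γ) :=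
  ⟨_, (h₂.add (PT.const 1)).sub h₁, fun γ => by omega⟩

theorem PTP.eq {f₁ f₂ : Γ → ℕ} (h₁ : PT f₁) (h₂ : PT f₂) : PTP (fun γ => f₁ γ = f₂ γ) :=
  ⟨_, (PT.const 1).sub ((h₂.sub h₁).add (h₁.sub h₂)), fun γ => by omega⟩

theorem PTP.and {P Q : Γ → Prop} (hP : PTP P) (hQ : PTP Q) : PTP (fun γ => P γ ∧ Q γ) := by
  obtain ⟨f, hf, hfP⟩ := hP
  obtain ⟨g, hg, hgQ⟩ := hQ
  exact ⟨_, hf.mul hg, fun γ => by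
    dsimp only
    rw [← hfP, ← hgQ, mul_ne_zero_iff]⟩

theorem PTP.app₂ {P : Γ → ℕ → ℕ → Prop} (hP : PTP fun p : (Γ × ℕ) × ℕ => P p.1.1 p.1.2 p.2)
    {φ : Δ → Γ} [Sub φ] {G H : Δ → ℕ} (hG : PT G) (hH : PT H) :
    PTP fun δ => P (φ δ) (G δ) (H δ) := by
  obtain ⟨f, hf, hfP⟩ := hP
  exact ⟨_, PT.app₂ (F := fun γ x y => f ((γ, x), y)) hf hG hH, fun δ => hfP ((φ δ, G δ), H δ)⟩

end PT

end Ram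

namespace Ram

section PT

variable {Γ Δ Θ : Type} [Ctx Γ] [Ctx Δ] [Ctx Θ]

/-! ### Iteration -/

theorem PB.sub {g : Γ → ℕ} (hg : PB g) (φ : Δ → Γ) [h : Sub φ] : PB (fun δ => g (φ δ)) :=
  hg.comp h.pb

theorem PT.size_pb {f : Γ → ℕ} (hf : PT f) : PB fun γ => Nat.size (f γ) := by
  obtain ⟨g, hg, hs, -⟩ := hf
  exact hg.mono hs

/-- A counted loop: variable `b` holds the value, `b + 1` the number of rounds and `b + 2` the
counter, and the step works from `b + 3` on. The number of rounds is polynomial, and since `hv`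
keeps all intermediate values short, `PB.extend` yields one polynomial bound for the cost of every
round. -/
theorem PT.iter {init cnt g : Γ → ℕ} {step : Γ → ℕ → ℕ → ℕ} (hinit : PT init)
    (hstep : PT fun p : (Γ × ℕ) × ℕ => step p.1.1 p.1.2 p.2) (hcnt : PT cnt) (hcb : PB cnt)
    {v : Γ → ℕ → ℕ} (v0 : ∀ γ, v γ 0 = init γ) (vs : ∀ γ i, v γ (i + 1) = step γ i (v γ i))
    (hg : PB g) (hv : ∀ γ i, i ≤ cnt γ → Nat.size (v γ i) ≤ g γ) :
    PT fun γ => v γ (cnt γ) := by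
  obtain ⟨g₁, p₁, s₁, h₁⟩ := hinit
  obtain ⟨g₂, p₂, s₂, h₂⟩ := hcnt
  obtain ⟨g₃, p₃, s₃, h₃⟩ := hstep
  obtain ⟨g₄, p₄, h₄⟩ := p₃.extend (hg.sub fun p : Γ × ℕ => p.1)
  obtain ⟨g₅, p₅, h₅⟩ := p₄.extend hcb
  have hG : ∀ γ i, i ≤ cnt γ → g₃ ((γ, i), v γ i) ≤ g₅ γ := fun γ i hi =>
    (h₄ (γ, i) (v γ i) (hv γ i hi)).trans (h₅ γ i ((size_le_self i).trans hi))
  let E : Γ → ℕ := fun γ => 3 * cnt γ + 3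
  let T : Γ → ℕ := fun γ => g₅ γ + ((g₅ γ + 2) + (2 * cnt γ + 7))
  have pE : PB E := ((PB.const 3).mul hcb).add (PB.const 3)
  have pT : PB T := p₅.add ((p₅.add (PB.const 2)).add (((PB.const 2).mul hcb).add (PB.const 7)))
  refine ⟨fun γ => g γ + (g₁ γ + (g₂ γ + (2 + (cnt γ + 1) * (E γ + 1 + T γ)))),
    hg.add (p₁.add (p₂.add ((PB.const 2).add ((hcb.add (PB.const 1)).mul
      ((pE.add (PB.const 1)).add pT))))),
    fun γ => (hv γ _ le_rfl).trans (Nat.le_add_right _ _), fun locs b hl hb => ?_⟩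
  have hl1 : ∀ l ∈ locs, l < b + 1 := fun l h => (hl l h).trans (by omega)
  have hl3 : ∀ l ∈ b :: (b + 2) :: locs, l < b + 3 := by
    intro l h
    simp only [List.mem_cons] at h
    rcases h with rfl | rfl | h
    · omega
    · omega
    · exact (hl l h).trans (by omega)
  obtain ⟨c₁, hc₁⟩ := h₁ locs b hl hb
  obtain ⟨c₂, hc₂⟩ := h₂ locs (b + 1) hl1 (by omega)
  obtain ⟨c₃, hc₃⟩ := h₃ (b :: (b + 2) :: locs) (b + 3) hl3 (by omega)
  refine ⟨.seq c₁ (.seq c₂ (.seq (.assign (b + 2) (.lit 0))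
    (.loop (.op .sub (.var (b + 1)) (.var (b + 2))) (.seq c₃ (.seq (.assign b (.var (b + 3)))
      (.assign (b + 2) (.op .add (.var (b + 2)) (.lit 1)))))))), fun γ σ hσ => ?_⟩
  obtain ⟨σ₁, r₁, e₁⟩ := hc₁ γ σ hσ
  have v₁ := hσ.runs hl hb r₁
  obtain ⟨σ₂, r₂, e₂⟩ := hc₂ γ σ₁ v₁
  have r₃ := Runs.assign (b := b) (x := b + 2) (by omega) (.lit 0) σ₂
  set σ₃ := σ₂.set (b + 2) ((Expr.lit 0).eval σ₂) with hσ₃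
  obtain ⟨σ₄, ⟨t, lt, ex⟩, hInv⟩ := Exec.loop
    (e := .op .sub (.var (b + 1)) (.var (b + 2)))
    (c := .seq c₃ (.seq (.assign b (.var (b + 3)))
      (.assign (b + 2) (.op .add (.var (b + 2)) (.lit 1))))) (m := cnt γ) (E := E γ) (T := T γ)
    (Inv := fun i τ => (τ.arr = σ₃.arr ∧ ∀ x < b, τ.var x = σ₃.var x) ∧ τ.var b = v γ i ∧
      τ.var (b + 1) = cnt γ ∧ τ.var (b + 2) = i) (σ := σ₃)
    (by
      rintro i hi τ ⟨-, -, i2, i3⟩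
      simp only [Expr.eval, Expr.cost, BinOp.eval, i2, i3]
      refine ⟨by omega, ?_⟩
      have := size_le_self (cnt γ)
      have := size_le_self i
      have := size_le_self (cnt γ - i)
      simp only [E]
      omega)
    (by
      rintro i hi τ ⟨⟨i0, i0'⟩, i1, i2, i3⟩
      have hγ : Valid γ locs τ := by
        refine (v₁.runs hl1 (by omega) r₂).frame hl hb (by rw [i0, hσ₃, State.set_arr]) fun x hx => ?_
        rw [i0' x hx, hσ₃, State.set_ne _ _ (by omega)]
      obtain ⟨τ₁, q₁, w₁⟩ := hc₃ ((γ, i), v γ i) τ ((hγ.cons i3).cons i1)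
      have q₂ := Runs.assign (b := b) le_rfl (.var (b + 3)) τ₁
      set τ₂ := τ₁.set b ((Expr.var (b + 3)).eval τ₁) with hτ₂
      have q₃ := Runs.assign (b := b) (x := b + 2) (by omega)
        (.op .add (.var (b + 2)) (.lit 1)) τ₂
      have w₂ : τ₂.var (b + 2) = i := by
        rw [hτ₂, State.set_ne _ _ (by omega), q₁.2.2 _ (by omega), i3]
      have q := (q₁.weaken (b' := b) (by omega) (hG γ i hi.le)).seq
        ((q₂.weaken le_rfl (T' := g₅ γ + 2) (by
          simp only [Expr.cost, w₁]
          have := s₃ ((γ, i), v γ i)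
          have := hG γ i hi.le
          dsimp only at *
          omega)).seq (q₃.weaken le_rfl (T' := 2 * cnt γ + 7) (by
          simp only [Expr.cost, Expr.eval, BinOp.eval, w₂]
          have := size_le_self i
          have := size_le_self (i + 1)
          have := size_le_self 1
          omega)))
      obtain ⟨⟨t, ex, lt⟩, q0, q0'⟩ := q
      refine ⟨_, ⟨t, lt, ex⟩, ⟨q0.trans i0, fun x hx => (q0' x hx).trans (i0' x hx)⟩, ?_, ?_, ?_⟩
      · rw [State.set_ne _ _ (by omega), hτ₂, State.set_same, Expr.eval, w₁, vs]
      · rw [State.set_ne _ _ (by omega), hτ₂, State.set_ne _ _ (by omega), q₁.2.2 _ (by omega), i2]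
      · rw [State.set_same]
        simp only [Expr.eval, BinOp.eval, w₂])
    (by
      refine ⟨⟨rfl, fun _ _ => rfl⟩, ?_, ?_, ?_⟩
      · rw [hσ₃, State.set_ne _ _ (by omega), r₂.2.2 _ (by omega), e₁, v0]
      · rw [hσ₃, State.set_ne _ _ (by omega), e₂]
      · rw [hσ₃, State.set_same, Expr.eval])
  refine ⟨σ₄, (r₁.seq ((r₂.weaken (by omega) le_rfl).seq ((r₃.weaken le_rfl (T' := 2) ?_).seq
    ⟨⟨t, ex, lt⟩, hInv.1⟩))).weaken le_rfl (Nat.le_add_left _ _), hInv.2.1⟩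
  simp [Expr.cost]

/-- The value is halved until it vanishes, which takes as many rounds as it has bits. -/
theorem PT.natSize {f : Γ → ℕ} (hf : PT f) : PT fun γ => Nat.size (f γ) := by
  obtain ⟨g, p, s, h⟩ := hf
  let E : Γ → ℕ := fun γ => g γ + 1
  let T : Γ → ℕ := fun γ => (2 * g γ + 6) + (2 * g γ + 7)
  have pE : PB E := p.add (PB.const 1)
  have pT : PB T := (((PB.const 2).mul p).add (PB.const 6)).add (((PB.const 2).mul p).add (PB.const 7))
  refine ⟨fun γ => g γ + (2 + (g γ + 1) * (E γ + 1 + T γ)),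
    p.add ((PB.const 2).add ((p.add (PB.const 1)).mul ((pE.add (PB.const 1)).add pT))),
    fun γ => (size_le_self _).trans ((s γ).trans (Nat.le_add_right _ _)), fun locs b hl hb => ?_⟩
  have hl1 : ∀ l ∈ locs, l < b + 1 := fun l h => (hl l h).trans (by omega)
  obtain ⟨c₁, hc₁⟩ := h locs (b + 1) hl1 (by omega)
  refine ⟨.seq c₁ (.seq (.assign b (.lit 0)) (.loop (.var (b + 1))
    (.seq (.assign (b + 1) (.op .div (.var (b + 1)) (.lit 2)))
      (.assign b (.op .add (.var b) (.lit 1)))))), fun γ σ hσ => ?_⟩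
  obtain ⟨σ₁, r₁, e₁⟩ := hc₁ γ σ hσ
  have r₂ := Runs.assign (b := b) le_rfl (.lit 0) σ₁
  set σ₂ := σ₁.set b ((Expr.lit 0).eval σ₁) with hσ₂
  have hdiv : ∀ i, Nat.size (f γ / 2 ^ i) ≤ g γ := fun i =>
    (Nat.size_le_size (Nat.div_le_self _ _)).trans (s γ)
  obtain ⟨σ₃, ⟨t, lt, ex⟩, hInv⟩ := Exec.loop (e := .var (b + 1))
    (c := .seq (.assign (b + 1) (.op .div (.var (b + 1)) (.lit 2)))
      (.assign b (.op .add (.var b) (.lit 1)))) (m := Nat.size (f γ)) (E := E γ) (T := T γ)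
    (Inv := fun i τ => (τ.arr = σ₂.arr ∧ ∀ x < b, τ.var x = σ₂.var x) ∧ τ.var b = i ∧
      τ.var (b + 1) = f γ / 2 ^ i) (σ := σ₂)
    (by
      rintro i hi τ ⟨-, -, i2⟩
      simp only [Expr.eval, Expr.cost, i2]
      refine ⟨?_, Nat.add_le_add_right (hdiv i) 1⟩
      rw [Nat.lt_size, Nat.div_ne_zero_iff]
      have : 2 ^ i ≠ 0 := by positivity
      tauto)
    (by
      rintro i hi τ ⟨⟨i0, i0'⟩, i1, i2⟩
      have q₁ := Runs.assign (b := b) (x := b + 1) (by omega)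
        (.op .div (.var (b + 1)) (.lit 2)) τ
      set τ₁ := τ.set (b + 1) ((Expr.op .div (.var (b + 1)) (.lit 2)).eval τ) with hτ₁
      have q₂ := Runs.assign (b := b) le_rfl (.op .add (.var b) (.lit 1)) τ₁
      have w₁ : τ₁.var b = i := by rw [hτ₁, State.set_ne _ _ (by omega), i1]
      have h2 : f γ / 2 ^ i / 2 = f γ / 2 ^ (i + 1) := by rw [Nat.div_div_eq_div_mul, pow_succ]
      have q := (q₁.weaken le_rfl (T' := 2 * g γ + 6) (by
          simp only [Expr.cost, Expr.eval, BinOp.eval, i2, h2]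
          have := hdiv i
          have := hdiv (i + 1)
          have := size_le_self 2
          omega)).seq (q₂.weaken le_rfl (T' := 2 * g γ + 7) (by
          simp only [Expr.cost, Expr.eval, BinOp.eval, w₁]
          have := size_le_self i
          have := size_le_self (i + 1)
          have := size_le_self 1
          have := s γ
          omega))
      obtain ⟨⟨t, ex, lt⟩, q0, q0'⟩ := q
      refine ⟨_, ⟨t, lt, ex⟩, ⟨q0.trans i0, fun x hx => (q0' x hx).trans (i0' x hx)⟩, ?_, ?_⟩
      · rw [State.set_same]
        simp only [Expr.eval, BinOp.eval, w₁]
      · rw [State.set_ne _ _ (by omega), hτ₁, State.set_same]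
        simp only [Expr.eval, BinOp.eval, i2, h2])
    (by
      refine ⟨⟨rfl, fun _ _ => rfl⟩, ?_, ?_⟩
      · rw [hσ₂, State.set_same, Expr.eval]
      · rw [hσ₂, State.set_ne _ _ (by omega), e₁, pow_zero, Nat.div_one])
  refine ⟨σ₃, ((r₁.weaken (by omega) le_rfl).seq ((r₂.weaken le_rfl (T' := 2) ?_).seq
    ⟨⟨t, ex, lt.trans (Nat.mul_le_mul_right _ (Nat.add_le_add_right (s γ) 1))⟩, hInv.1⟩)),
    hInv.2.1⟩
  simp [Expr.cost]

/-! ### Bounded sums, suprema, search and powers -/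

/-- The values of a computable function at arguments below a polynomial bound are short. -/
theorem PT.size_bound {f : Γ → ℕ → ℕ} (hf : PT fun p : Γ × ℕ => f p.1 p.2) {cnt : Γ → ℕ}
    (hcb : PB cnt) : ∃ g : Γ → ℕ, PB g ∧ ∀ γ i, i ≤ cnt γ → Nat.size (f γ i) ≤ g γ := by
  obtain ⟨g, hg, h⟩ := hf.size_pb.extend hcb
  exact ⟨g, hg, fun γ i hi => h γ i ((size_le_self i).trans hi)⟩

theorem PT.sum {f : Γ → ℕ → ℕ} {cnt : Γ → ℕ} (hcnt : PT cnt) (hcb : PB cnt)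
    (hf : PT fun p : Γ × ℕ => f p.1 p.2) : PT fun γ => ∑ i ∈ Finset.range (cnt γ), f γ i := by
  obtain ⟨g, hg, hs⟩ := hf.size_bound hcb
  refine PT.iter (v := fun γ m => ∑ i ∈ Finset.range m, f γ i) (PT.const 0)
    (step := fun γ i a => a + f γ i) (PT.var.add (hf.comp fun p : (Γ × ℕ) × ℕ => p.1)) hcnt hcb
    (fun γ => by simp) (fun γ i => Finset.sum_range_succ _ _) (hcb.add hg) fun γ i hi => ?_
  have h : ∑ j ∈ Finset.range i, f γ j ≤ i * 2 ^ g γ := by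
    refine (Finset.sum_le_card_nsmul _ _ (2 ^ g γ) fun j hj => ?_).trans (by simp)
    rw [Finset.mem_range] at hj
    exact (Nat.size_le.mp (hs γ j (by omega))).le
  rw [Nat.size_le, pow_add]
  refine h.trans_lt (Nat.mul_lt_mul_of_pos_right ?_ (by positivity))
  exact hi.trans_lt Nat.lt_two_pow_self

theorem PT.max {f₁ f₂ : Γ → ℕ} (h₁ : PT f₁) (h₂ : PT f₂) : PT fun γ => Max.max (f₁ γ) (f₂ γ) :=
  (PT.ite (PTP.le h₁ h₂) h₂ h₁).of_eq fun γ => by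
    split_ifs <;> omega

theorem PT.min {f₁ f₂ : Γ → ℕ} (h₁ : PT f₁) (h₂ : PT f₂) : PT fun γ => Min.min (f₁ γ) (f₂ γ) :=
  (PT.ite (PTP.le h₁ h₂) h₁ h₂).of_eq fun γ => by
    split_ifs <;> omega

theorem PT.sup {f : Γ → ℕ → ℕ} {cnt : Γ → ℕ} (hcnt : PT cnt) (hcb : PB cnt)
    (hf : PT fun p : Γ × ℕ => f p.1 p.2) : PT fun γ => (Finset.range (cnt γ)).sup (f γ) := by
  obtain ⟨g, hg, hs⟩ := hf.size_bound hcb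
  refine PT.iter (v := fun γ m => (Finset.range m).sup (f γ)) (PT.const 0)
    (step := fun γ i a => Max.max (f γ i) a) ((hf.comp fun p : (Γ × ℕ) × ℕ => p.1).max PT.var)
    hcnt hcb (fun γ => by simp) (fun γ i => ?_) hg fun γ i hi => ?_
  · rw [Finset.range_add_one, Finset.sup_insert]
  · rw [Nat.size_le, Finset.sup_lt_iff (by simp)]
    intro j hj
    rw [Finset.mem_range] at hj
    exact Nat.size_le.mp (hs γ j (by omega))

/-- The recursion that defines `least` is itself the loop to be run. -/
theorem PT.least {P : Γ → ℕ → Prop} [∀ γ, DecidablePred (P γ)] {cnt : Γ → ℕ} (hcnt : PT cnt)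
    (hcb : PB cnt) (hP : PTP fun p : Γ × ℕ => P p.1 p.2) :
    PT fun γ => ReadK.least (P γ) (cnt γ) := by
  refine PT.iter (v := fun γ m => ReadK.least (P γ) m) (PT.const 0)
    (step := fun γ i a => if a < i then a else if P γ i then i else i + 1) ?_
    hcnt hcb (fun γ => rfl) (fun γ i => rfl) hcb fun γ i hi =>
      (size_le_self _).trans ((ReadK.least_spec _ _).1.trans hi)
  have hi : PT fun p : (Γ × ℕ) × ℕ => p.1.2 := PT.snd fun p : (Γ × ℕ) × ℕ => p.1
  obtain ⟨f, hf, hfP⟩ := hP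
  have hP' : PTP fun p : (Γ × ℕ) × ℕ => P p.1.1 p.1.2 :=
    ⟨_, hf.comp fun p : (Γ × ℕ) × ℕ => p.1, fun p => hfP p.1⟩
  exact PT.ite (PTP.lt PT.var hi) PT.var (PT.ite hP' hi (hi.add (PT.const 1)))

theorem PTP.exists_lt {P : Γ → ℕ → Prop} {cnt : Γ → ℕ} (hcnt : PT cnt)
    (hcb : PB cnt) (hP : PTP fun p : Γ × ℕ => P p.1 p.2) :
    PTP fun γ => ∃ i < cnt γ, P γ i := by
  classical
  refine (PTP.lt (PT.least hcnt hcb hP) hcnt).of_iff fun γ => ⟨fun h => ?_, ?_⟩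
  · exact ⟨_, h, (ReadK.least_spec _ _).2.1 h⟩
  · rintro ⟨i, hi, h⟩
    exact ReadK.least_lt hi h

theorem size_pow_le (a i : ℕ) : Nat.size (a ^ i) ≤ i * Nat.size a + 1 := by
  rw [Nat.size_le, pow_succ, mul_comm i, pow_mul]
  have := Nat.pow_le_pow_left (Nat.lt_size_self a).le i
  have : 0 < (2 ^ Nat.size a) ^ i := by positivity
  omega

theorem PT.pow {f g : Γ → ℕ} (hf : PT f) (hg : PT g) (hgb : PB g) : PT fun γ => f γ ^ g γ := by
  refine PT.iter (v := fun γ m => f γ ^ m) (PT.const 1)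
    (step := fun γ i a => a * f γ) (PT.var.mul (hf.comp fun p : (Γ × ℕ) × ℕ => p.1.1)) hg hgb
    (fun γ => pow_zero _) (fun γ i => pow_succ _ _) ((hgb.mul hf.size_pb).add (PB.const 1))
    fun γ i hi => (size_pow_le _ _).trans (Nat.add_le_add_right (Nat.mul_le_mul_right _ hi) 1)

/-! ### Tables encoded as numbers -/

/-- The entry `x < m` of a table, stored as digits in base `B`. -/
def entry (B m code x : ℕ) : ℕ := if x < m then code / B ^ x % B else 0

theorem sum_digits_lt {B m : ℕ} {F : ℕ → ℕ} (hF : ∀ x < m, F x < B) :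
    ∑ x ∈ Finset.range m, F x * B ^ x < B ^ m := by
  induction m with
  | zero => simp
  | succ m ih =>
    rw [Finset.sum_range_succ, pow_succ]
    have h1 := ih fun x hx => hF x (by omega)
    have h2 : (F m + 1) * B ^ m ≤ B * B ^ m := Nat.mul_le_mul_right _ (hF m (by omega))
    rw [mul_comm (B ^ m)]
    rw [add_mul, one_mul] at h2
    omega

theorem entry_sum {B m : ℕ} {F : ℕ → ℕ} (hF : ∀ x < m, F x < B) (h0 : ∀ x, m ≤ x → F x = 0) :
    entry B m (∑ x ∈ Finset.range m, F x * B ^ x) = F := by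
  funext x
  unfold entry
  split_ifs with hx
  · have hB : 0 < B := (Nat.zero_le _).trans_lt (hF x hx)
    rw [← Finset.sum_range_add_sum_Ico _ (Nat.succ_le_of_lt hx), Finset.sum_range_succ]
    have h1 : ∃ c, ∑ z ∈ Finset.Ico (x + 1) m, F z * B ^ z = B ^ x * (B * c) := by
      simp only [← mul_assoc, ← pow_succ]
      change B ^ (x + 1) ∣ _
      refine Finset.dvd_sum fun z hz => ?_
      rw [Finset.mem_Ico] at hz
      exact (pow_dvd_pow B hz.1).mul_left _
    obtain ⟨c, hc⟩ := h1
    rw [hc, add_assoc, mul_comm (F x), ← mul_add,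
      Nat.add_mul_div_left _ _ (by positivity),
      Nat.div_eq_of_lt (sum_digits_lt fun z hz => hF z (by omega)), zero_add,
      Nat.add_mul_mod_self_left, Nat.mod_eq_of_lt (hF x hx)]
  · exact (h0 x (by omega)).symm

/-- The exponent is capped at `m` so that the power stays short for every value of the index, not
only for those inside the table. -/
theorem PT.entry {B m code f : Γ → ℕ} (hB : PT B) (hm : PT m) (hmb : PB m) (hc : PT code)
    (hf : PT f) : PT fun γ => entry (B γ) (m γ) (code γ) (f γ) := by
  have h := PT.ite (PTP.lt hf hm) ((hc.div (hB.pow (hf.min hm) (hmb.mono fun γ => min_le_right _ _))).mod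
    hB) (PT.const 0)
  refine h.of_eq fun γ => ?_
  unfold Ram.entry
  split_ifs with h
  · rw [min_eq_left h.le]
  · rfl

/-- Iteration of a step that acts on tables. -/
theorem PT.iterTable {B m cnt : Γ → ℕ} {F : Γ → ℕ → ℕ → ℕ} {step : Γ → ℕ → (ℕ → ℕ) → ℕ → ℕ}
    (hB : PT B) (hm : PT m) (hmb : PB m) (hcnt : PT cnt) (hcb : PB cnt)
    (hF0 : PT fun p : Γ × ℕ => F p.1 0 p.2) (hFs : ∀ γ i, i < cnt γ → F γ (i + 1) = step γ i (F γ i))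
    (hstep : PT fun p : ((Γ × ℕ) × ℕ) × ℕ =>
      step p.1.1.1 p.1.1.2 (Ram.entry (B p.1.1.1) (m p.1.1.1) p.1.2) p.2)
    (hz : ∀ γ i x, m γ ≤ x → F γ i x = 0) (hlt : ∀ γ i x, i ≤ cnt γ → F γ i x < B γ) :
    PT fun p : Γ × ℕ => F p.1 (cnt p.1) p.2 := by
  have hsum : ∀ {Δ : Type} [Ctx Δ] (φ : Δ → Γ) [Sub φ] {G : Δ → ℕ → ℕ},
      PT (fun p : Δ × ℕ => G p.1 p.2) →
      PT fun δ => ∑ x ∈ Finset.range (m (φ δ)), G δ x * B (φ δ) ^ x := by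
    intro Δ _ φ _ G hG
    have hm' : PT fun p : Δ × ℕ => m (φ p.1) := (hm.comp φ).weak
    have hpow := ((hB.comp φ).weak).pow (PT.var.min hm')
      (((hmb.sub φ).sub fun p : Δ × ℕ => p.1).mono fun p => min_le_right _ _)
    refine (PT.sum (f := fun δ x => G δ x * B (φ δ) ^ Min.min x (m (φ δ))) (hm.comp φ)
      (hmb.sub φ) (hG.mul hpow)).of_eq fun δ => Finset.sum_congr rfl fun x hx => ?_
    rw [min_eq_left (Finset.mem_range.mp hx).le]
  let v : Γ → ℕ → ℕ := fun γ i => Nat.rec (∑ x ∈ Finset.range (m γ), F γ 0 x * B γ ^ x)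
    (fun i a => ∑ x ∈ Finset.range (m γ), step γ i (Ram.entry (B γ) (m γ) a) x * B γ ^ x) i
  -- Entries are digits by `hlt` and vanish from `m` on by `hz`, so a code determines the whole
  -- function, and the numbers computed round by round are the codes of `F γ i`.
  have hv : ∀ γ i, i ≤ cnt γ → v γ i = ∑ x ∈ Finset.range (m γ), F γ i x * B γ ^ x := by
    intro γ i hi
    induction i with
    | zero => rfl
    | succ i ih =>
      change ∑ x ∈ Finset.range (m γ), step γ i (Ram.entry (B γ) (m γ) (v γ i)) x * B γ ^ x = _
      rw [ih (by omega), entry_sum (fun x _ => hlt _ _ _ (by omega)) fun x hx => hz _ _ _ hx,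
        hFs _ _ (by omega)]
  have hcode : PT fun γ => v γ (cnt γ) := by
    refine PT.iter (hsum (fun γ => γ) hF0)
      (step := fun γ i a => ∑ x ∈ Finset.range (m γ),
        step γ i (Ram.entry (B γ) (m γ) a) x * B γ ^ x)
      (hsum (fun p : (Γ × ℕ) × ℕ => p.1.1) hstep) hcnt hcb (fun γ => rfl)
      (fun γ i => rfl) ((hmb.mul hB.size_pb).add (PB.const 1)) fun γ i hi => ?_
    rw [hv γ i hi]
    exact (Nat.size_le_size (sum_digits_lt fun x _ => hlt _ _ _ hi).le).trans (size_pow_le _ _)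
  refine PT.of_eq (PT.entry hB.weak hm.weak (hmb.sub fun p : Γ × ℕ => p.1) hcode.weak PT.var)
    fun p => ?_
  rw [hv _ _ le_rfl, entry_sum (fun x _ => hlt _ _ _ le_rfl) fun x hx => hz _ _ _ hx]

end PT

end Ram

/-! ### Reading times and labels as functions of the instance, and their computability. -/

namespace Ram

open ReadK

/-- The length of the padded sequence. -/
abbrev Inst.timeBound (I : Inst) : ℕ := I.n * I.k

/-- The number of reads of `x` among the first `p` reads of the input sequence. -/
def Inst.count (I : Inst) (p x : ℕ) : ℕ :=
  ∑ q ∈ Finset.range (min p I.S.length), if I.read q = x then 1 else 0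

/-- The position of the `c`-th read of `x` in the padded sequence. -/
def Inst.time (I : Inst) (c x : ℕ) : ℕ :=
  if c ≤ I.count I.S.length x then
    ∑ p ∈ Finset.range I.S.length, if I.count (p + 1) x < c then 1 else 0
  else I.S.length + ∑ y ∈ Finset.range (min x I.n), (I.k - I.count I.S.length y) +
    (c - 1 - I.count I.S.length x)

/-- The partition of the variables. -/
def Inst.label (I : Inst) : ℕ → ℕ := finalLab I.n I.k I.timeBound I.time

theorem rootCeil_le (n r : ℕ) : rootCeil n r ≤ n := by
  induction r with
  | zero => exact le_rfl
  | succ r ih =>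
    refine le_trans ?_ ih
    rw [rootCeil]
    refine (least_spec _ _).2.2 _ (Nat.lt_succ_self _) ?_
    rcases Nat.eq_zero_or_pos (rootCeil n r) with h | h
    · omega
    · exact Nat.le_mul_of_pos_left _ h

section PT

variable {Γ Δ : Type} [Ctx Γ] [Ctx Δ]

theorem PT.var₁ : PT (fun p : (Γ × ℕ) × ℕ => p.1.2) := PT.snd fun p : (Γ × ℕ) × ℕ => p.1

theorem PT.var₂ : PT (fun p : ((Γ × ℕ) × ℕ) × ℕ => p.1.1.2) :=
  PT.snd fun p : ((Γ × ℕ) × ℕ) × ℕ => p.1.1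

theorem PT.timeBound : PT (fun γ : Γ => (Ctx.base γ).timeBound) := PT.n.mul PT.k

theorem PB.timeBound : PB (fun γ : Γ => (Ctx.base γ).timeBound) := PB.n.mul PB.k

theorem PT.count {f g : Γ → ℕ} (hf : PT f) (hg : PT g) :
    PT fun γ => (Ctx.base γ).count (f γ) (g γ) :=
  PT.sum (hf.min PT.length) (PB.length.mono fun _ => min_le_right _ _)
    (PT.ite (PTP.eq (PT.read PT.var) hg.weak) (PT.const 1) (PT.const 0))

theorem PT.time {f g : Γ → ℕ} (hf : PT f) (hg : PT g) :
    PT fun γ => (Ctx.base γ).time (f γ) (g γ) := by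
  refine PT.ite (PTP.le hf (PT.count PT.length hg)) ?_ ?_
  · exact PT.sum PT.length PB.length (PT.ite (PTP.lt (PT.count (PT.var.add (PT.const 1)) hg.weak)
      hf.weak) (PT.const 1) (PT.const 0))
  · exact (PT.length.add (PT.sum (hg.min PT.n) (PB.n.mono fun γ => min_le_right _ _)
      (PT.k.sub (PT.count PT.length PT.var)))).add
      ((hf.sub (PT.const 1)).sub (PT.count PT.length hg))

/-! ### The partition -/

theorem PT.rank {R : Γ → ℕ → ℕ → Prop} [∀ γ, DecidableRel (R γ)] {q : Γ → ℕ → ℕ}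
    (hR : PTP fun p : (Γ × ℕ) × ℕ => R p.1.1 p.1.2 p.2) (hq : PT fun p : Γ × ℕ => q p.1 p.2) :
    PT fun p : Γ × ℕ =>
      ReadK.rank (Ctx.base p.1).n (R p.1) (q p.1) (Ctx.base p.1).timeBound p.2 := by
  refine PT.iterTable (B := fun γ => (Ctx.base γ).timeBound + 1) (m := fun γ => (Ctx.base γ).n)
    (cnt := fun γ => (Ctx.base γ).timeBound)
    (F := fun γ i => ReadK.rank (Ctx.base γ).n (R γ) (q γ) i)
    (step := fun γ i G => rankStep (Ctx.base γ).n (R γ) (q γ) i G)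
    (PT.timeBound.add (PT.const 1)) PT.n PB.n PT.timeBound PB.timeBound (PT.const 0)
    (fun γ i _ => rfl) ?_ (fun γ i x hx => rank_of_le hx i)
    fun γ i x hi => Nat.lt_succ_of_le ((rank_le i x).trans hi)
  have hB : ∀ {Δ : Type} [Ctx Δ], PT fun δ : Δ => (Ctx.base δ).timeBound + 1 :=
    PT.timeBound.add (PT.const 1)
  unfold rankStep
  refine PT.ite (PTP.and (PTP.lt PT.var PT.n) (PTP.eq (hq.app PT.var) PT.var₂)) ?_
    (PT.entry hB PT.n PB.n PT.var₁ PT.var)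
  exact PT.sup PT.n PB.n (PT.ite (hR.app₂ PT.var PT.var₁)
    ((PT.entry hB PT.n PB.n PT.var₂ PT.var).add (PT.const 1)) (PT.const 0))

theorem PT.refine {lab comp : Γ → ℕ → ℕ} (hl : PT fun p : Γ × ℕ => lab p.1 p.2)
    (hc : PT fun p : Γ × ℕ => comp p.1 p.2) :
    PT fun p : Γ × ℕ => ReadK.refine (Ctx.base p.1).n (lab p.1) (comp p.1) p.2 := by
  refine PT.ite (PTP.lt PT.var PT.n) (PT.least PT.n PB.n ?_) (PT.const 0)
  exact PTP.and (PTP.eq (hl.app PT.var) (hl.app PT.var₁)) (PTP.eq (hc.app PT.var) (hc.app PT.var₁))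

section Mono

variable {lab ext a b : Γ → ℕ → ℕ} {K j : Γ → ℕ}

theorem PTP.monoRel (hl : PT fun p : Γ × ℕ => lab p.1 p.2) (he : PT fun p : Γ × ℕ => ext p.1 p.2)
    (ha : PT fun p : Γ × ℕ => a p.1 p.2) (hb : PT fun p : Γ × ℕ => b p.1 p.2) :
    PTP fun p : (Γ × ℕ) × ℕ =>
      ReadK.monoRel (lab p.1.1) (ext p.1.1) (a p.1.1) (b p.1.1) p.1.2 p.2 := by
  unfold ReadK.monoRel
  exact PTP.and (PTP.eq (hl.app PT.var₁) (hl.app PT.var)) (PTP.and (PTP.eq (he.app PT.var₁)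
    (PT.const 0)) (PTP.and (PTP.eq (he.app PT.var) (PT.const 0)) (PTP.and
      (PTP.lt (ha.app PT.var₁) (ha.app PT.var)) (PTP.lt (hb.app PT.var₁) (hb.app PT.var)))))

theorem PT.monoRank (hl : PT fun p : Γ × ℕ => lab p.1 p.2) (he : PT fun p : Γ × ℕ => ext p.1 p.2)
    (ha : PT fun p : Γ × ℕ => a p.1 p.2) (hb : PT fun p : Γ × ℕ => b p.1 p.2) :
    PT fun p : Γ × ℕ => ReadK.monoRank (Ctx.base p.1).n (Ctx.base p.1).timeBound (lab p.1)
      (ext p.1) (a p.1) (b p.1) p.2 :=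
  PT.rank (R := fun γ => ReadK.monoRel (lab γ) (ext γ) (a γ) (b γ)) (PTP.monoRel hl he ha hb) hb

theorem PT.chainTop (hK : PT K) (hl : PT fun p : Γ × ℕ => lab p.1 p.2)
    (he : PT fun p : Γ × ℕ => ext p.1 p.2) (ha : PT fun p : Γ × ℕ => a p.1 p.2)
    (hb : PT fun p : Γ × ℕ => b p.1 p.2) :
    PT fun γ => ReadK.chainTop (Ctx.base γ).n (Ctx.base γ).timeBound (K γ) (lab γ) (ext γ)
      (a γ) (b γ) :=
  PT.least PT.n PB.n (PTP.and (PTP.eq he (PT.const 0))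
    (PTP.eq ((PT.monoRank hl he ha hb).add (PT.const 1)) hK.weak))

theorem PT.chainElem (hK : PT K) (hl : PT fun p : Γ × ℕ => lab p.1 p.2)
    (he : PT fun p : Γ × ℕ => ext p.1 p.2) (ha : PT fun p : Γ × ℕ => a p.1 p.2)
    (hb : PT fun p : Γ × ℕ => b p.1 p.2) (hj : PT j) (hjb : PB j) :
    PT fun γ => ReadK.chainElem (Ctx.base γ).n (Ctx.base γ).timeBound (K γ) (lab γ) (ext γ)
      (a γ) (b γ) (j γ) := by
  have hle : ∀ (γ : Γ) i, ReadK.chainElem (Ctx.base γ).n (Ctx.base γ).timeBound (K γ) (lab γ)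
      (ext γ) (a γ) (b γ) i ≤ (Ctx.base γ).n := by
    intro γ i
    cases i with
    | zero => exact (least_spec _ _).1
    | succ i => exact (least_spec _ _).1
  refine PT.iter (PT.chainTop hK hl he ha hb) (step := fun γ i c => ReadK.least (fun y =>
      ReadK.monoRel (lab γ) (ext γ) (a γ) (b γ) y c ∧
        ReadK.monoRank (Ctx.base γ).n (Ctx.base γ).timeBound (lab γ) (ext γ) (a γ) (b γ) y + 1 =
        ReadK.monoRank (Ctx.base γ).n (Ctx.base γ).timeBound (lab γ) (ext γ) (a γ) (b γ) c)
      (Ctx.base γ).n) ?_ hj hjb (fun γ => rfl) (fun γ i => rfl) PB.n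
    fun γ i _ => (size_le_self _).trans (hle γ i)
  let F : Γ → ℕ → ℕ := fun γ => ReadK.monoRank (Ctx.base γ).n (Ctx.base γ).timeBound (lab γ) (ext γ)
    (a γ) (b γ)
  have hr : PT fun p : Γ × ℕ => F p.1 p.2 := PT.monoRank hl he ha hb
  exact PT.least PT.n PB.n (PTP.and (PTP.app₂
    (P := fun γ => ReadK.monoRel (lab γ) (ext γ) (a γ) (b γ)) (PTP.monoRel hl he ha hb) PT.var PT.var₁)
    (PTP.eq ((PT.app (F := F) hr PT.var).add (PT.const 1)) (PT.app (F := F) hr PT.var₁)))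

theorem PT.markStep (hK : PT K) (hKb : PB K) (hl : PT fun p : Γ × ℕ => lab p.1 p.2)
    (he : PT fun p : Γ × ℕ => ext p.1 p.2) (ha : PT fun p : Γ × ℕ => a p.1 p.2)
    (hb : PT fun p : Γ × ℕ => b p.1 p.2) (hj : PT j) :
    PT fun p : Γ × ℕ => ReadK.markStep (Ctx.base p.1).n (Ctx.base p.1).timeBound (K p.1) (lab p.1)
      (a p.1) (b p.1) (j p.1) (ext p.1) p.2 := by
  refine PT.ite (PTP.and (PTP.lt PT.var PT.n) (PTP.and (PTP.eq he (PT.const 0)) (PTP.and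
    (PTP.lt (PT.chainTop hK hl he ha hb).weak PT.n) ?_))) (hj.weak.add (PT.const 1)) he
  have hc : PT fun p : Γ × ℕ => ReadK.chainElem (Ctx.base p.1).n (Ctx.base p.1).timeBound (K p.1)
      (lab p.1) (ext p.1) (a p.1) (b p.1) (Min.min p.2 (K p.1)) :=
    PT.chainElem (Γ := Γ × ℕ) (K := fun p => K p.1) (lab := fun p => lab p.1)
      (ext := fun p => ext p.1) (a := fun p => a p.1) (b := fun p => b p.1)
      (j := fun p => Min.min p.2 (K p.1)) hK.weak (hl.app PT.var)
      (he.app PT.var) (ha.app PT.var) (hb.app PT.var)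
      (PT.var.min hK.weak) ((hKb.sub fun p : Γ × ℕ => p.1).mono fun p => min_le_right _ _)
  have := Sub.pair (fun p : (Γ × ℕ) × ℕ => p.1.1) PT.var
  refine (PTP.exists_lt hK.weak (hKb.sub fun p : Γ × ℕ => p.1)
    (P := fun p i => ReadK.chainElem (Ctx.base p.1).n (Ctx.base p.1).timeBound (K p.1)
      (lab p.1) (ext p.1) (a p.1) (b p.1) (Min.min i (K p.1)) = p.2)
    (PTP.eq (hc.comp fun p : (Γ × ℕ) × ℕ => (p.1.1, p.2)) PT.var₁)).of_iff fun p => ?_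
  refine exists_congr fun i => and_congr_right fun hi => ?_
  rw [min_eq_left hi.le]

theorem PT.mark (hK : PT K) (hKb : PB K) (hl : PT fun p : Γ × ℕ => lab p.1 p.2)
    (ha : PT fun p : Γ × ℕ => a p.1 p.2) (hb : PT fun p : Γ × ℕ => b p.1 p.2) :
    PT fun p : Γ × ℕ => ReadK.mark (Ctx.base p.1).n (Ctx.base p.1).timeBound (K p.1) (lab p.1)
      (a p.1) (b p.1) (Ctx.base p.1).n p.2 := by
  refine PT.iterTable (B := fun γ => (Ctx.base γ).n + 1) (m := fun γ => (Ctx.base γ).n)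
    (cnt := fun γ => (Ctx.base γ).n)
    (F := fun γ i => ReadK.mark (Ctx.base γ).n (Ctx.base γ).timeBound (K γ) (lab γ)
      (a γ) (b γ) i)
    (step := fun γ i G => ReadK.markStep (Ctx.base γ).n (Ctx.base γ).timeBound (K γ) (lab γ)
      (a γ) (b γ) i G)
    (PT.n.add (PT.const 1)) PT.n PB.n PT.n PB.n (PT.const 0)
    (fun γ i _ => rfl) ?_ (fun γ i x hx => mark_of_le hx i)
    fun γ i x hi => Nat.lt_succ_of_le ((mark_le i x).trans hi)
  exact PT.markStep (Γ := (Γ × ℕ) × ℕ) (K := fun p => K p.1.1) (lab := fun p => lab p.1.1)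
    (ext := fun p => Ram.entry ((Ctx.base p.1.1).n + 1) (Ctx.base p.1.1).n p.2)
    (a := fun p => a p.1.1) (b := fun p => b p.1.1) (j := fun p => p.1.2)
    (hK.comp fun p : (Γ × ℕ) × ℕ => p.1.1) (hKb.sub fun p : (Γ × ℕ) × ℕ => p.1.1)
    (hl.app PT.var) (PT.entry (PT.n.add (PT.const 1)) PT.n PB.n PT.var₁ PT.var)
    (ha.app PT.var) (hb.app PT.var) PT.var₁

theorem PT.monoComp (hK : PT K) (hKb : PB K) (hl : PT fun p : Γ × ℕ => lab p.1 p.2)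
    (ha : PT fun p : Γ × ℕ => a p.1 p.2) (hb : PT fun p : Γ × ℕ => b p.1 p.2) :
    PT fun p : Γ × ℕ => ReadK.monoComp (Ctx.base p.1).n (Ctx.base p.1).timeBound (K p.1) (lab p.1)
      (a p.1) (b p.1) p.2 :=
  have hm := PT.mark hK hKb hl ha hb
  PT.ite (PTP.eq hm (PT.const 0))
    ((PT.const 2).mul (PT.monoRank (ext := fun γ => ReadK.mark (Ctx.base γ).n
      (Ctx.base γ).timeBound (K γ) (lab γ) (a γ) (b γ) (Ctx.base γ).n) hl hm ha hb))
    (((PT.const 2).mul hm).add (PT.const 1))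

end Mono

theorem PT.rootCeil {f : Γ → ℕ} (hf : PT f) (hfb : PB f) :
    PT fun γ => ReadK.rootCeil (Ctx.base γ).n (f γ) := by
  refine PT.iter (v := fun γ i => ReadK.rootCeil (Ctx.base γ).n i) PT.n
    (step := fun γ i c => ReadK.least (fun s => c ≤ s * s) (Min.min c (Ctx.base γ).n + 1)) ?_ hf hfb
    (fun γ => rfl) (fun γ i => ?_) PB.n fun γ i _ => (size_le_self _).trans (rootCeil_le _ _)
  -- In the step `c` is an arbitrary number, so the search range is capped at `n + 1`; this changes
  -- nothing, because the iterates never exceed `n`.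
  · exact PT.least ((PT.var.min PT.n).add (PT.const 1)) ((PB.n.add (PB.const 1)).mono fun p =>
      Nat.add_le_add_right (min_le_right _ _) 1) (PTP.le PT.var₁ (PT.var.mul PT.var))
  · rw [ReadK.rootCeil, min_eq_left (rootCeil_le _ _)]

theorem monoLab_lt (n N : ℕ) (ρ : ℕ → ℕ → ℕ) (i x : ℕ) :
    (n ≤ x → monoLab n N ρ i x = 0) ∧ monoLab n N ρ i x < n + 1 := by
  rcases i with _ | i
  · exact ⟨fun _ => rfl, Nat.succ_pos _⟩
  · refine ⟨fun hx => refine_of_le hx, ?_⟩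
    rcases lt_or_ge x n with hx | hx
    · exact (refine_lt hx).trans (Nat.lt_succ_self _)
    · rw [monoLab, refine_of_le hx]
      exact Nat.succ_pos _

theorem PT.monoLab : PT fun p : Γ × ℕ => ReadK.monoLab (Ctx.base p.1).n (Ctx.base p.1).timeBound
    (Ctx.base p.1).time ((Ctx.base p.1).k - 1) p.2 := by
  refine PT.iterTable (B := fun γ => (Ctx.base γ).n + 1) (m := fun γ => (Ctx.base γ).n)
    (cnt := fun γ => (Ctx.base γ).k - 1)
    (F := fun γ i => ReadK.monoLab (Ctx.base γ).n (Ctx.base γ).timeBound (Ctx.base γ).time i)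
    (step := fun γ i G => ReadK.refine (Ctx.base γ).n G (ReadK.monoComp (Ctx.base γ).n
      (Ctx.base γ).timeBound (ReadK.rootCeil (Ctx.base γ).n (Min.min i (Ctx.base γ).k + 1)) G
      ((Ctx.base γ).time 1) ((Ctx.base γ).time (i + 2))))
    (PT.n.add (PT.const 1)) PT.n PB.n (PT.k.sub (PT.const 1)) (PB.k.mono fun γ => Nat.sub_le _ _)
    (PT.const 0) (fun γ i hi => ?_) ?_ (fun γ i x hx => (monoLab_lt _ _ _ _ _).1 hx)
    fun γ i x _ => (monoLab_lt _ _ _ _ _).2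
  · rw [ReadK.monoLab, min_eq_left (by omega)]
  · have hl : PT fun p : ((Γ × ℕ) × ℕ) × ℕ =>
        Ram.entry ((Ctx.base p.1.1.1).n + 1) (Ctx.base p.1.1.1).n p.1.2 p.2 :=
      PT.entry (PT.n.add (PT.const 1)) PT.n PB.n PT.var₁ PT.var
    let lab : (Γ × ℕ) × ℕ → ℕ → ℕ := fun p =>
      Ram.entry ((Ctx.base p.1.1).n + 1) (Ctx.base p.1.1).n p.2
    refine PT.refine (lab := lab) (comp := fun p => ReadK.monoComp (Ctx.base p.1.1).n
      (Ctx.base p.1.1).timeBound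
      (ReadK.rootCeil (Ctx.base p.1.1).n (Min.min p.1.2 (Ctx.base p.1.1).k + 1)) (lab p)
      ((Ctx.base p.1.1).time 1) ((Ctx.base p.1.1).time (p.1.2 + 2))) hl ?_
    exact PT.monoComp (lab := lab)
      (K := fun p => ReadK.rootCeil (Ctx.base p.1.1).n (Min.min p.1.2 (Ctx.base p.1.1).k + 1))
      (a := fun p => (Ctx.base p.1.1).time 1) (b := fun p => (Ctx.base p.1.1).time (p.1.2 + 2))
      (PT.rootCeil ((PT.var₁.min PT.k).add (PT.const 1)) ((PB.k.add (PB.const 1)).mono fun p =>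
        Nat.add_le_add_right (min_le_right _ _) 1))
      (PB.n.mono fun p => rootCeil_le _ _) hl (PT.time (PT.const 1) PT.var)
      (PT.time (PT.var₂.add (PT.const 2)) PT.var)

theorem PT.pairLevel {lab a b : Γ → ℕ → ℕ} (hl : PT fun p : Γ × ℕ => lab p.1 p.2)
    (ha : PT fun p : Γ × ℕ => a p.1 p.2) (hb : PT fun p : Γ × ℕ => b p.1 p.2) :
    PT fun p : Γ × ℕ => ReadK.pairLevel (Ctx.base p.1).n (Ctx.base p.1).timeBound (lab p.1)
      (a p.1) (b p.1) p.2 := by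
  refine PT.rank (R := fun γ => pairRel (lab γ) (a γ) (b γ)) ?_ ha
  unfold pairRel
  exact PTP.and (PTP.eq (hl.app PT.var₁) (hl.app PT.var)) (PTP.lt (hb.app PT.var₁) (ha.app PT.var))

theorem pairLab_lt (n k N : ℕ) (ρ : ℕ → ℕ → ℕ) (i x : ℕ) :
    (n ≤ x → pairLab n k N ρ i x = 0) ∧ pairLab n k N ρ i x < n + 1 := by
  rcases i with _ | i
  · exact monoLab_lt n N ρ (k - 1) x
  · refine ⟨fun hx => refine_of_le hx, ?_⟩
    rcases lt_or_ge x n with hx | hx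
    · exact (refine_lt hx).trans (Nat.lt_succ_self _)
    · rw [pairLab, refine_of_le hx]
      exact Nat.succ_pos _

theorem PT.label : PT fun p : Γ × ℕ => (Ctx.base p.1).label p.2 := by
  refine PT.iterTable (B := fun γ => (Ctx.base γ).n + 1) (m := fun γ => (Ctx.base γ).n)
    (cnt := fun γ => (Ctx.base γ).k * (Ctx.base γ).k)
    (F := fun γ i => pairLab (Ctx.base γ).n (Ctx.base γ).k (Ctx.base γ).timeBound
      (Ctx.base γ).time i)
    (step := fun γ i G => ReadK.refine (Ctx.base γ).n G fun x =>
      if i / (Ctx.base γ).k < i % (Ctx.base γ).k then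
        ReadK.pairLevel (Ctx.base γ).n (Ctx.base γ).timeBound G
          ((Ctx.base γ).time (i / (Ctx.base γ).k + 1)) ((Ctx.base γ).time (i % (Ctx.base γ).k + 1))
          x % 2 else 0)
    (PT.n.add (PT.const 1)) PT.n PB.n (PT.k.mul PT.k) (PB.k.mul PB.k)
    PT.monoLab (fun γ i _ => rfl) ?_ (fun γ i x hx => (pairLab_lt _ _ _ _ _ _).1 hx)
    fun γ i x _ => (pairLab_lt _ _ _ _ _ _).2
  have hl : PT fun p : ((Γ × ℕ) × ℕ) × ℕ =>
      Ram.entry ((Ctx.base p.1.1.1).n + 1) (Ctx.base p.1.1.1).n p.1.2 p.2 :=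
    PT.entry (PT.n.add (PT.const 1)) PT.n PB.n PT.var₁ PT.var
  let lab : (Γ × ℕ) × ℕ → ℕ → ℕ := fun p =>
    Ram.entry ((Ctx.base p.1.1).n + 1) (Ctx.base p.1.1).n p.2
  refine PT.refine (lab := lab) (comp := fun p x =>
    if p.1.2 / (Ctx.base p.1.1).k < p.1.2 % (Ctx.base p.1.1).k then
      ReadK.pairLevel (Ctx.base p.1.1).n (Ctx.base p.1.1).timeBound
        (lab p) ((Ctx.base p.1.1).time (p.1.2 / (Ctx.base p.1.1).k + 1))
        ((Ctx.base p.1.1).time (p.1.2 % (Ctx.base p.1.1).k + 1)) x % 2 else 0) hl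
    (PT.ite (PTP.lt (PT.var₂.div PT.k) (PT.var₂.mod PT.k)) ?_ (PT.const 0))
  exact PT.mod (PT.pairLevel (lab := lab)
    (a := fun p => (Ctx.base p.1.1).time (p.1.2 / (Ctx.base p.1.1).k + 1))
    (b := fun p => (Ctx.base p.1.1).time (p.1.2 % (Ctx.base p.1.1).k + 1)) hl
    (PT.time ((PT.var₂.div PT.k).add (PT.const 1)) PT.var)
    (PT.time ((PT.var₂.mod PT.k).add (PT.const 1)) PT.var)) (PT.const 2)

end PT

end Ram

namespace Ram

open ReadK

/-! ### The output bits -/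

/-- The number of levels of the generators. -/
def Inst.levels (I : Inst) : ℕ := Nat.size I.n

/-- The block length of the generators. -/
def Inst.blockLen (I : Inst) : ℕ := 2 * (2 * Nat.size I.n + 13 * I.k * Nat.size (I.w - 1) + I.e)

/-- The seed length of the generators. -/
def Inst.partLen (I : Inst) : ℕ := I.blockLen + 3 * I.blockLen * I.levels

/-- The number of the part of `x`. -/
def Inst.part (I : Inst) (x : ℕ) : ℕ :=
  ∑ z ∈ Finset.range I.n, if z < I.label x ∧ I.label z = z then 1 else 0

/-- The number of the cell of `x` in its part. -/
def Inst.cellIdx (I : Inst) (x : ℕ) : ℕ :=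
  ∑ z ∈ Finset.range I.n, if I.label z = I.label x ∧ I.time 1 z < I.time 1 x then 1 else 0

/-- One level of a generator, for the seed that starts at `o` and the cell `c`, applied to a block
given by its bits. -/
def Inst.levelStep (I : Inst) (o c i : ℕ) (G : ℕ → ℕ) : ℕ → ℕ := fun x =>
  if x < I.blockLen then
    if c / 2 ^ (I.levels - 1 - i) % 2 = 1 then
      (I.bit (o + (I.blockLen + 3 * I.blockLen * i + 2 * I.blockLen + x)) +
        ∑ l ∈ Finset.range I.blockLen,
          I.bit (o + (I.blockLen + 3 * I.blockLen * i + (x + l))) * G l) % 2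
    else G x
  else 0

/-- The bits of the block of the cell `c` after some levels. -/
def Inst.level (I : Inst) (o c : ℕ) : ℕ → ℕ → ℕ
  | 0 => fun x => if x < I.blockLen then I.bit (o + x) else 0
  | i + 1 => I.levelStep o c i (I.level o c i)

/-- The output bit at `x`. -/
def Inst.out (I : Inst) (x : ℕ) : ℕ := I.level (I.part x * I.partLen) (I.cellIdx x) I.levels 0

theorem Inst.level_spec (I : Inst) (o c i x : ℕ) :
    (I.blockLen ≤ x → I.level o c i x = 0) ∧ I.level o c i x < 2 := by
  induction i generalizing x with
  | zero =>
    unfold level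
    have := I.bit_le (o + x)
    split_ifs <;> omega
  | succ i ih =>
    have := ih x
    simp only [level, levelStep]
    split_ifs <;> omega

section PT

variable {Γ Δ : Type} [Ctx Γ] [Ctx Δ]

theorem PT.levels : PT fun γ : Γ => (Ctx.base γ).levels := PT.n.natSize

theorem PB.levels : PB fun γ : Γ => (Ctx.base γ).levels := PB.n.size

theorem PT.blockLen : PT fun γ : Γ => (Ctx.base γ).blockLen :=
  (PT.const 2).mul ((((PT.const 2).mul PT.n.natSize).add (((PT.const 13).mul PT.k).mul
    (PT.w.sub (PT.const 1)).natSize)).add PT.e)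

theorem PB.blockLen : PB fun γ : Γ => (Ctx.base γ).blockLen :=
  (PB.const 2).mul ((((PB.const 2).mul PB.n.size).add (((PB.const 13).mul PB.k).mul
    (PB.size_w.mono fun _ => Nat.size_le_size (Nat.sub_le _ _)))).add PB.e)

theorem PT.partLen : PT fun γ : Γ => (Ctx.base γ).partLen :=
  PT.blockLen.add (((PT.const 3).mul PT.blockLen).mul PT.levels)

theorem PT.part : PT fun p : Γ × ℕ => (Ctx.base p.1).part p.2 := by
  let F : Γ → ℕ → ℕ := fun γ => (Ctx.base γ).label
  have h : PT fun p : Γ × ℕ => F p.1 p.2 := PT.label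
  exact PT.sum PT.n PB.n (PT.ite (PTP.and (PTP.lt PT.var (PT.app (F := F) h PT.var₁))
    (PTP.eq (PT.app (F := F) h PT.var) PT.var)) (PT.const 1) (PT.const 0))

theorem PT.cellIdx : PT fun p : Γ × ℕ => (Ctx.base p.1).cellIdx p.2 := by
  let F : Γ → ℕ → ℕ := fun γ => (Ctx.base γ).label
  have h : PT fun p : Γ × ℕ => F p.1 p.2 := PT.label
  exact PT.sum PT.n PB.n (PT.ite (PTP.and (PTP.eq (PT.app (F := F) h PT.var)
    (PT.app (F := F) h PT.var₁)) (PTP.lt (PT.time (PT.const 1) PT.var)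
      (PT.time (PT.const 1) PT.var₁))) (PT.const 1) (PT.const 0))

theorem PT.level {o c : Γ → ℕ} (ho : PT o) (hc : PT c) : PT fun p : Γ × ℕ =>
    (Ctx.base p.1).level (o p.1) (c p.1) (Ctx.base p.1).levels p.2 := by
  refine PT.iterTable (B := fun _ => 2) (m := fun γ => (Ctx.base γ).blockLen)
    (cnt := fun γ => (Ctx.base γ).levels)
    (F := fun γ i => (Ctx.base γ).level (o γ) (c γ) i)
    (step := fun γ i G => (Ctx.base γ).levelStep (o γ) (c γ) i G)
    (PT.const 2) PT.blockLen PB.blockLen PT.levels PB.levels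
    (PT.ite (PTP.lt PT.var PT.blockLen) (PT.bit (ho.weak.add PT.var)) (PT.const 0))
    (fun γ i _ => rfl) ?_ (fun γ i x hx => (Inst.level_spec _ _ _ _ _).1 hx)
    fun γ i x _ => (Inst.level_spec _ _ _ _ _).2
  have ho3 : PT fun p : ((Γ × ℕ) × ℕ) × ℕ => o p.1.1.1 := ho.comp _
  have hbase : PT fun p : ((Γ × ℕ) × ℕ) × ℕ => (Ctx.base p).blockLen +
      3 * (Ctx.base p).blockLen * p.1.1.2 :=
    PT.blockLen.add (((PT.const 3).mul PT.blockLen).mul PT.var₂)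
  have hpow : PT fun p : ((Γ × ℕ) × ℕ) × ℕ => 2 ^ ((Ctx.base p).levels - 1 - p.1.1.2) :=
    (PT.const 2).pow ((PT.levels.sub (PT.const 1)).sub PT.var₂)
      (PB.levels.mono fun p => by omega)
  have hent : ∀ {Δ : Type} [Ctx Δ] {f g : Δ → ℕ}, PT f → PT g →
      PT fun δ => Ram.entry 2 (Ctx.base δ).blockLen (f δ) (g δ) := fun hf hg =>
    PT.entry (PT.const 2) PT.blockLen PB.blockLen hf hg
  refine PT.ite (PTP.lt PT.var PT.blockLen) (PT.ite (PTP.eq (((hc.comp _).div hpow).mod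
    (PT.const 2)) (PT.const 1)) (PT.mod (PT.add (PT.bit (ho3.add ((hbase.add
      ((PT.const 2).mul PT.blockLen)).add PT.var))) ?_) (PT.const 2)) (hent PT.var₁ PT.var))
    (PT.const 0)
  exact PT.sum PT.blockLen PB.blockLen (PT.mul (PT.bit (ho3.weak.add (hbase.weak.add
    (PT.var₁.add PT.var)))) (hent PT.var₂ PT.var))

theorem PT.out : PT fun p : Γ × ℕ => (Ctx.base p.1).out p.2 := by
  let F : Γ × ℕ → ℕ → ℕ := fun p => (Ctx.base p.1).level
    ((Ctx.base p.1).part p.2 * (Ctx.base p.1).partLen) ((Ctx.base p.1).cellIdx p.2)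
    (Ctx.base p.1).levels
  have h : PT fun p : (Γ × ℕ) × ℕ => F p.1 p.2 :=
    PT.level (Γ := Γ × ℕ) (PT.part.mul PT.partLen) PT.cellIdx
  exact PT.app (F := F) (φ := fun p => p) h (PT.const 0)

end PT

/-! ### The program -/

/-- Variable `6` runs through the output positions and is the one local variable of the context; the
bit is computed from variable `7` on and stored in array `2`, on which the validity of a state does
not depend. -/
theorem exists_program {f : Inst → ℕ → ℕ} (hf : PT fun p : Inst × ℕ => f p.1 p.2) :
    ∃ (prog : Cmd) (e : ℕ), ∀ I : Inst, ∃ σ' T, Exec prog I.state σ' T ∧ T ≤ (I.size + 2) ^ e ∧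
      ∀ x < I.n, σ'.arr 2 x = f I x := by
  obtain ⟨g, p, s, h⟩ := hf
  obtain ⟨c, hc⟩ := h [6] 7 (by simp) (by omega)
  obtain ⟨g', p', h'⟩ := p.extend PB.n
  have hG : ∀ (I : Inst) x, x ≤ I.n → g (I, x) ≤ g' I := fun I x hx =>
    h' I x ((size_le_self x).trans hx)
  let E : Inst → ℕ := fun I => 3 * I.n + 3
  let T : Inst → ℕ := fun I => g' I + ((I.n + 1 + (g' I + 1) + 1) + (2 * I.n + 7))
  have pE : PB E := ((PB.const 3).mul PB.n).add (PB.const 3)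
  have pT : PB T := p'.add ((((PB.n.add (PB.const 1)).add (p'.add (PB.const 1))).add
    (PB.const 1)).add (((PB.const 2).mul PB.n).add (PB.const 7)))
  have pR : PB fun I : Inst => (I.n + 1) * (E I + 1 + T I) :=
    (PB.n.add (PB.const 1)).mul ((pE.add (PB.const 1)).add pT)
  obtain ⟨e, he⟩ := pR
  refine ⟨.loop (.op .sub (.var 0) (.var 6)) (.seq c (.seq (.store 2 (.var 6) (.var 7))
    (.assign 6 (.op .add (.var 6) (.lit 1))))), e, fun I => ?_⟩
  obtain ⟨σ', ⟨t, lt, ex⟩, hInv⟩ := Exec.loop (e := .op .sub (.var 0) (.var 6))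
    (c := .seq c (.seq (.store 2 (.var 6) (.var 7)) (.assign 6 (.op .add (.var 6) (.lit 1)))))
    (m := I.n) (E := E I) (T := T I)
    (Inv := fun i τ => Valid I [] τ ∧ τ.var 6 = i ∧ ∀ x < i, τ.arr 2 x = f I x) (σ := I.state)
    (by
      rintro i hi τ ⟨v, i1, -⟩
      have h0 : τ.var 0 = I.n := v.1 0 (by omega)
      simp only [Expr.eval, Expr.cost, BinOp.eval, h0, i1]
      refine ⟨by omega, ?_⟩
      have := size_le_self I.n
      have := size_le_self i
      have := size_le_self (I.n - i)
      simp only [E]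
      omega)
    (by
      rintro i hi τ ⟨v, i1, i2⟩
      obtain ⟨τ₁, ⟨⟨t₁, ex₁, l₁⟩, a₁, k₁⟩, w₁⟩ := hc (I, i) τ (v.cons i1)
      have w₀ : τ₁.var 6 = i := (k₁ 6 (by omega)).trans i1
      have ex₂ := Exec.store 2 (.var 6) (.var 7) τ₁
      simp only [Expr.eval, Expr.cost, w₀, w₁] at ex₂
      have v₁ : Valid I [] τ₁ := v.frame (b := 7) (by simp) (by omega) a₁ k₁
      generalize hτ₂ : (⟨τ₁.var, Function.update τ₁.arr 2 (Function.update (τ₁.arr 2) i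
        (f (I, i).1 (I, i).2))⟩ : State) = τ₂ at ex₂
      have hv₂ : τ₂.var = τ₁.var := by rw [← hτ₂]
      have ex₃ := Exec.assign 6 (.op .add (.var 6) (.lit 1)) τ₂
      simp only [Expr.eval, Expr.cost, BinOp.eval, hv₂, w₀] at ex₃
      refine ⟨_, ⟨_, ?_, ex₁.seq (ex₂.seq ex₃)⟩, ⟨?_, ?_, ?_, ?_⟩, ?_, ?_⟩
      · have h1 := hG I i hi.le
        have h2 := s (I, i)
        have := size_le_self i
        have := size_le_self (i + 1)
        have := size_le_self 1
        dsimp only [T] at *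
        omega
      · intro x hx
        have hx6 : x ≠ 6 := by omega
        simp only [Function.update_of_ne hx6]
        exact v₁.1 x hx
      · rw [← hτ₂]
        exact v₁.2.1
      · rw [← hτ₂]
        exact v₁.2.2.1
      · rfl
      · simp
      · intro x hx
        simp only [← hτ₂, Function.update_self]
        rcases Nat.lt_succ_iff_lt_or_eq.mp hx with hx | rfl
        · rw [Function.update_of_ne (by omega), a₁, i2 x hx]
        · simp)
    ⟨⟨fun _ _ => rfl, rfl, rfl, rfl⟩, rfl, fun x hx => absurd hx (Nat.not_lt_zero x)⟩
  refine ⟨σ', t, ex, lt.trans ((he I).trans (le_of_eq ?_)), hInv.2.2⟩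
  simp [sz, Ctx.base, Ctx.vals]

end Ram

/-! ### The formula for the reading times agrees with the padded sequence. -/

namespace ReadK

variable {α : Type} [DecidableEq α]

theorem readTime_append_cons (A B : List α) (x : α) :
    readTime (A ++ x :: B) (A.count x + 1) x = A.length := by
  have hlt : A.length < (A ++ x :: B).length := by simp
  have h := readTime_eq (A ++ x :: B) A.length hlt
  have hx : (A ++ x :: B)[A.length] = x := by simp
  rw [hx, List.take_succ_eq_append_getElem hlt, hx] at h
  simpa using h

theorem readTime_append_left (S P : List α) {c : ℕ} {x : α} (hc : c ≤ S.count x) :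
    readTime (S ++ P) c x = readTime S c x := by
  unfold readTime
  rw [List.length_append, Finset.sum_range_add]
  have h : ∀ p ∈ Finset.range P.length,
      (if ((S ++ P).take (S.length + p + 1)).count x < c then 1 else 0) = 0 := by
    intro p _
    rw [if_neg]
    rw [add_assoc, List.take_length_add_append, List.count_append]
    omega
  rw [Finset.sum_eq_zero h, add_zero]
  refine Finset.sum_congr rfl fun p hp => ?_
  rw [Finset.mem_range] at hp
  rw [List.take_append_of_le_length (by omega)]

theorem readTime_lt_length (T : List α) {c : ℕ} {x : α} (h1 : 1 ≤ c) (hc : c ≤ T.count x) :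
    readTime T c x < T.length := by
  have hT : 0 < T.length := by
    have := List.count_le_length (a := x) (l := T)
    omega
  calc readTime T c x < ∑ _p ∈ Finset.range T.length, 1 := by
        refine Finset.sum_lt_sum (fun p _ => by split_ifs <;> omega)
          ⟨T.length - 1, Finset.mem_range.mpr (by omega), ?_⟩
        rw [Nat.sub_add_cancel hT, List.take_length, if_neg (by omega)]
        omega
    _ = _ := by simp

theorem length_eq_of_count {n k : ℕ} {T : List (Fin n)} (hT : ∀ x, T.count x = k) :
    T.length = n * k := by
  rw [← List.sum_toFinset_count_eq_length,
    Finset.sum_subset (Finset.subset_univ _) fun x _ hx => by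
      simpa [List.count_eq_zero] using hx]
  simp [hT]

end ReadK

namespace Ram

open ReadK

theorem Inst.read_eq (I : Inst) {q : ℕ} (hq : q < I.S.length) : I.read q = I.S[q] := by
  simp [Inst.read, hq]

theorem Inst.count_eq (I : Inst) (p : ℕ) (x : Fin I.n) : I.count p x = (I.S.take p).count x := by
  have h : ∀ m ≤ I.S.length, (∑ q ∈ Finset.range m, if I.read q = x then 1 else 0) =
      (I.S.take m).count x := by
    intro m hm
    induction m with
    | zero => simp
    | succ m ih =>
      rw [Finset.sum_range_succ, ih (by omega), List.take_succ_eq_append_getElem (by omega),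
        List.count_append, I.read_eq (by omega), List.count_singleton]
      simp [Fin.ext_iff]
  rw [Inst.count, h _ (min_le_right _ _)]
  rcases le_total p I.S.length with h | h
  · rw [min_eq_left h]
  · rw [min_eq_right h, List.take_of_length_le h, List.take_of_length_le le_rfl]

theorem Inst.count_length (I : Inst) (x : Fin I.n) : I.count I.S.length x = I.S.count x := by
  rw [I.count_eq, List.take_length]

theorem Inst.length_pad (I : Inst) {m : ℕ} (hm : m ≤ I.n) :
    (((List.finRange I.n).take m).flatMap
      fun x => List.replicate (I.k - I.S.count x) x).length =
      ∑ y ∈ Finset.range m, (I.k - I.count I.S.length y) := by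
  induction m with
  | zero => simp
  | succ m ih =>
    rw [Finset.sum_range_succ, List.take_succ_eq_append_getElem (by simpa using hm),
      List.flatMap_append, List.length_append, ih (by omega)]
    have := I.count_length ⟨m, by omega⟩
    simp only at this
    simp [this]

/-- Reads inside `S` keep their positions. The padding treats the variables in increasing order, so
a later read of `x` comes after `S`, the padding of all smaller variables and the earlier padding
reads of `x`. -/
theorem Inst.time_eq (I : Inst) {c : ℕ} (hc : 1 ≤ c) (hck : c ≤ I.k) (x : Fin I.n) :
    I.time c x = readTime (padReads I.k I.S) c x := by
  unfold Inst.time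
  rw [I.count_length]
  split_ifs with h
  · rw [padReads, readTime_append_left _ _ h, readTime]
    refine Finset.sum_congr rfl fun p _ => ?_
    rw [I.count_eq]
  · have hsplit : List.finRange I.n = (List.finRange I.n).take x ++ x ::
        (List.finRange I.n).drop (x + 1) := by
      have h1 := (List.take_append_drop (x : ℕ) (List.finRange I.n)).symm
      rwa [List.drop_eq_getElem_cons (by simp), List.getElem_finRange] at h1
    have hrep : List.replicate (I.k - I.S.count x) x =
        List.replicate (c - 1 - I.S.count x) x ++ x :: List.replicate (I.k - c) x := by
      rw [← List.replicate_succ, List.replicate_append_replicate]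
      congr 1
      omega
    set A := I.S ++ (((List.finRange I.n).take x).flatMap
      fun x => List.replicate (I.k - I.S.count x) x) ++ List.replicate (c - 1 - I.S.count x) x with hA
    have hT : padReads I.k I.S = A ++ x :: (List.replicate (I.k - c) x ++
        ((List.finRange I.n).drop (x + 1)).flatMap
          fun x => List.replicate (I.k - I.S.count x) x) := by
      rw [padReads]
      nth_rewrite 1 [hsplit]
      rw [List.flatMap_append, List.flatMap_cons, hrep, hA]
      simp only [List.append_assoc, List.cons_append]
    have hAc : A.count x + 1 = c := by
      rw [hA, List.count_append, List.count_append, List.count_replicate_self,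
        List.count_eq_zero_of_not_mem (l := List.flatMap _ _)]
      · omega
      · rw [List.mem_flatMap]
        rintro ⟨y, hy, hxy⟩
        have hxy' := List.eq_of_mem_replicate hxy
        subst hxy'
        rw [List.mem_take_iff_getElem] at hy
        obtain ⟨i, hi, hiy⟩ := hy
        rw [List.getElem_finRange] at hiy
        have := congrArg Fin.val hiy
        simp at this
        omega
    have := readTime_append_cons A (List.replicate (I.k - c) x ++
        ((List.finRange I.n).drop (x + 1)).flatMap
          fun x => List.replicate (I.k - I.S.count x) x) x
    rw [hAc, ← hT] at this
    rw [this, hA, List.length_append, List.length_append, I.length_pad x.2.le,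
      min_eq_left x.2.le, List.length_replicate]

theorem Inst.isTimes (I : Inst) : IsTimes I.n I.k I.timeBound I.time := by
  have hT := count_padReads I.S I.count_le
  refine ⟨fun c x h1 h2 hx => ?_, fun c d x h1 h2 h3 hx => ?_, fun c x y h1 h2 hx hy h => ?_⟩
  · have := readTime_lt_length (padReads I.k I.S) (x := ⟨x, hx⟩) h1 (by rw [hT]; exact h2)
    rwa [length_eq_of_count hT, ← I.time_eq h1 h2] at this
  · have := readTime_lt_readTime (padReads I.k I.S) (x := ⟨x, hx⟩) h1 h2 (by rw [hT]; exact h3)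
    rwa [← I.time_eq h1 (by omega), ← I.time_eq (by omega) h3] at this
  · have h' : readTime (padReads I.k I.S) c ⟨x, hx⟩ = readTime (padReads I.k I.S) c ⟨y, hy⟩ := by
      rw [← I.time_eq h1 h2, ← I.time_eq h1 h2]
      exact h
    have := readTime_injective (padReads I.k I.S) ((mem_reads _ _ _).mpr ⟨h1, by rw [hT]; exact h2⟩)
      ((mem_reads _ _ _).mpr ⟨h1, by rw [hT]; exact h2⟩) h'
    exact congrArg Fin.val this.1

/-- Each class of the partition is regular. -/
theorem Inst.regularClass (I : Inst) (hk : 1 ≤ I.k) (x₀ : Fin I.n) (q : Fin I.n → Bool)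
    (hq : ∀ x, q x = true → I.label x = I.label x₀) :
    RegularClass I.k (padReads I.k I.S) q := by
  have ht := I.isTimes
  refine ⟨fun c h1 h2 => ?_, fun i j h1 h2 h3 => ?_⟩
  · rcases pairLab_mono ht (I.k * I.k) x₀ x₀.2 c h1 h2 with h | h
    · left
      intro x y hx hy hxy
      rw [← I.time_eq le_rfl hk, ← I.time_eq le_rfl hk] at hxy
      rw [← I.time_eq h1 h2, ← I.time_eq h1 h2]
      exact h x y x.2 y.2 (hq x hx) (hq y hy) hxy
    · right
      intro x y hx hy hxy
      rw [← I.time_eq le_rfl hk, ← I.time_eq le_rfl hk] at hxy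
      rw [← I.time_eq h1 h2, ← I.time_eq h1 h2]
      exact h x y x.2 y.2 (hq x hx) (hq y hy) hxy
  · obtain ⟨lev, h⟩ := finalLab_level ht x₀ x₀.2 i j h1 h2 h3
    refine ⟨fun x => lev x, fun x y hx hy => ?_⟩
    have := h x y x.2 y.2 (hq x hx) (hq y hy)
    simp only [I.time_eq h1 (by omega : i ≤ I.k), I.time_eq (by omega : 1 ≤ j) h3] at this
    exact this

/-! ### The output bits are those of the generators -/

theorem bool_toNat_add (a b : Bool) : (a + b).toNat = (a.toNat + b.toNat) % 2 := by
  cases a <;> cases b <;> rfl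

theorem bool_toNat_mul (a b : Bool) : (a * b).toNat = a.toNat * b.toNat := by
  cases a <;> cases b <;> rfl

theorem bool_toNat_sum {M : ℕ} (f : Fin M → Bool) :
    (∑ l, f l).toNat = (∑ l, (f l).toNat) % 2 := by
  induction M with
  | zero => rfl
  | succ M ih => rw [Fin.sum_univ_succ, Fin.sum_univ_succ, bool_toNat_add, ih, Nat.add_mod_mod]

theorem toNat_toeplitzHash {M : ℕ} (h : (Fin (2 * M) → Bool) × (Fin M → Bool)) (x : Fin M → Bool)
    (j : Fin M) (a b G : ℕ → ℕ) (ha : ∀ i : Fin (2 * M), (h.1 i).toNat = a i)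
    (hb : ∀ i : Fin M, (h.2 i).toNat = b i) (hG : ∀ i : Fin M, (x i).toNat = G i) :
    (toeplitzHash h x j).toNat = (b j + ∑ l ∈ Finset.range M, a (j + l) * G l) % 2 := by
  unfold toeplitzHash
  rw [bool_toNat_add, bool_toNat_sum, Nat.add_mod_mod, hb, Finset.sum_range]
  simp only [bool_toNat_mul, ha, hG]

/-- Restricting the seed to the block that starts at `o`. -/
theorem Inst.level_eq (I : Inst) (o c : ℕ) (y : Fin I.partLen → Bool)
    (hy : ∀ j : Fin I.partLen, (y j).toNat = I.bit (o + j)) (x : Fin I.blockLen) :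
    I.level o c I.levels x = (genSeed I.blockLen I.levels y c x).toNat := by
  have hbit : ∀ j, j < I.partLen → (seedBit y j).toNat = I.bit (o + j) := fun j hj => by
    rw [seedBit, dif_pos hj, hy]
  -- After `i` levels the block is that of the ancestor `c / 2 ^ (levels - i)` of the cell, so the
  -- levels use the binary digits of `c` from the top down.
  have key : ∀ i, i ≤ I.levels → ∀ x : Fin I.blockLen, I.level o c i x =
      (genBlock i (fun i' : Fin i => (fun j : Fin (2 * I.blockLen) =>
          seedBit y (I.blockLen + 3 * I.blockLen * i' + j),
        fun j : Fin I.blockLen =>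
          seedBit y (I.blockLen + 3 * I.blockLen * i' + 2 * I.blockLen + j)))
        (fun j => seedBit y j) (c / 2 ^ (I.levels - i)) x).toNat := by
    intro i
    induction i with
    | zero =>
      intro _ x
      simp only [Inst.level, genBlock, x.2, if_true]
      rw [hbit _ (lt_of_lt_of_le x.2 (Nat.le_add_right _ _))]
    | succ i ih =>
      intro hi x
      have hlen : ∀ j, j < 3 * I.blockLen → I.blockLen + 3 * I.blockLen * i + j < I.partLen := by
        intro j hj
        have : 3 * I.blockLen * (i + 1) ≤ 3 * I.blockLen * I.levels := Nat.mul_le_mul_left _ hi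
        unfold Inst.partLen
        rw [mul_add] at this
        omega
      have ih' := ih (by omega)
      have hdiv : c / 2 ^ (I.levels - (i + 1)) / 2 = c / 2 ^ (I.levels - i) := by
        rw [Nat.div_div_eq_div_mul, ← pow_succ]
        congr 2
        omega
      simp only [Inst.level, Inst.levelStep, genBlock, x.2, if_true, hdiv,
        show I.levels - 1 - i = I.levels - (i + 1) by omega]
      split_ifs with hc
      · rw [toNat_toeplitzHash _ _ x (fun l => I.bit (o + (I.blockLen + 3 * I.blockLen * i + l)))
          (fun l => I.bit (o + (I.blockLen + 3 * I.blockLen * i + 2 * I.blockLen + l)))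
          (I.level o c i)]
        · intro l
          exact hbit _ (hlen _ (by omega))
        · intro l
          have := hbit (I.blockLen + 3 * I.blockLen * i + 2 * I.blockLen + l) (by
            have := hlen (2 * I.blockLen + l) (by omega)
            omega)
          exact this
        · intro l
          exact (ih' l).symm
      · exact ih' x
  have := key I.levels le_rfl x
  rw [Nat.sub_self, pow_zero, Nat.div_one] at this
  exact this

end Ram

namespace ReadK

/-! ### Positions in a finite set -/

theorem card_filter_lt_lt {s : Finset ℕ} {f : ℕ → ℕ} {a b : ℕ} (ha : a ∈ s) (hab : f a < f b) :
    (s.filter fun z => f z < f a).card < (s.filter fun z => f z < f b).card := by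
  refine Finset.card_lt_card (Finset.ssubset_iff_of_subset ?_ |>.mpr ⟨a, ?_, ?_⟩)
  · intro z hz
    rw [Finset.mem_filter] at hz ⊢
    exact ⟨hz.1, hz.2.trans hab⟩
  · exact Finset.mem_filter.mpr ⟨ha, hab⟩
  · simp

theorem card_filter_lt_card {s : Finset ℕ} {f : ℕ → ℕ} {a : ℕ} (ha : a ∈ s) :
    (s.filter fun z => f z < f a).card < s.card := by
  refine Finset.card_lt_card (Finset.ssubset_iff_of_subset (Finset.filter_subset _ _) |>.mpr
    ⟨a, ha, by simp⟩)

end ReadK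

/-! ### The classes as an ordered partition of the variables. -/

namespace Ram

open ReadK

variable (I : Inst)

/-- The number of parts. -/
def Inst.numParts : ℕ := numClasses I.n I.label

/-- The least elements of the parts. -/
def Inst.leaders : Finset ℕ := (Finset.range I.n).filter fun z => I.label z = z

theorem Inst.part_eq (x : ℕ) : I.part x = (I.leaders.filter fun z => z < I.label x).card := by
  rw [Inst.part, Inst.leaders, Finset.filter_filter, Finset.card_filter]
  exact Finset.sum_congr rfl fun z _ => if_congr and_comm rfl rfl

theorem Inst.cellIdx_eq (x : ℕ) : I.cellIdx x =
    (((Finset.range I.n).filter fun z => I.label z = I.label x).filter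
      fun z => I.time 1 z < I.time 1 x).card := by
  rw [Inst.cellIdx, Finset.filter_filter, Finset.card_filter]

variable {I}

theorem Inst.label_mem_leaders (hk : 1 ≤ I.k) {x : ℕ} (hx : x < I.n) : I.label x ∈ I.leaders := by
  obtain ⟨h1, h2⟩ := finalLab_isLabelling (N := I.timeBound) (ρ := I.time) hk x hx
  exact Finset.mem_filter.mpr ⟨Finset.mem_range.mpr (h1.trans_lt hx), h2⟩

theorem Inst.card_leaders (hk : 1 ≤ I.k) : I.leaders.card = I.numParts := by
  rw [Inst.numParts, numClasses]
  congr 1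
  ext z
  rw [Finset.mem_image]
  constructor
  · intro hz
    obtain ⟨h1, h2⟩ := Finset.mem_filter.mp hz
    exact ⟨z, h1, h2⟩
  · rintro ⟨x, hx, rfl⟩
    exact Inst.label_mem_leaders hk (Finset.mem_range.mp hx)

theorem Inst.part_lt (hk : 1 ≤ I.k) {x : ℕ} (hx : x < I.n) : I.part x < I.numParts := by
  rw [I.part_eq, ← Inst.card_leaders hk]
  exact card_filter_lt_card (f := fun z => z) (Inst.label_mem_leaders hk hx)

theorem Inst.label_eq_of_part_eq (hk : 1 ≤ I.k) {x y : ℕ} (hx : x < I.n) (hy : y < I.n)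
    (h : I.part x = I.part y) : I.label x = I.label y := by
  rw [I.part_eq, I.part_eq] at h
  rcases lt_trichotomy (I.label x) (I.label y) with hlt | heq | hlt
  · exact absurd h (card_filter_lt_lt (f := fun z => z) (Inst.label_mem_leaders hk hx) hlt).ne
  · exact heq
  · exact absurd h (card_filter_lt_lt (f := fun z => z) (Inst.label_mem_leaders hk hy) hlt).ne'

theorem Inst.part_eq_of_label_eq {x y : ℕ} (h : I.label x = I.label y) :
    I.part x = I.part y := by
  rw [I.part_eq, I.part_eq, h]

theorem Inst.exists_part_eq (hk : 1 ≤ I.k) {i : ℕ} (hi : i < I.numParts) :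
    ∃ x < I.n, I.part x = i := by
  have hl : ∀ z ∈ I.leaders, z < I.n ∧ I.label z = z := fun z hz => by
    obtain ⟨h1, h2⟩ := Finset.mem_filter.mp hz
    exact ⟨Finset.mem_range.mp h1, h2⟩
  have himage : I.leaders.image I.part = Finset.range I.numParts := by
    refine Finset.eq_of_subset_of_card_le (fun p hp => ?_) ?_
    · obtain ⟨z, hz, rfl⟩ := Finset.mem_image.mp hp
      exact Finset.mem_range.mpr (Inst.part_lt hk (hl z hz).1)
    · rw [Finset.card_image_of_injOn, Finset.card_range, Inst.card_leaders hk]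
      intro z hz z' hz' h
      have := Inst.label_eq_of_part_eq hk (hl z hz).1 (hl z' hz').1 h
      rwa [(hl z hz).2, (hl z' hz').2] at this
  obtain ⟨z, hz, h⟩ := Finset.mem_image.mp (himage ▸ Finset.mem_range.mpr hi)
  exact ⟨z, (hl z hz).1, h⟩

variable (I) in
/-- The elements of a part. -/
def Inst.members (i : ℕ) : Finset ℕ := (Finset.range I.n).filter fun x => I.part x = i

theorem Inst.members_part (hk : 1 ≤ I.k) {x : ℕ} (hx : x < I.n) :
    I.members (I.part x) = (Finset.range I.n).filter fun z => I.label z = I.label x := by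
  refine Finset.filter_congr fun z hz => ⟨fun h => ?_, Inst.part_eq_of_label_eq⟩
  exact Inst.label_eq_of_part_eq hk (Finset.mem_range.mp hz) hx h

theorem Inst.cellIdx_eq_members (hk : 1 ≤ I.k) {x : ℕ} (hx : x < I.n) : I.cellIdx x =
    ((I.members (I.part x)).filter fun z => I.time 1 z < I.time 1 x).card := by
  rw [I.cellIdx_eq, Inst.members_part hk hx]

theorem Inst.mem_members {x : ℕ} (hx : x < I.n) : x ∈ I.members (I.part x) :=
  Finset.mem_filter.mpr ⟨Finset.mem_range.mpr hx, rfl⟩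

theorem Inst.cellIdx_lt (hk : 1 ≤ I.k) {x : ℕ} (hx : x < I.n) :
    I.cellIdx x < (I.members (I.part x)).card := by
  rw [Inst.cellIdx_eq_members hk hx]
  exact card_filter_lt_card (Inst.mem_members hx)

theorem Inst.cellIdx_lt_cellIdx (hk : 1 ≤ I.k) {x y : ℕ} (hx : x < I.n) (hy : y < I.n)
    (h : I.part x = I.part y) (hxy : I.time 1 x < I.time 1 y) : I.cellIdx x < I.cellIdx y := by
  rw [Inst.cellIdx_eq_members hk hx, Inst.cellIdx_eq_members hk hy, ← h]
  exact card_filter_lt_lt (Inst.mem_members hx) hxy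

theorem Inst.time_lt_of_cellIdx_lt (hk : 1 ≤ I.k) {x y : ℕ} (hx : x < I.n) (hy : y < I.n)
    (h : I.part x = I.part y) (hxy : I.cellIdx x < I.cellIdx y) : I.time 1 x < I.time 1 y := by
  by_contra hcon
  rcases (not_lt.mp hcon).lt_or_eq with hlt | heq
  · exact absurd (Inst.cellIdx_lt_cellIdx hk hy hx h.symm hlt) (by omega)
  · rw [I.isTimes.inj 1 x y le_rfl hk hx hy heq.symm] at hxy
    omega

theorem Inst.sum_card_members (hk : 1 ≤ I.k) :
    ∑ i : Fin I.numParts, (I.members i).card = I.n := by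
  rw [← Finset.sum_range fun i => (I.members i).card]
  have := Finset.card_eq_sum_card_fiberwise (s := Finset.range I.n) (f := I.part)
    (t := Finset.range I.numParts) (fun x hx => by
      have := Finset.mem_range.mp hx
      simpa using Inst.part_lt hk this)
  rw [Finset.card_range] at this
  exact this.symm

/-- The part of an element and its cell in the part. -/
def Inst.locate (hk : 1 ≤ I.k) (x : Fin I.n) :
    Σ i : Fin I.numParts, Fin (I.members i).card :=
  ⟨⟨I.part x, Inst.part_lt hk x.2⟩, ⟨I.cellIdx x, Inst.cellIdx_lt hk x.2⟩⟩

theorem Inst.locate_bijective (hk : 1 ≤ I.k) : Function.Bijective (Inst.locate (I := I) hk) := by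
  rw [Fintype.bijective_iff_injective_and_card]
  refine ⟨fun x y h => ?_, ?_⟩
  · have h1 : I.part x = I.part y := congrArg (fun p => p.1.1) h
    have h2 : I.cellIdx x = I.cellIdx y := congrArg (fun p => p.2.1) h
    refine Fin.ext (I.isTimes.inj 1 x y le_rfl hk x.2 y.2 ?_)
    rcases lt_trichotomy (I.time 1 x) (I.time 1 y) with hlt | heq | hlt
    · exact absurd (Inst.cellIdx_lt_cellIdx hk x.2 y.2 h1 hlt) (by omega)
    · exact heq
    · exact absurd (Inst.cellIdx_lt_cellIdx hk y.2 x.2 h1.symm hlt) (by omega)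
  · rw [Fintype.card_fin, Fintype.card_sigma]
    simp only [Fintype.card_fin]
    exact (Inst.sum_card_members hk).symm

/-- The partition of the variables. -/
noncomputable def Inst.partition (hk : 1 ≤ I.k) : OrderedPartition I.n I.numParts where
  size i := (I.members i).card
  size_pos i := by
    obtain ⟨x, hx, h⟩ := Inst.exists_part_eq hk i.2
    exact Finset.card_pos.mpr ⟨x, h ▸ Inst.mem_members hx⟩
  cell := (Equiv.ofBijective _ (Inst.locate_bijective hk)).symm

theorem Inst.partition_symm (hk : 1 ≤ I.k) (x : Fin I.n) :
    (Inst.partition hk).cell.symm x = Inst.locate hk x := rfl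

theorem Inst.locate_cell (hk : 1 ≤ I.k) (i : Fin I.numParts) (a : Fin ((Inst.partition hk).size i)) :
    Inst.locate hk ((Inst.partition hk).cell ⟨i, a⟩) = ⟨i, a⟩ := by
  rw [← Inst.partition_symm]
  exact Equiv.symm_apply_apply _ _

theorem Inst.part_cell (hk : 1 ≤ I.k) (i : Fin I.numParts) (a : Fin ((Inst.partition hk).size i)) :
    I.part ((Inst.partition hk).cell ⟨i, a⟩) = i :=
  congrArg (fun p => p.1.1) (Inst.locate_cell hk i a)

theorem Inst.cellIdx_cell (hk : 1 ≤ I.k) (i : Fin I.numParts)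
    (a : Fin ((Inst.partition hk).size i)) :
    I.cellIdx ((Inst.partition hk).cell ⟨i, a⟩) = a :=
  congrArg (fun p => p.2.1) (Inst.locate_cell hk i a)

theorem Inst.readTime_cell_lt (hk : 1 ≤ I.k) (i : Fin I.numParts)
    (a b : Fin ((Inst.partition hk).size i)) (hab : a < b) :
    readTime (padReads I.k I.S) 1 ((Inst.partition hk).cell ⟨i, a⟩) <
      readTime (padReads I.k I.S) 1 ((Inst.partition hk).cell ⟨i, b⟩) := by
  rw [← I.time_eq le_rfl hk, ← I.time_eq le_rfl hk]
  refine Inst.time_lt_of_cellIdx_lt hk (Fin.is_lt _) (Fin.is_lt _) ?_ ?_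
  · rw [Inst.part_cell, Inst.part_cell]
  · rw [Inst.cellIdx_cell, Inst.cellIdx_cell]
    exact hab

theorem Inst.firstReadLT_cell (hk : 1 ≤ I.k) (i : Fin I.numParts)
    (a b : Fin ((Inst.partition hk).size i)) (hab : a < b) :
    FirstReadLT (padReads I.k I.S) ((Inst.partition hk).cell ⟨i, a⟩)
      ((Inst.partition hk).cell ⟨i, b⟩) := by
  have hmem : ∀ x, x ∈ padReads I.k I.S := fun x => by
    rw [← List.count_pos_iff, count_padReads I.S I.count_le]
    exact hk
  have := Inst.readTime_cell_lt hk i a b hab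
  rwa [readTime_one _ (hmem _), readTime_one _ (hmem _)] at this

theorem Inst.regularClass_part (hk : 1 ≤ I.k) (i : Fin I.numParts) :
    RegularClass I.k (padReads I.k I.S)
      fun x => decide (((Inst.partition hk).cell.symm x).1 = i) := by
  obtain ⟨x₀, hx₀, h⟩ := Inst.exists_part_eq hk i.2
  refine I.regularClass hk ⟨x₀, hx₀⟩ _ fun x hx => ?_
  have h1 := of_decide_eq_true hx
  rw [Inst.partition_symm] at h1
  have h2 : I.part x = i := congrArg Fin.val h1
  exact Inst.label_eq_of_part_eq hk x.2 hx₀ (h2.trans h.symm)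

/-- Padding only appends reads, so a walk for the padded sequence on the part also serves `S`. -/
theorem Inst.headVisits_part (hk : 1 ≤ I.k) (i : Fin I.numParts) :
    HeadVisitsAtMost (2 * I.k) (I.S.filterMap ((Inst.partition hk).cellIn i)) := by
  have hT := count_padReads I.S I.count_le
  refine headVisits_sublist ((Inst.regularClass_part hk i).headVisits hT
    (fun a => (Inst.partition hk).cell ⟨i, a⟩) (fun a => ?_)
    (fun a b hab => Inst.readTime_cell_lt hk i a b hab) ((Inst.partition hk).cellIn i)
    fun x a => ⟨fun h => ?_, fun h => ?_⟩) ?_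
  · rw [Equiv.symm_apply_apply]
    exact decide_eq_true rfl
  · obtain ⟨⟨j, b⟩, rfl⟩ := (Inst.partition hk).cell.surjective x
    by_cases hij : j = i
    · subst hij
      rw [OrderedPartition.cellIn_cell, Option.some.injEq] at h
      rw [h]
    · rw [OrderedPartition.cellIn_eq_none _ _ _ _ hij] at h
      exact absurd h (by simp)
  · rw [h, OrderedPartition.cellIn_cell]
  · exact (List.sublist_append_left _ _).filterMap _

end Ram

namespace Ram

open ReadK

/-! ### Parameters -/

theorem size_le_log {n : ℕ} (hn : 2 ≤ n) : (Nat.size n : ℝ) ≤ 3 * Real.log n := by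
  have h2 : Real.log 2 ≤ Real.log n := Real.log_le_log (by norm_num) (by exact_mod_cast hn)
  have hpos : 0 < Nat.size n := Nat.size_pos.mpr (by omega)
  have h1 : 2 ^ (Nat.size n - 1) ≤ n := Nat.lt_size.mp (by omega)
  have h3 : ((Nat.size n - 1 : ℕ) : ℝ) * Real.log 2 ≤ Real.log n := by
    rw [← Real.log_pow]
    exact Real.log_le_log (by positivity) (by exact_mod_cast h1)
  rw [Nat.cast_sub hpos, Nat.cast_one] at h3
  have := Real.log_two_gt_d9
  nlinarith

/-- Taking the length of `w - 1` rather than of `w` makes the left side zero at `w = 1`, where the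
logarithm vanishes. -/
theorem size_pred_le_log {w : ℕ} (hw : 1 ≤ w) : (Nat.size (w - 1) : ℝ) ≤ 3 * Real.log w := by
  rcases hw.eq_or_lt with rfl | hw
  · simp
  · refine le_trans ?_ (size_le_log hw)
    exact_mod_cast Nat.size_le_size (Nat.sub_le w 1)

theorem ceil_logb_le {ε L : ℝ} (hε : 0 < ε) (hε1 : ε ≤ 1) (hL : Real.log 2 ≤ L) :
    ((⌈Real.logb 2 (1 / ε)⌉₊ : ℕ) : ℝ) ≤ 2 * Real.log (1 / ε) + 2 * L := by
  have h0 : 0 ≤ Real.log (1 / ε) := Real.log_nonneg (by rw [le_div_iff₀ hε]; linarith)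
  have h2 := Real.log_two_gt_d9
  have h1 : Real.logb 2 (1 / ε) ≤ 2 * Real.log (1 / ε) := by
    rw [Real.logb, div_le_iff₀ (by linarith)]
    nlinarith
  have h3 : 0 ≤ Real.logb 2 (1 / ε) := div_nonneg h0 (by linarith)
  have := Nat.ceil_lt_add_one h3
  linarith

theorem inv_two_pow_ceil_le {ε : ℝ} (hε : 0 < ε) :
    1 / (2 : ℝ) ^ ⌈Real.logb 2 (1 / ε)⌉₊ ≤ ε := by
  have h1 : 1 / ε ≤ (2 : ℝ) ^ ⌈Real.logb 2 (1 / ε)⌉₊ := by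
    rw [← Real.rpow_natCast, ← Real.logb_le_iff_le_rpow (by norm_num) (by positivity)]
    exact Nat.le_ceil _
  rw [div_le_iff₀ (by positivity)]
  rwa [div_le_iff₀ hε, mul_comm] at h1

variable {I : Inst}

/-- The block length is at most `78` times the second logarithmic factor, and `1 + 3 * size n ≤ 4 *
size n` is at most `12 * log n`; the product `78 * 12` is below `1000`. -/
theorem Inst.partLen_le {ε : ℝ} (hn : 2 ≤ I.n) (hw : 1 ≤ I.w) (hε : 0 < ε) (hε1 : ε ≤ 1)
    (he : I.e = ⌈Real.logb 2 (1 / ε)⌉₊) :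
    (I.partLen : ℝ) ≤
      1000 * (Real.log I.n * (Real.log (I.n / ε) + I.k * Real.log I.w)) := by
  have hn0 : (0 : ℝ) < I.n := by exact_mod_cast (by omega : 0 < I.n)
  have h2 : Real.log 2 ≤ Real.log I.n := Real.log_le_log (by norm_num) (by exact_mod_cast hn)
  have h2' := Real.log_two_gt_d9
  have hsplit : Real.log (I.n / ε) = Real.log I.n + Real.log (1 / ε) := by
    rw [← Real.log_mul hn0.ne' (by positivity), mul_one_div]
  have hL : 0 ≤ Real.log (1 / ε) := Real.log_nonneg (by rw [le_div_iff₀ hε]; linarith)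
  have hw0 : 0 ≤ Real.log I.w := Real.log_nonneg (by exact_mod_cast hw)
  have hd := size_le_log hn
  have hs := size_pred_le_log hw
  have hE := ceil_logb_le hε hε1 h2
  rw [← he] at hE
  have hd1 : (1 : ℝ) ≤ Nat.size I.n := by
    exact_mod_cast Nat.size_pos.mpr (by omega : 0 < I.n)
  have hk0 : (0 : ℝ) ≤ I.k := Nat.cast_nonneg _
  have hM : (I.blockLen : ℝ) ≤ 78 * (Real.log (I.n / ε) + I.k * Real.log I.w) := by
    have h3 : (I.k : ℝ) * Nat.size (I.w - 1) ≤ I.k * (3 * Real.log I.w) :=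
      mul_le_mul_of_nonneg_left hs hk0
    rw [Inst.blockLen, hsplit]
    push_cast
    nlinarith
  have hM0 : (0 : ℝ) ≤ I.blockLen := Nat.cast_nonneg _
  have hlen : (I.partLen : ℝ) = I.blockLen * (1 + 3 * Nat.size I.n) := by
    rw [Inst.partLen, Inst.levels]
    push_cast
    ring
  rw [hlen]
  calc (I.blockLen : ℝ) * (1 + 3 * Nat.size I.n)
      ≤ (78 * (Real.log (I.n / ε) + I.k * Real.log I.w)) * (12 * Real.log I.n) :=
        mul_le_mul hM (by linarith) (by positivity) (hM0.trans hM)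
    _ ≤ _ := by
        have h4 : 0 ≤ Real.log I.n * (Real.log (I.n / ε) + I.k * Real.log I.w) := by
          rw [hsplit]
          positivity
        nlinarith

theorem Inst.blockLen_pos (hn : 2 ≤ I.n) : 0 < I.blockLen := by
  have : 0 < Nat.size I.n := Nat.size_pos.mpr (by omega)
  unfold Inst.blockLen
  omega

/-- The block length is chosen so that the square root of `2 ^ blockLen` splits into four factors:
one cancels the `2 ^ levels` replacements, one is at least `n`, one is at least `w ^ (12 * k + 1)`
because `w ≤ 2 ^ size (w - 1)` and `12 * k + 1 ≤ 13 * k`, and one is at least `1 / ε`. -/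
theorem Inst.error_le {ε : ℝ} (hn : 2 ≤ I.n) (hk : 1 ≤ I.k) (hε : 0 < ε)
    (he : I.e = ⌈Real.logb 2 (1 / ε)⌉₊) :
    (2 : ℝ) ^ I.levels * ((I.w : ℝ) ^ (6 * (2 * I.k) + 1) * (1 / Real.sqrt (2 ^ I.blockLen))) ≤
      ε / I.n := by
  have hn0 : (0 : ℝ) < I.n := by exact_mod_cast (by omega : 0 < I.n)
  set s := Nat.size (I.w - 1) with hs
  have hsqrt : Real.sqrt (2 ^ I.blockLen) =
      2 ^ I.levels * (2 ^ I.levels * (2 ^ (13 * I.k * s) * 2 ^ I.e)) := by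
    rw [Inst.blockLen, pow_mul', Real.sqrt_sq (by positivity), Inst.levels, ← hs]
    ring
  have hw : (I.w : ℝ) ^ (6 * (2 * I.k) + 1) ≤ 2 ^ (13 * I.k * s) := by
    have h1 : I.w ≤ 2 ^ s := by
      have := Nat.lt_size_self (I.w - 1)
      rw [← hs] at this
      omega
    calc (I.w : ℝ) ^ (6 * (2 * I.k) + 1) ≤ ((2 : ℝ) ^ s) ^ (6 * (2 * I.k) + 1) :=
          pow_le_pow_left₀ (Nat.cast_nonneg _) (by exact_mod_cast h1) _
      _ ≤ ((2 : ℝ) ^ s) ^ (13 * I.k) :=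
          pow_le_pow_right₀ (one_le_pow₀ (by norm_num)) (by omega)
      _ = _ := by rw [← pow_mul, mul_comm]
  have hnd : (I.n : ℝ) ≤ 2 ^ I.levels := by exact_mod_cast (Nat.lt_size_self I.n).le
  have he' := inv_two_pow_ceil_le hε
  rw [← he] at he'
  calc _ ≤ (2 : ℝ) ^ I.levels * ((2 : ℝ) ^ (13 * I.k * s) *
        (1 / (2 ^ I.levels * (2 ^ I.levels * (2 ^ (13 * I.k * s) * 2 ^ I.e))))) := by
        rw [hsqrt]
        gcongr
    _ = (1 / 2 ^ I.e) / 2 ^ I.levels := by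
        field_simp
    _ ≤ ε / I.n := by gcongr

theorem Inst.numParts_le_n : I.numParts ≤ I.n := by
  rw [Inst.numParts, numClasses]
  exact Finset.card_image_le.trans (by simp)

/-! ### The generators -/

/-- The generator on a part. -/
noncomputable def Inst.gen (hk : 1 ≤ I.k) (hn : 2 ≤ I.n) (i : Fin I.numParts) :
    (Fin I.partLen → Bool) → (Fin ((Inst.partition hk).size i) → Bool) :=
  fun y c => genSeed I.blockLen I.levels y c ⟨0, Inst.blockLen_pos hn⟩

theorem Inst.gen_fools {ε : ℝ} (hk : 1 ≤ I.k) (hn : 2 ≤ I.n) (hε : 0 < ε)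
    (he : I.e = ⌈Real.logb 2 (1 / ε)⌉₊) (i : Fin I.numParts)
    (B : ObliviousBP (Fin ((Inst.partition hk).size i)) I.w)
    (hB : HeadVisitsAtMost (2 * I.k) B.order) : Fools (ε / I.n) (Inst.gen hk hn i) B.eval := by
  have hm : (Inst.partition hk).size i ≤ 2 ^ I.levels := by
    refine le_trans ?_ (Nat.lt_size_self I.n).le
    exact (Finset.card_filter_le _ _).trans (Finset.card_range I.n).le
  exact (genSeed_fools (Inst.blockLen_pos hn) hm B hB).trans (Inst.error_le hn hk hε he)

/-- There are at most `n` parts, so the errors `ε / n` add up to at most `ε`. -/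
theorem Inst.product_fools {ε : ℝ} (hk : 1 ≤ I.k) (hn : 2 ≤ I.n) (hε : 0 < ε)
    (he : I.e = ⌈Real.logb 2 (1 / ε)⌉₊) (B : ObliviousBP (Fin I.n) I.w) (hB : B.order = I.S) :
    Fools ε ((Inst.partition hk).product (fun _ => I.partLen) (Inst.gen hk hn)) B.eval := by
  have h := ReadK.product_fools (Inst.partition hk) (fun _ => I.partLen) (Inst.gen hk hn) (ε / I.n) B
    fun i B' hB' => Inst.gen_fools hk hn hε he i B' (by
      rw [hB', hB]
      exact Inst.headVisits_part hk i)
  refine le_trans h ?_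
  have hn0 : (0 : ℝ) < I.n := by exact_mod_cast (by omega : 0 < I.n)
  rw [mul_div_assoc', div_le_iff₀ hn0, mul_comm]
  exact mul_le_mul_of_nonneg_left (by exact_mod_cast Inst.numParts_le_n) hε.le

/-- The same instance with a seed. -/
def Inst.withSeed (I : Inst) {s : ℕ} (y : Fin s → Bool) : Inst := { I with s := s, y := y }

theorem Inst.bit_eq (I : Inst) {i : ℕ} (hi : i < I.s) : I.bit i = (I.y ⟨i, hi⟩).toNat := by
  simp [Inst.bit, hi]

/-- The partition does not depend on the seed, so it is the same for `I` and `I.withSeed y`. All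
parts have equally long seeds, hence the block of the part of `x` begins at `part x * partLen`,
where the program reads it. -/
theorem Inst.out_eq (hk : 1 ≤ I.k) (hn : 2 ≤ I.n)
    (y : Fin (∑ _i : Fin I.numParts, I.partLen) → Bool) (x : Fin I.n) :
    (I.withSeed y).out x =
      ((Inst.partition hk).product (fun _ => I.partLen) (Inst.gen hk hn) y x).toNat := by
  have hx : x.1 < I.n := x.2
  refine (I.withSeed y).level_eq _ _
    (fun j : Fin I.partLen => y (finSigmaFinEquiv ⟨⟨I.part x, Inst.part_lt hk hx⟩, j⟩)) ?_
    ⟨0, Inst.blockLen_pos hn⟩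
  intro j
  have hval : ((finSigmaFinEquiv (⟨⟨I.part x, Inst.part_lt hk hx⟩, j⟩ :
      Σ _ : Fin I.numParts, Fin I.partLen) : Fin _) : ℕ) = I.part x * I.partLen + j := by
    rw [finSigmaFinEquiv_apply]
    simp
  have hlt := (finSigmaFinEquiv (⟨⟨I.part x, Inst.part_lt hk hx⟩, j⟩ :
      Σ _ : Fin I.numParts, Fin I.partLen)).2
  rw [hval] at hlt
  have hb := (I.withSeed y).bit_eq (i := I.part x * I.partLen + j) hlt
  refine Eq.trans ?_ hb.symm
  exact congrArg (fun z => (y z).toNat) (Fin.ext hval)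

end Ram

theorem theorem1 :
    -- an absolute constant, one program and one polynomial, for all parameters
    ∃ (C : ℝ) (prog : Ram.Cmd) (time : Polynomial ℕ),
      ∀ (k n w : ℕ) (ε : ℝ) (S : List (Fin n)),
        2 ≤ k → 2 ≤ n → 1 ≤ w → 0 < ε → ε ≤ 1 → (∀ x, S.count x ≤ k) →
        ∃ (t : ℕ) (Y : ReadK.OrderedPartition n t) (len : Fin t → ℕ)
          (g : ∀ i : Fin t, (Fin (len i) → Bool) → (Fin (Y.size i) → Bool)),
          -- the partition; each part is enumerated in the order of first reads
          (t : ℝ) ≤ Real.exp ((k : ℝ) ^ 2) * (n : ℝ) ^ (1 - 1 / (2 : ℝ) ^ (k - 1)) ∧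
          (∀ i, ReadK.PerReadMonotone k (Y.restrict (ReadK.padReads k S) i) ∧
            ReadK.RegularlyInterleaving k (Y.restrict (ReadK.padReads k S) i) ∧
            ∀ a b : Fin (Y.size i), a < b →
              ReadK.FirstReadLT (ReadK.padReads k S) (Y.cell ⟨i, a⟩) (Y.cell ⟨i, b⟩)) ∧
          -- the generators on the parts
          (∀ i, ∀ B : ReadK.ObliviousBP (Fin (Y.size i)) w,
            ReadK.HeadVisitsAtMost (2 * k) B.order → ReadK.Fools (ε / n) (g i) B.eval) ∧
          (∀ i, (len i : ℝ) ≤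
            C * (Real.log n * (Real.log (n / ε) + k * Real.log w))) ∧
          -- the product generator: fooling, seed length, running time
          (∀ B : ReadK.ObliviousBP (Fin n) w, B.order = S →
            ReadK.Fools ε (Y.product len g) B.eval) ∧
          ((∑ i, len i : ℕ) : ℝ) ≤
            C * (Real.exp ((k : ℝ) ^ 2) * (n : ℝ) ^ (1 - 1 / (2 : ℝ) ^ (k - 1)) *
              Real.log n * (Real.log (n / ε) + k * Real.log w)) ∧
          (∀ y : Fin (∑ i, len i) → Bool,
            Ram.OutputsWithin prog
              (Ram.input n k w ⌈Real.logb 2 (1 / ε)⌉₊ S y) (Y.product len g y)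
              (time.eval (n + k + Nat.size w + ⌈Real.logb 2 (1 / ε)⌉₊))) := by
  obtain ⟨prog, e, hprog⟩ := Ram.exists_program
    (f := fun I => I.out) (Ram.PT.out (Γ := Ram.Inst))
  refine ⟨1000, prog, (Polynomial.X + Polynomial.C 2) ^ e, ?_⟩
  intro k n w ε S hk hn hw hε hε1 hS
  -- The seed is left empty, since partition, seed lengths and generators depend on the other data
  -- only; it is supplied when the program is run.
  let I : Ram.Inst := ⟨n, k, w, ⌈Real.logb 2 (1 / ε)⌉₊, S, hS, 0, Fin.elim0⟩
  have hk' : 1 ≤ I.k := (by omega : 1 ≤ k)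
  have hn' : 2 ≤ I.n := hn
  have hT := ReadK.count_padReads S hS
  have ht : (I.numParts : ℝ) ≤
      Real.exp ((k : ℝ) ^ 2) * (n : ℝ) ^ (1 - 1 / (2 : ℝ) ^ (k - 1)) :=
    ReadK.numClasses_finalLab_le I.isTimes (by omega) hk
  have hlen : (I.partLen : ℝ) ≤ 1000 * (Real.log n * (Real.log (n / ε) + k * Real.log w)) :=
    Ram.Inst.partLen_le (I := I) hn hw hε hε1 rfl
  refine ⟨I.numParts, Ram.Inst.partition hk', fun _ => I.partLen, Ram.Inst.gen hk' hn', ht,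
    fun i => ⟨?_, ?_, fun a b => Ram.Inst.firstReadLT_cell hk' i a b⟩,
    fun i B hB => Ram.Inst.gen_fools hk' hn' hε rfl i B hB, fun _ => hlen,
    fun B hB => Ram.Inst.product_fools hk' hn' hε rfl B hB, ?_, fun y => ?_⟩
  · exact (Ram.Inst.regularClass_part hk' i).perReadMonotone hT
  · exact (Ram.Inst.regularClass_part hk' i).regularlyInterleaving hT
  · rw [Finset.sum_const, Finset.card_univ, Fintype.card_fin, smul_eq_mul, Nat.cast_mul]
    calc (I.numParts : ℝ) * I.partLen
        ≤ (Real.exp ((k : ℝ) ^ 2) * (n : ℝ) ^ (1 - 1 / (2 : ℝ) ^ (k - 1))) *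
          (1000 * (Real.log n * (Real.log (n / ε) + k * Real.log w))) :=
          mul_le_mul ht hlen (Nat.cast_nonneg _) (by positivity)
      _ = _ := by ring
  · obtain ⟨σ, T, hex, hle, hout⟩ := hprog (I.withSeed y)
    refine ⟨σ, T, hex, hle.trans (le_of_eq ?_), fun x => ?_⟩
    · simp [Ram.Inst.withSeed, Ram.Inst.size, I]
    · rw [hout x x.2]
      exact Ram.Inst.out_eq hk' hn' y x
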